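/- For a rational number $m/n$ with $\gcd(m,n)=1$ let $H(m/n)=\max(|m|,|n|)$, and for $z=(x,y)\in\mathbb{Q}^2$ let $H(z)=\max(H(x),H(y))$ and $\mathcal{B}_N=\{z\in\mathbb{Q}^2 : H(z)\le N\}$, a finite set. A property is said to hold for almost all $z\in\mathbb{Q}^2$ if the set $A$ of the points at which it holds satisfies $$\lim_{N\to\infty}\frac{\#(A\cap\mathcal{B}_N)}{\#\mathcal{B}_N}=1 .$$ Let $p$ be a prime, let $\nu_p$ be the $p$-adic order on $\mathbb{Q}$, with $\nu_p(0)=\infty$, and for $z=(x,y)\in\mathbb{Q}^2$ let $\nu_p(z)=\min(\nu_p(x),\nu_p(y))$. Theorem. Let $F(z)=\mathrm{M}z+s$ with $\mathrm{M}\in\mathrm{GL}(2,\mathbb{Q})$ and $s\in\mathbb{Q}^2$, and let $T=\operatorname{tr}\mathrm{M}$ and $D=\det\mathrm{M}$. For almost all $z\in\mathbb{Q}^2$ the limit $$h_p(z)=\lim_{t\to\infty}-\frac{1}{t}\,\nu_p(F^t(z))$$ exists, and it has the following value. If $s=(0,0)$: i) if $\nu_p(D)>2\nu_p(T)$, then $h_p(z)=-\nu_p(T)$;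 ii) if $\nu_p(D)\le 2\nu_p(T)$, then $h_p(z)=-\nu_p(D)/2$. If $s\neq(0,0)$: i) if $\nu_p(D)>2\nu_p(T)$, then $h_p(z)=\max(-\nu_p(T),0)$; ii) if $\nu_p(D)\le 2\nu_p(T)$, then $h_p(z)=\max(-\nu_p(D)/2,0)$. -/

import Mathlib

open Filter Topology

noncomputable section

namespace AffineHeight

/-- The height of a rational number: `H(m/n) = max(|m|,|n|)` for `gcd(m,n) = 1`. -/
def height (r : ℚ) : ℕ := max r.num.natAbs r.den

/-- The height of a rational point: the larger of the heights of its two coordinates. -/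
def pointHeight (z : Fin 2 → ℚ) : ℕ := max (height (z 0)) (height (z 1))

/-- The set of rational points of the plane whose height is at most `N`. -/
def heightBall (N : ℕ) : Set (Fin 2 → ℚ) := {z | pointHeight z ≤ N}

/-- `A` has density `d` in the rational plane: the proportion of the points of height at most `N`
that lie in `A` tends to `d` (these sets of points are finite, see `heightBall_finite`). -/
def HasDensity (A : Set (Fin 2 → ℚ)) (d : ℝ) : Prop :=
  Tendsto (fun N : ℕ => ((A ∩ heightBall N).ncard : ℝ) / ((heightBall N).ncard : ℝ)) atTop (𝓝 d)

/-- A property holds for almost all rational points if it holds on a set of density one. -/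
def AlmostAll (P : (Fin 2 → ℚ) → Prop) : Prop := HasDensity {z | P z} 1

/-- The `p`-adic order of a rational number, with value `∞` at `0`. -/
def ord (p : ℕ) (r : ℚ) : EReal := if r = 0 then ⊤ else ((padicValRat p r : ℝ) : EReal)

/-- The `p`-adic order of a rational point: the smaller of the orders of its two coordinates. -/
def pointOrd (p : ℕ) (z : Fin 2 → ℚ) : EReal := min (ord p (z 0)) (ord p (z 1))

/-- The affine map `z ↦ M z + s`. -/
def affine (M : GL (Fin 2) ℚ) (s : Fin 2 → ℚ) (z : Fin 2 → ℚ) : Fin 2 → ℚ :=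
  (M : Matrix (Fin 2) (Fin 2) ℚ).mulVec z + s

/-- The `p`-adic (local) height of `z` under `F` exists and equals `h`:
`-ν_p(F^t(z)) / t` converges to `h` as `t → ∞`. -/
def HasLocalHeight (p : ℕ) (F : (Fin 2 → ℚ) → (Fin 2 → ℚ)) (z : Fin 2 → ℚ) (h : EReal) : Prop :=
  Tendsto (fun t : ℕ => -pointOrd p (F^[t] z) / (t : EReal)) atTop (𝓝 h)

theorem height_finite (N : ℕ) : {r : ℚ | height r ≤ N}.Finite := by
  refine (((Set.finite_Icc (-(N : ℤ)) N).prod (Set.finite_Icc 0 N)).image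
    (fun a : ℤ × ℕ => (a.1 : ℚ) / (a.2 : ℚ))).subset ?_
  intro r hr
  have h : max r.num.natAbs r.den ≤ N := hr
  obtain ⟨h1, h2⟩ := max_le_iff.1 h
  refine ⟨(r.num, r.den), ⟨⟨?_, ?_⟩, ⟨Nat.zero_le _, h2⟩⟩, Rat.num_div_den r⟩
  · show -(N : ℤ) ≤ r.num
    omega
  · show r.num ≤ (N : ℤ)
    omega

theorem heightBall_finite (N : ℕ) : (heightBall N).Finite := by
  refine (Set.Finite.pi' (fun _ : Fin 2 => height_finite N)).subset ?_
  intro z hz i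
  have h : max (height (z 0)) (height (z 1)) ≤ N := hz
  obtain ⟨h1, h2⟩ := max_le_iff.1 h
  fin_cases i
  · exact h1
  · exact h2

end AffineHeight

end

/-! ### Interpolation determinants over the `p`-adic integers. -/

namespace AffineHeight

open Polynomial Finset

/-! Write `|·|` for the `p`-adic norm, and for the sup norm on the plane. Away from the origin
`-ν_p(z) = log_p |z|`, so the limit is the logarithm of the exponential growth rate of `|F^t z|`.

Linear part. By Cayley–Hamilton, `w_t = M^t w` satisfies `w_{t+2} = T w_{t+1} - D w_t`. If `|T|² ≤
|D|`, this recurrence, run in both directions, shows that every nonzero orbit grows like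
`|D|^(t/2)`. If `|D| < |T|²`, the term `T w_{t+1}` takes over and the norm is eventually multiplied
by exactly `|T|` at each step, except for slow vectors of size `O((|D|/|T|)^t)`. Two slow vectors
are proportional, since their determinant is multiplied by `D` at each step; so the exceptions lie
on a line, and a line has density zero.

Affine part. If the linear growth rate exceeds 1, it swamps the translation. If `|T| < 1` and `|D| <
1`, all orbits converge to a fixed point, which is nonzero because `s ≠ 0`. In the remaining cases
orbits are bounded, and the point is that almost none of them approaches the origin exponentially
fast. If `|D| = 1`, the `t`-th preimages of the origin are almost periodic in `t`, with a period
proportional to `p^k` at precision `p^(-k)`. Points whose orbits approach the origin are thus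
covered by `O(p^k)` polydiscs of radius `p^(-k)`, each of density `O(p^(-2k))`. If `|T| = 1` and
`|D| < 1`, the cases are: no fixed point, where a linear functional of the orbit is a nonconstant
affine function of `t`; a fixed point that is not an eigenvector, where the form `det(x, M x)` keeps
orbits away from the origin; and a fixed point that is an eigenvector for `μ`, where one must bound
`|μ^t a - b|` from below.

This last bound, for a rational unit `μ ≠ ±1`, is the arithmetic core (`eventually_le_of_pow_dvd`).
It is a weak form of a `p`-adic estimate for linear forms in two logarithms, obtained from an
interpolation determinant: a nonzero integer that is highly divisible by `p` and yet too small.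
Nonvanishing is `eq_zero_of_many_zeros`, divisibility is `pow_dvd_interpolationMatrix_det`. -/

theorem sum_range_card_le_sum (s : Finset ℕ) : ∑ i ∈ range #s, i ≤ ∑ x ∈ s, x := by
  have h : #s = #(s.map Nat.castEmbedding : Finset ℤ) := (card_map _).symm
  have := sum_range_le_sum (s := (s.map Nat.castEmbedding : Finset ℤ)) (c := 0) (by simp)
  rw [← h, sum_map] at this
  zify
  simpa using this

theorem half_card_le_sum_of_injective {ι : Type*} [Fintype ι] {f : ι → ℕ}
    (hf : Function.Injective f) :
    Fintype.card ι * (Fintype.card ι - 1) / 2 ≤ ∑ i, f i := by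
  classical
  have h := sum_range_card_le_sum (univ.image f)
  rw [card_image_of_injective _ hf, sum_image (fun _ _ _ _ h => hf h), Finset.sum_range_id,
    card_univ] at h
  exact h

/-- Polynomials whose `j`-th coefficients are divisible by `π ^ j` have generalized Vandermonde
determinants divisible by a power of `π` of quadratic exponent. -/
theorem pow_dvd_det_eval {R ι : Type*} [CommRing R] [Fintype ι] [DecidableEq ι] (π : R)
    (f : ι → R[X]) (hf : ∀ i j, π ^ j ∣ (f i).coeff j) (x : ι → R) :
    π ^ (Fintype.card ι * (Fintype.card ι - 1) / 2) ∣
      (Matrix.of fun i j => (f i).eval (x j)).det := by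
  choose c hc using hf
  have h : (Matrix.of fun i j => (f i).eval (x j)) =
      fun i => ∑ k ∈ range ((f i).natDegree + 1), (π ^ k * c i k) • fun j => x j ^ k := by
    funext i j
    simp only [Matrix.of_apply, eval_eq_sum_range, Finset.sum_apply, Pi.smul_apply, smul_eq_mul,
      hc]
  rw [h]
  change _ ∣ Matrix.detRowAlternating _
  rw [← AlternatingMap.coe_multilinearMap, MultilinearMap.map_sum_finset]
  refine dvd_sum fun r _ => ?_
  rw [MultilinearMap.map_smul_univ]
  -- `r` selects one monomial from each polynomial. A repeated exponent gives two equal rows;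
  -- distinct exponents sum to at least `0 + 1 + ⋯ + (n - 1)`.
  by_cases hr : Function.Injective r
  · refine Dvd.dvd.mul_right ?_ _
    rw [prod_mul_distrib, prod_pow_eq_pow_sum]
    exact (pow_dvd_pow _ (half_card_le_sum_of_injective hr)).mul_right _
  · obtain ⟨a, b, hab, hne⟩ := Function.not_injective_iff.1 hr
    rw [AlternatingMap.coe_multilinearMap,
      AlternatingMap.map_eq_zero_of_eq _ _ (by rw [hab]) hne, smul_zero]
    exact dvd_zero _

section Padic

variable {p : ℕ} [Fact p.Prime]

variable (p) in
-- Since `v_p(i!) ≤ i`, the quotient `p ^ i / i!` is `p`-integral. It absorbs the denominators of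
-- binomial coefficients.
theorem exists_factorial_mul_eq_pow (i : ℕ) :
    ∃ b : ℤ_[p], (i.factorial : ℤ_[p]) * b = (p : ℤ_[p]) ^ i := by
  have hp : p.Prime := Fact.out
  have h1 : padicValNat p i.factorial ≤ i := padicValNat_factorial_le p i
  have h0 : (i.factorial : ℤ_[p]) ≠ 0 := by exact_mod_cast i.factorial_ne_zero
  have hv : (i.factorial : ℤ_[p]).valuation ≤ i := by
    zify; rw [← PadicInt.valuation_coe, PadicInt.coe_natCast, Padic.valuation_natCast]; exact_mod_cast h1
  have : (p : ℤ_[p]) ^ i ∈ Ideal.span {(p : ℤ_[p]) ^ (i.factorial : ℤ_[p]).valuation} :=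
    Ideal.mem_span_singleton.2 (pow_dvd_pow _ hv)
  rw [Ideal.mem_span_singleton] at this
  obtain ⟨c, hc⟩ := this
  refine ⟨((PadicInt.unitCoeff h0)⁻¹ : ℤ_[p]ˣ) * c, ?_⟩
  rw [hc]
  calc _ = ((PadicInt.unitCoeff h0 : ℤ_[p]ˣ) * (p : ℤ_[p]) ^ (i.factorial : ℤ_[p]).valuation) *
        (((PadicInt.unitCoeff h0)⁻¹ : ℤ_[p]ˣ) * c) := by rw [← PadicInt.unitCoeff_spec h0]
    _ = ((PadicInt.unitCoeff h0 : ℤ_[p]ˣ) * ((PadicInt.unitCoeff h0)⁻¹ : ℤ_[p]ˣ) : ℤ_[p])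
        * ((p : ℤ_[p]) ^ (i.factorial : ℤ_[p]).valuation * c) := by ring
    _ = _ := by rw [Units.mul_inv, one_mul]

/-- Powers of a `p`-adic integer congruent to `1` modulo `p ^ 2` are interpolated by a polynomial
with rapidly decreasing coefficients. -/
theorem exists_polynomial_eval_eq_pow (x : ℤ_[p]) (hx : (p : ℤ_[p]) ^ 2 ∣ x - 1) (J : ℕ) :
    ∃ P : ℤ_[p][X], (∀ j, (p : ℤ_[p]) ^ j ∣ P.coeff j) ∧
      ∀ n : ℕ, n < J → P.eval (n : ℤ_[p]) = x ^ n := by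
  obtain ⟨μ, hμ⟩ := hx
  choose b hb using fun i => exists_factorial_mul_eq_pow p i
  -- Binomial expansion of `(1 + p² μ)^n`: of the factor `p^(2i)`, one half pays for `i!` and the
  -- other remains in the coefficients. Terms with `i > n` vanish at `n`, so truncation at `J` is
  -- exact for `n < J`.
  refine ⟨∑ i ∈ range J, C ((p : ℤ_[p]) ^ i * (b i * μ ^ i)) * descPochhammer ℤ_[p] i, ?_, ?_⟩
  · intro j
    rw [finsetSum_coeff]
    refine dvd_sum fun i _ => ?_
    rw [coeff_C_mul]
    rcases lt_or_ge i j with hij | hij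
    · rw [coeff_eq_zero_of_natDegree_lt (by rwa [descPochhammer_natDegree]), mul_zero]
      exact dvd_zero _
    · exact ((pow_dvd_pow _ hij).mul_right _).mul_right _
  · intro n hn
    have hx' : x = (p : ℤ_[p]) ^ 2 * μ + 1 := by rw [← hμ]; ring
    rw [hx', add_pow, eval_finsetSum]
    have hsub : range (n + 1) ⊆ range J := range_subset_range.2 hn
    rw [← sum_subset hsub]
    · refine sum_congr rfl fun i _ => ?_
      rw [eval_mul, eval_C, descPochhammer_eval_eq_descFactorial,
        Nat.descFactorial_eq_factorial_mul_choose, one_pow, mul_one, Nat.cast_mul, mul_pow]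
      calc _ = (p : ℤ_[p]) ^ i * ((i.factorial : ℤ_[p]) * b i) * μ ^ i * (n.choose i) := by ring
        _ = _ := by rw [hb]; ring
    · intro i _ hi
      rw [eval_mul, descPochhammer_eval_eq_descFactorial,
        Nat.descFactorial_eq_zero_iff_lt.2 (by simpa using hi), Nat.cast_zero, mul_zero]

end Padic

/-- The hypothesis says that no nonzero linear form kills all rows, so the rows span and a basis can
be picked among them. -/
theorem exists_minor_det_ne_zero {K P ι : Type*} [Field K] [Fintype ι] [DecidableEq ι]
    (A : P → ι → K) (h : ∀ q : ι → K, (∀ x, ∑ i, A x i * q i = 0) → q = 0) :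
    ∃ f : ι → P, (Matrix.of fun i j => A (f i) j).det ≠ 0 := by
  have htop : ⊤ ≤ Submodule.span K (Set.range A) := by
    by_contra hne
    obtain ⟨φ, hφ, hle⟩ := Submodule.exists_le_ker_of_lt_top _ (lt_top_iff_ne_top.2
      fun h => hne h.ge)
    refine hφ ?_
    have hz := h (fun i => φ (Pi.single i 1)) fun x => by
      have hx : φ (A x) = 0 := hle (Submodule.subset_span ⟨x, rfl⟩)
      rw [LinearMap.pi_apply_eq_sum_univ] at hx
      rw [← hx]
      refine sum_congr rfl fun i _ => ?_
      rw [smul_eq_mul]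
      congr 2
      funext j
      rw [Pi.single_apply]
      exact if_congr eq_comm rfl rfl
    refine LinearMap.pi_ext' fun i => LinearMap.ext_ring ?_
    simpa using congrFun hz i
  let b := Module.Basis.ofSpan htop
  have hfin : Fintype _ := b.fintypeIndexOfRankLtAleph0 (by
    exact Module.rank_lt_aleph0 K (ι → K))
  have hcard : Fintype.card ι = Fintype.card _ :=
    (Module.finrank_fintype_fun_eq_card K).symm.trans (Module.finrank_eq_card_basis b)
  let e := Fintype.equivOfCardEq hcard
  have hmem : ∀ i, b (e i) ∈ Set.range A := fun i =>
    Module.Basis.ofSpan_subset htop ⟨e i, rfl⟩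
  choose f hf using hmem
  refine ⟨f, ?_⟩
  have hli : LinearIndependent K (fun i => A (f i)) := by
    simp_rw [hf]
    exact b.linearIndependent.comp _ e.injective
  have := (Matrix.linearIndependent_rows_iff_isUnit (A := Matrix.of fun i j => A (f i) j)).1 hli
  exact ((Matrix.isUnit_iff_isUnit_det _).1 this).ne_zero

theorem coeff_prod_sum_of_natDegree_le {R ι : Type*} [CommRing R] (s : Finset ι) (f : ι → R[X])
    (d : ι → ℕ) (h : ∀ i ∈ s, (f i).natDegree ≤ d i) :
    (∏ i ∈ s, f i).coeff (∑ i ∈ s, d i) = ∏ i ∈ s, (f i).coeff (d i) := by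
  classical
  induction s using Finset.induction_on with
  | empty => simp
  | insert a s ha ih =>
    rw [prod_insert ha, sum_insert ha, prod_insert ha, coeff_mul_add_eq_of_natDegree_le
      (h a (mem_insert_self _ _)), ih fun i hi => h i (mem_insert_of_mem hi)]
    exact (natDegree_prod_le _ _).trans (sum_le_sum fun i hi => h i (mem_insert_of_mem hi))

/-- Each Leibniz term takes one entry from every column, so column degree bounds add up and the top
coefficients form a determinant of their own. -/
theorem coeff_det_of_natDegree_le {R ι : Type*} [CommRing R] [Fintype ι] [DecidableEq ι]
    (A : Matrix ι ι R[X]) (d : ι → ℕ) (h : ∀ i j, (A i j).natDegree ≤ d j) :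
    A.det.coeff (∑ j, d j) = (Matrix.of fun i j => (A i j).coeff (d j)).det := by
  rw [Matrix.det_apply, Matrix.det_apply, finsetSum_coeff]
  refine sum_congr rfl fun σ _ => ?_
  rw [Units.smul_def, Units.smul_def, coeff_smul,
    coeff_prod_sum_of_natDegree_le _ _ _ fun i _ => h _ i]
  rfl

/-- An exponential polynomial `∑ Q_l(x) y ^ l` on the group generated by `(1, a)` and `(t, c)`
with too many zeros vanishes identically. -/
theorem eq_zero_of_many_zeros {F : Type*} [Field F] [CharZero F] (a c : F) (hc : c ≠ 0) (ha : a ≠ 0)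
    (K L R S t : ℕ) (hinj : Function.Injective fun l : ℕ => a ^ l)
    (hRS : (K - 1) * L < R * S) (ht : R ≤ t) (q : Fin K × Fin L → F)
    (h : ∀ r s : ℕ, r < R + L → s < S →
      ∑ i : Fin K × Fin L, ((r + t * s : ℕ) : F) ^ (i.1 : ℕ) * (a ^ r * c ^ s) ^ (i.2 : ℕ) * q i = 0) :
    q = 0 := by
  classical
  by_contra hq
  let Q : Fin L → F[X] := fun l => ∑ k : Fin K, C (q (k, l)) * X ^ (k : ℕ)
  have hQeval : ∀ l x, (Q l).eval x = ∑ k : Fin K, q (k, l) * x ^ (k : ℕ) := by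
    intro l x; simp [Q, eval_finsetSum]
  have hQdeg : ∀ l, (Q l).natDegree ≤ K - 1 := by
    intro l
    refine natDegree_sum_le_of_forall_le _ _ fun k _ => ?_
    exact (natDegree_C_mul_X_pow_le _ _).trans (by omega)
  have hQcoeff : ∀ (l : Fin L) (k : Fin K), (Q l).coeff k = q (k, l) := by
    intro l k
    simp [Q, coeff_X_pow, Fin.val_inj]
  have hzero : ∀ r s : ℕ, r < R + L → s < S →
      ∑ l : Fin L, (Q l).eval ((r + t * s : ℕ) : F) * (a ^ r * c ^ s) ^ (l : ℕ) = 0 := by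
    intro r s hr hs
    rw [← h r s hr hs, Fintype.sum_prod_type_right]
    refine sum_congr rfl fun l _ => ?_
    rw [hQeval, sum_mul]
    exact sum_congr rfl fun k _ => by ring
  let I : Finset (Fin L) := univ.filter fun l => Q l ≠ 0
  let e : Fin #I ≃ I := (I.equivFin).symm
  have hI : 0 < #I := by
    rw [card_pos]
    by_contra hI
    refine hq (funext fun ⟨k, l⟩ => ?_)
    have : Q l = 0 := by
      by_contra hl
      exact hI ⟨l, by simp [I, hl]⟩
    rw [← hQcoeff, this]; simp
  have hIL : #I ≤ L := (card_le_univ _).trans (by simp)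
  -- Row `i` records the relation at the point shifted by `i` steps of `(1, a)`. The extra `L`
  -- values of `r` in the hypothesis leave room for these shifts. Zero polynomials `Q l` are
  -- discarded so that leading coefficients are nonzero.
  let A : Matrix (Fin #I) (Fin #I) F[X] := Matrix.of fun i j =>
    C (a ^ ((i : ℕ) * (e j : Fin L))) * (Q (e j)).comp (X + C ((i : ℕ) : F))
  have hAdeg : ∀ i j, (A i j).natDegree ≤ (Q (e j)).natDegree := by
    intro i j
    refine (natDegree_C_mul_le _ _).trans ?_
    change ((Q (e j)).comp (X + C ((i : ℕ) : F))).natDegree ≤ _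
    rw [natDegree_comp, natDegree_X_add_C, mul_one]
  have hlead : ∀ i j, (A i j).coeff ((Q (e j)).natDegree) =
      (a ^ ((e j : Fin L) : ℕ)) ^ (i : ℕ) * (Q (e j)).leadingCoeff := by
    intro i j
    have hn : ((Q (e j)).comp (X + C ((i : ℕ) : F))).natDegree = (Q (e j)).natDegree := by
      rw [natDegree_comp, natDegree_X_add_C, mul_one]
    simp only [A, Matrix.of_apply, coeff_C_mul]
    nth_rewrite 1 [← hn]
    rw [coeff_natDegree, leadingCoeff_comp (by rw [natDegree_X_add_C]; norm_num)]
    rw [leadingCoeff_X_add_C, one_pow, mul_one, ← pow_mul, mul_comm (i : ℕ)]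
  -- The top coefficient is a product of leading coefficients times a Vandermonde determinant in the
  -- distinct powers `a ^ l`.
  have hdet : A.det ≠ 0 := by
    intro h0
    have h1 := coeff_det_of_natDegree_le A _ hAdeg
    rw [h0, coeff_zero] at h1
    have h2 : (Matrix.of fun i j => (A i j).coeff ((Q (e j)).natDegree)) = Matrix.of fun i j =>
        (Q (e j)).leadingCoeff *
          (Matrix.vandermonde fun j => a ^ ((e j : Fin L) : ℕ)).transpose i j := by
      ext i j
      rw [Matrix.of_apply, hlead, Matrix.of_apply, Matrix.transpose_apply, Matrix.vandermonde_apply,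
        mul_comm]
    rw [h2, Matrix.det_mul_row, Matrix.det_transpose] at h1
    refine mul_ne_zero ?_ ?_ h1.symm
    · refine prod_ne_zero_iff.2 fun j _ => ?_
      have := (e j).2
      simp only [I, mem_filter] at this
      exact leadingCoeff_ne_zero.2 this.2
    · rw [Matrix.det_vandermonde_ne_zero_iff]
      intro i j hij
      exact e.injective (Subtype.ext (Fin.ext (hinj hij)))
  -- The powers of `a ^ r * c ^ s` form a nonzero kernel vector of the matrix evaluated at `r + t *
  -- s`. This yields `R * S` distinct roots, more than the degree allows.
  have hroot : ∀ r s : ℕ, r < R → s < S → A.det.eval ((r + t * s : ℕ) : F) = 0 := by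
    intro r s hr hs
    rw [← coe_evalRingHom, RingHom.map_det, ← Matrix.exists_mulVec_eq_zero_iff]
    refine ⟨fun j => (a ^ r * c ^ s) ^ ((e j : Fin L) : ℕ), ?_, ?_⟩
    · intro h0
      have := congrFun h0 ⟨0, hI⟩
      exact pow_ne_zero _ (mul_ne_zero (pow_ne_zero _ ha) (pow_ne_zero _ hc)) this
    · funext i
      have hz := hzero (r + i) s (by omega) hs
      have hfilter : ∑ l : Fin L, (Q l).eval ((r + i + t * s : ℕ) : F) * (a ^ (r + i : ℕ) * c ^ s) ^ (l : ℕ) =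
          ∑ l ∈ I, (Q l).eval ((r + i + t * s : ℕ) : F) * (a ^ (r + i : ℕ) * c ^ s) ^ (l : ℕ) := by
        symm
        refine sum_subset (subset_univ _) fun l _ hl => ?_
        have : Q l = 0 := by simpa [I] using hl
        rw [this, eval_zero, zero_mul]
      refine Eq.trans ?_ (hfilter.symm.trans hz)
      rw [← sum_coe_sort I]
      refine Eq.trans ?_ (e.sum_comp _)
      rw [Matrix.mulVec, dotProduct]
      refine sum_congr rfl fun j _ => ?_
      simp only [RingHom.mapMatrix_apply, Matrix.map_apply, A, Matrix.of_apply, coe_evalRingHom,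
        eval_mul, eval_C, eval_comp, eval_add, eval_X]
      push_cast
      rw [show (r : F) + t * s + i = r + i + t * s by ring]
      ring
  have hdeg : A.det.natDegree ≤ (K - 1) * L := by
    have h3 : A.det.natDegree ≤ ∑ j : Fin #I, (K - 1) := by
      rw [Matrix.det_apply]
      refine natDegree_sum_le_of_forall_le _ _ fun σ _ => ?_
      rw [Units.smul_def]
      refine (natDegree_smul_le _ _).trans ((natDegree_prod_le _ _).trans
        (sum_le_sum fun j _ => (hAdeg _ j).trans (hQdeg _)))
    refine h3.trans ?_
    rw [sum_const, card_univ, Fintype.card_fin, smul_eq_mul, mul_comm]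
    exact Nat.mul_le_mul_left _ hIL
  have hinjpt : Set.InjOn (fun x : ℕ × ℕ => ((x.1 + t * x.2 : ℕ) : F))
      (range R ×ˢ range S : Finset (ℕ × ℕ)) := by
    rintro ⟨r, s⟩ h1 ⟨r', s'⟩ h2 h3
    simp only [coe_product, Set.mem_prod, coe_range, Set.mem_Iio] at h1 h2
    have h4 : r + t * s = r' + t * s' := Nat.cast_injective (R := F) h3
    have hmod : r = r' := by
      have := congrArg (· % t) h4
      simpa [Nat.add_mul_mod_self_left, Nat.mod_eq_of_lt (h1.1.trans_le ht),
        Nat.mod_eq_of_lt (h2.1.trans_le ht)] using this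
    subst hmod
    have : t * s = t * s' := by omega
    rw [Nat.eq_of_mul_eq_mul_left (by omega) this]
  have hcard : #((range R ×ˢ range S).image fun x : ℕ × ℕ => ((x.1 + t * x.2 : ℕ) : F)) = R * S := by
    rw [card_image_of_injOn hinjpt, card_product, card_range, card_range]
  have hsub := card_le_degree_of_subset_roots (p := A.det)
    (Z := (range R ×ˢ range S).image fun x : ℕ × ℕ => ((x.1 + t * x.2 : ℕ) : F)) (by
      intro x hx
      rw [mem_val, mem_image] at hx
      obtain ⟨⟨r, s⟩, hrs, rfl⟩ := hx
      rw [mem_product, mem_range, mem_range] at hrs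
      exact (mem_roots hdet).2 (hroot r s hrs.1 hrs.2))
  omega

/-- The interpolation matrix with entries `n ^ k * (a ^ r * c ^ s) ^ l`, where `n = r + t * s`. -/
def interpolationMatrix {A : Type*} [CommRing A] (K L t : ℕ) {R S : ℕ} (a c : A)
    (f : Fin K × Fin L → Fin R × Fin S) : Matrix (Fin K × Fin L) (Fin K × Fin L) A :=
  Matrix.of fun i j => (((f i).1 + t * (f i).2 : ℕ) : A) ^ (j.1 : ℕ) *
    (a ^ ((f i).1 : ℕ) * c ^ ((f i).2 : ℕ)) ^ (j.2 : ℕ)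

/-- The interpolation matrix for `a = u / v`, `c = g / h` with denominators cleared. -/
def integralInterpolationMatrix (K L t : ℕ) {R S : ℕ} (u v g h : ℤ)
    (f : Fin K × Fin L → Fin R × Fin S) : Matrix (Fin K × Fin L) (Fin K × Fin L) ℤ :=
  Matrix.of fun i j => (((f i).1 + t * (f i).2 : ℕ) : ℤ) ^ (j.1 : ℕ) *
    ((u ^ (j.2 * (f i).1 : ℕ) * v ^ (L * R - j.2 * (f i).1)) *
     (g ^ (j.2 * (f i).2 : ℕ) * h ^ (L * S - j.2 * (f i).2)))

theorem map_integralInterpolationMatrix {A : Type*} [CommRing A] (K L t : ℕ) {R S : ℕ}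
    (u v g h : ℤ) (a c : A) (ha : a * v = u) (hc : c * h = g)
    (f : Fin K × Fin L → Fin R × Fin S) :
    (integralInterpolationMatrix K L t u v g h f).map (Int.cast : ℤ → A) =
      ((v : A) ^ (L * R) * (h : A) ^ (L * S)) • interpolationMatrix K L t a c f := by
  ext i j
  have h1 : (j.2 * (f i).1 : ℕ) ≤ L * R := Nat.mul_le_mul j.2.2.le (f i).1.2.le
  have h2 : (j.2 * (f i).2 : ℕ) ≤ L * S := Nat.mul_le_mul j.2.2.le (f i).2.2.le
  simp only [integralInterpolationMatrix, interpolationMatrix, Matrix.map_apply, Matrix.of_apply,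
    Matrix.smul_apply, smul_eq_mul, Int.cast_mul, Int.cast_pow, ← ha, ← hc, Int.cast_natCast]
  conv_rhs => rw [← Nat.sub_add_cancel h1, ← Nat.sub_add_cancel h2, pow_add, pow_add]
  rw [mul_pow, mul_pow, mul_pow, ← pow_mul, ← pow_mul, mul_comm ((f i).1 : ℕ),
    mul_comm ((f i).2 : ℕ)]
  ring

theorem cast_det_integralInterpolationMatrix {A : Type*} [CommRing A] (K L t : ℕ) {R S : ℕ}
    (u v g h : ℤ) (a c : A) (ha : a * v = u) (hc : c * h = g)
    (f : Fin K × Fin L → Fin R × Fin S) :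
    ((integralInterpolationMatrix K L t u v g h f).det : A) =
      ((v : A) ^ (L * R) * (h : A) ^ (L * S)) ^ (K * L) * (interpolationMatrix K L t a c f).det := by
  have := congrArg Matrix.det (map_integralInterpolationMatrix K L t u v g h a c ha hc f)
  rw [Matrix.det_smul] at this
  simp only [Fintype.card_prod, Fintype.card_fin] at this
  rw [← this]
  exact RingHom.map_det (Int.castRingHom A) _

theorem abs_det_integralInterpolationMatrix_le (K L t : ℕ) {R S : ℕ} (u v g h : ℤ) (H : ℕ)
    (hH : 1 ≤ H) (hu : |u| ≤ H) (hv : |v| ≤ H) (hg : |g| ≤ H) (hh : |h| ≤ H)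
    (f : Fin K × Fin L → Fin R × Fin S) :
    |(integralInterpolationMatrix K L t u v g h f).det| ≤
      ((K * L) ^ (K * L) * ((R + t * S) ^ K * H ^ (L * (R + S))) ^ (K * L) : ℕ) := by
  have hent : ∀ i j, |integralInterpolationMatrix K L t u v g h f i j| ≤
      (((R + t * S) ^ K * H ^ (L * (R + S)) : ℕ) : ℤ) := by
    intro i j
    have h1 : (j.2 * (f i).1 : ℕ) ≤ L * R := Nat.mul_le_mul j.2.2.le (f i).1.2.le
    have h2 : (j.2 * (f i).2 : ℕ) ≤ L * S := Nat.mul_le_mul j.2.2.le (f i).2.2.le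
    have hn : (((f i).1 + t * (f i).2 : ℕ)) ^ (j.1 : ℕ) ≤ (R + t * S) ^ K := by
      have hR := (f i).1.2
      have hle : ((f i).1 + t * (f i).2 : ℕ) ≤ R + t * S :=
        Nat.add_le_add hR.le (Nat.mul_le_mul_left _ (f i).2.2.le)
      exact (Nat.pow_le_pow_left hle _).trans (Nat.pow_le_pow_right (by omega) j.1.2.le)
    simp only [integralInterpolationMatrix, Matrix.of_apply, abs_mul, abs_pow, Nat.abs_cast]
    rw [mul_add, pow_add]
    push_cast
    have e1 : (H : ℤ) ^ (L * R) = (H : ℤ) ^ (j.2 * (f i).1 : ℕ) * (H : ℤ) ^ (L * R - j.2 * (f i).1) := by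
      rw [← pow_add, Nat.add_sub_cancel' h1]
    have e2 : (H : ℤ) ^ (L * S) = (H : ℤ) ^ (j.2 * (f i).2 : ℕ) * (H : ℤ) ^ (L * S - j.2 * (f i).2) := by
      rw [← pow_add, Nat.add_sub_cancel' h2]
    rw [e1, e2]
    have hn' : (((f i).1 : ℤ) + t * (f i).2) ^ (j.1 : ℕ) ≤ ((R : ℤ) + t * S) ^ K := by exact_mod_cast hn
    gcongr
  have hdet := Matrix.det_le (abv := AbsoluteValue.abs) hent
  simp only [Fintype.card_prod, Fintype.card_fin, nsmul_eq_mul] at hdet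
  refine hdet.trans ?_
  push_cast
  gcongr
  exact_mod_cast Nat.factorial_le_pow _

theorem exists_interpolationMatrix_det_ne_zero {F : Type*} [Field F] [CharZero F] (a c : F)
    (hc : c ≠ 0) (ha : a ≠ 0) (K L R S t : ℕ) (hinj : Function.Injective fun l : ℕ => a ^ l)
    (hRS : (K - 1) * L < R * S) (ht : R ≤ t) :
    ∃ f : Fin K × Fin L → Fin (R + L) × Fin S, (interpolationMatrix K L t a c f).det ≠ 0 := by
  refine exists_minor_det_ne_zero (P := Fin (R + L) × Fin S) (fun x (j : Fin K × Fin L) =>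
    ((x.1 + t * x.2 : ℕ) : F) ^ (j.1 : ℕ) *
    (a ^ (x.1 : ℕ) * c ^ (x.2 : ℕ)) ^ (j.2 : ℕ)) fun q hq => ?_
  exact eq_zero_of_many_zeros a c hc ha K L R S t hinj hRS ht q fun r s hr hs =>
    hq (⟨r, hr⟩, ⟨s, hs⟩)

/-- Replacing `c` by `a ^ t` changes the determinant by a multiple of `p ^ V`. After that the
entries are `n ^ k * a ^ (n * l)`, functions of `n` alone that are interpolated by polynomials with
rapidly decreasing coefficients, so `pow_dvd_det_eval` applies with size `K * L`. -/
theorem pow_dvd_interpolationMatrix_det {p : ℕ} [Fact p.Prime] (K L t V : ℕ) {R S : ℕ}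
    (a c : ℤ_[p]) (ha : (p : ℤ_[p]) ^ 2 ∣ a - 1) (hc : (p : ℤ_[p]) ^ V ∣ c - a ^ t)
    (f : Fin K × Fin L → Fin R × Fin S) :
    (p : ℤ_[p]) ^ (min V (K * L * (K * L - 1) / 2 - K * L * K)) ∣
      (interpolationMatrix K L t a c f).det := by
  set W := K * L * (K * L - 1) / 2 - K * L * K with hW
  have hsplit : (p : ℤ_[p]) ^ (min V W) ∣
      (interpolationMatrix K L t a c f).det - (interpolationMatrix K L t a (a ^ t) f).det := by
    refine (pow_dvd_pow _ (min_le_left V W)).trans ?_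
    rw [← Ideal.mem_span_singleton, ← Ideal.Quotient.eq, RingHom.map_det, RingHom.map_det]
    congr 1
    ext i j
    have : Ideal.Quotient.mk (Ideal.span {(p : ℤ_[p]) ^ V}) c = Ideal.Quotient.mk _ (a ^ t) :=
      Ideal.Quotient.eq.2 (Ideal.mem_span_singleton.2 hc)
    simp only [interpolationMatrix, RingHom.mapMatrix_apply, Matrix.map_apply, Matrix.of_apply,
      map_mul, map_pow] at this ⊢
    rw [this]
  refine (dvd_iff_dvd_of_dvd_sub hsplit).2 ((pow_dvd_pow _ (min_le_right V W)).trans ?_)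
  have hpow : ∀ l : ℕ, (p : ℤ_[p]) ^ 2 ∣ a ^ l - 1 := fun l =>
    ha.trans (by simpa using sub_dvd_pow_sub_pow a 1 l)
  choose P hP hPe using fun l => exists_polynomial_eval_eq_pow (a ^ l) (hpow l) (R + t * S)
  -- Multiplication by `X ^ k` shifts the coefficients, so a factor `p ^ k` is inserted to restore
  -- their divisibility. Removing these factors at the end costs at most `K * L * K` in the
  -- exponent.
  have hdvd := pow_dvd_det_eval (p : ℤ_[p])
    (fun j : Fin K × Fin L => C ((p : ℤ_[p]) ^ (j.1 : ℕ)) * (X ^ (j.1 : ℕ) * P j.2)) (by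
      intro j m
      rw [coeff_C_mul, coeff_X_pow_mul']
      split_ifs with hm
      · conv_lhs => rw [← Nat.add_sub_cancel' hm, pow_add]
        exact mul_dvd_mul_left _ (hP _ _)
      · rw [mul_zero]; exact dvd_zero _)
    (fun i => (((f i).1 + t * (f i).2 : ℕ) : ℤ_[p]))
  have hmat : (Matrix.of fun (j i : Fin K × Fin L) =>
      eval (((f i).1 + t * (f i).2 : ℕ) : ℤ_[p])
        (C ((p : ℤ_[p]) ^ (j.1 : ℕ)) * (X ^ (j.1 : ℕ) * P j.2))) =
      Matrix.of fun j i => (p : ℤ_[p]) ^ (j.1 : ℕ) *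
        (interpolationMatrix K L t a (a ^ t) f).transpose j i := by
    ext j i
    have hlt : ((f i).1 + t * (f i).2 : ℕ) < R + t * S :=
      Nat.add_lt_add_of_lt_of_le (f i).1.2 (Nat.mul_le_mul_left _ (f i).2.2.le)
    simp only [Matrix.of_apply, eval_mul, eval_C, eval_pow, eval_X, hPe _ _ hlt,
      Matrix.transpose_apply, interpolationMatrix]
    rw [← pow_mul a t, ← pow_add, ← pow_mul, ← pow_mul, mul_comm (j.2 : ℕ)]
  rw [hmat, Matrix.det_mul_column, Matrix.det_transpose, Fintype.card_prod, Fintype.card_fin,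
    Fintype.card_fin, prod_pow_eq_pow_sum] at hdvd
  have hsum : ∑ j : Fin K × Fin L, (j.1 : ℕ) ≤ K * L * K := by
    calc _ ≤ ∑ j : Fin K × Fin L, K := sum_le_sum fun j _ => j.1.2.le
      _ = _ := by simp
  have hp0 : (p : ℤ_[p]) ≠ 0 := by exact_mod_cast (Fact.out : p.Prime).ne_zero
  rcases Nat.le_total (K * L * (K * L - 1) / 2) (K * L * K) with hle | hle
  · rw [hW, Nat.sub_eq_zero_of_le hle, pow_zero]; exact one_dvd _
  · refine (mul_dvd_mul_iff_left (pow_ne_zero (∑ j : Fin K × Fin L, (j.1 : ℕ)) hp0)).1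
      (dvd_trans ?_ hdvd)
    rw [← pow_add]
    exact pow_dvd_pow _ (by omega)

/-- The fundamental inequality of the interpolation determinant method. -/
theorem pow_le_of_pow_dvd {p : ℕ} [Fact p.Prime] (u v g h : ℤ) (H K L R S t V : ℕ)
    (hH : 1 ≤ H) (hu : |u| ≤ H) (hv : |v| ≤ H) (hg : |g| ≤ H) (hh : |h| ≤ H)
    (hu0 : u ≠ 0) (hg0 : g ≠ 0) (hpv : ¬ (p : ℤ) ∣ v) (hph : ¬ (p : ℤ) ∣ h)
    (hinj : Function.Injective fun l : ℕ => ((u : ℚ) / v) ^ l)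
    (huv : (p : ℤ) ^ 2 ∣ u - v) (hV : (p : ℤ) ^ V ∣ g * v ^ t - h * u ^ t)
    (hRS : (K - 1) * L < R * S) (ht : R ≤ t) :
    p ^ (min V (K * L * (K * L - 1) / 2 - K * L * K)) ≤
      (K * L) ^ (K * L) * ((R + L + t * S) ^ K * H ^ (L * (R + L + S))) ^ (K * L) := by
  have hv0 : (v : ℚ) ≠ 0 := by
    rintro h0
    exact hpv (by rw [Int.cast_eq_zero.1 h0]; exact dvd_zero _)
  have hh0 : (h : ℚ) ≠ 0 := by
    rintro h0
    exact hph (by rw [Int.cast_eq_zero.1 h0]; exact dvd_zero _)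
  -- One choice of points `f` serves twice: the integral determinant is nonzero by comparison with
  -- `ℚ` and divisible by a power of `p` by comparison with `ℤ_[p]`. Its archimedean size then
  -- bounds that power.
  obtain ⟨f, hf⟩ := exists_interpolationMatrix_det_ne_zero ((u : ℚ) / v) ((g : ℚ) / h)
    (div_ne_zero (by exact_mod_cast hg0) hh0) (div_ne_zero (by exact_mod_cast hu0) hv0)
    K L R S t hinj hRS ht
  have hunit : ∀ {w : ℤ}, ¬ (p : ℤ) ∣ w → IsUnit (w : ℤ_[p]) := by
    intro w hw
    rw [PadicInt.isUnit_iff]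
    refine le_antisymm (PadicInt.norm_le_one _) (not_lt.1 fun hlt => hw ?_)
    exact PadicInt.norm_int_lt_one_iff_dvd _ |>.1 hlt
  obtain ⟨v', hv'⟩ := hunit hpv
  obtain ⟨h', hh'⟩ := hunit hph
  have ha : ((u : ℤ_[p]) * (v'⁻¹ : ℤ_[p]ˣ)) * v = u := by
    rw [← hv', mul_assoc, Units.inv_mul, mul_one]
  have hc : ((g : ℤ_[p]) * (h'⁻¹ : ℤ_[p]ˣ)) * h = g := by
    rw [← hh', mul_assoc, Units.inv_mul, mul_one]
  have hcast : ∀ {n : ℕ} {w : ℤ}, (p : ℤ) ^ n ∣ w → (p : ℤ_[p]) ^ n ∣ (w : ℤ_[p]) := fun hw =>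
    (PadicInt.pow_p_dvd_int_iff _ _).2 hw
  have hdvd := pow_dvd_interpolationMatrix_det K L t V (u * (v'⁻¹ : ℤ_[p]ˣ) : ℤ_[p])
    (g * (h'⁻¹ : ℤ_[p]ˣ) : ℤ_[p]) (by
      have h1 := hcast huv
      push_cast at h1
      refine (Units.dvd_mul_right (u := v')).1 ?_
      rwa [sub_mul, mul_assoc, Units.inv_mul, mul_one, one_mul, hv']) (by
      have h1 := hcast hV
      push_cast at h1
      refine (Units.dvd_mul_right (u := h' * v' ^ t)).1 ?_
      convert h1 using 1
      rw [mul_pow, sub_mul, Units.val_mul, Units.val_pow_eq_pow_val]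
      calc _ = (g : ℤ_[p]) * ((h'⁻¹ : ℤ_[p]ˣ) * h') * v' ^ t -
            h' * u ^ t * ((v'⁻¹ : ℤ_[p]ˣ) * v') ^ t := by ring
        _ = _ := by rw [Units.inv_mul, Units.inv_mul, hh', hv']; ring) f
  have hE : (p : ℤ) ^ (min V (K * L * (K * L - 1) / 2 - K * L * K)) ∣
      (integralInterpolationMatrix K L t u v g h f).det := by
    rw [← PadicInt.pow_p_dvd_int_iff, cast_det_integralInterpolationMatrix K L t u v g h _ _ ha hc]
    exact hdvd.mul_left _
  have hE0 : (integralInterpolationMatrix K L t u v g h f).det ≠ 0 := by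
    intro h0
    have h1 := cast_det_integralInterpolationMatrix K L t u v g h ((u : ℚ) / v) ((g : ℚ) / h)
      (div_mul_cancel₀ _ hv0) (div_mul_cancel₀ _ hh0) f
    rw [h0, Int.cast_zero] at h1
    exact mul_ne_zero (pow_ne_zero _ (mul_ne_zero (pow_ne_zero _ hv0) (pow_ne_zero _ hh0))) hf h1.symm
  have h1 := Int.le_of_dvd (abs_pos.2 hE0) ((dvd_abs _ _).2 hE)
  have h2 := h1.trans (abs_det_integralInterpolationMatrix_le K L t u v g h H hH hu hv hg hh f)
  exact_mod_cast h2

end AffineHeight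

/-! ### Choice of parameters in the determinant method. -/

namespace AffineHeight

open Finset

/-- Here `K = B² q`, `L = q`, `R = S = B q` and `N = K L = B² q²`. As `t ≥ q ^ 5`, `V > ε t ≥ B⁴ q⁴
= N²`, so the exponent of `p` is at least `N² / 4` and the logarithm of the right side at least `N²
/ 8`. On the left, `log t` is `O(log q)`, and `B ≥ 48 log H` makes the height term at most `N² /
16`; the rest contributes at most `8 N² / 300`, and `1/16 + 8/300 < 1/8`. -/
theorem interpolation_parameters_absurd {p q B t V H : ℕ} (hp : 2 ≤ p) (hH : 1 ≤ H) (hB : 1 ≤ B)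
    (hBH : 48 * Real.log H ≤ B) {ε : ℝ} (hq1 : 96 * B ≤ q)
    (hq2 : (B : ℝ) ^ 4 ≤ ε * q) (hq3 : Real.log q ≤ q / 300) (ht1 : q ^ 5 ≤ t)
    (ht2 : t < (q + 1) ^ 5) (hV : ε * t < V) (hε : 0 < ε) :
    ((B ^ 2 * q) * q) ^ ((B ^ 2 * q) * q) *
      ((B * q + q + t * (B * q)) ^ (B ^ 2 * q) * H ^ (q * (B * q + q + B * q))) ^ ((B ^ 2 * q) * q) <
      p ^ (min V ((B ^ 2 * q) * q * ((B ^ 2 * q) * q - 1) / 2 - (B ^ 2 * q) * q * (B ^ 2 * q))) := by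
  by_contra! hle
  have hq0 : 96 ≤ q := le_trans (by omega) hq1
  set N := (B ^ 2 * q) * q with hN
  have hqR : (96 : ℝ) ≤ q := by exact_mod_cast hq0
  have hBR : (1 : ℝ) ≤ B := by exact_mod_cast hB
  have hq1R : 96 * (B : ℝ) ≤ q := by exact_mod_cast hq1
  have hNR : (N : ℝ) = B ^ 2 * q ^ 2 := by rw [hN]; push_cast; ring
  have hB2 : (1 : ℝ) ≤ B ^ 2 := one_le_pow₀ hBR
  have hqpos : (0 : ℝ) ≤ q := by linarith
  have hqN : 96 * (q : ℝ) ≤ N := by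
    rw [hNR, sq (q : ℝ)]
    calc 96 * (q : ℝ) ≤ q * q := mul_le_mul_of_nonneg_right hqR hqpos
      _ = 1 * (q * q) := (one_mul _).symm
      _ ≤ _ := mul_le_mul_of_nonneg_right hB2 (by positivity)
  have hN1 : (96 : ℝ) ≤ N := by linarith
  have hN0 : 96 ≤ N := by exact_mod_cast hN1
  have hW : (N : ℝ) ^ 2 / 4 ≤ ((N * (N - 1) / 2 - N * (B ^ 2 * q) : ℕ) : ℝ) := by
    have h2 : N * (N - 1) / 2 * 2 = N * (N - 1) :=
      Nat.div_mul_cancel (Nat.even_mul_pred_self N).two_dvd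
    have h2R : ((N * (N - 1) / 2 : ℕ) : ℝ) * 2 = N * (N - 1) := by
      have := congrArg (Nat.cast : ℕ → ℝ) h2
      push_cast [Nat.cast_sub (show 1 ≤ N by omega)] at this
      exact_mod_cast this
    have h3 : (N : ℝ) * (B ^ 2 * q) * 96 ≤ N * N := by
      have : (B : ℝ) ^ 2 * q * 96 ≤ N := by
        rw [hNR, sq (q : ℝ), ← mul_assoc]
        exact mul_le_mul_of_nonneg_left hqR (by positivity)
      rw [mul_assoc]
      exact mul_le_mul_of_nonneg_left this (by positivity)
    have h4 : ((N * (N - 1) / 2 : ℕ) : ℝ) ≤ ((N * (N - 1) / 2 - N * (B ^ 2 * q) : ℕ) : ℝ) +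
        ((N * (B ^ 2 * q) : ℕ) : ℝ) := by
      exact_mod_cast (le_tsub_add : _ ≤ N * (N - 1) / 2 - N * (B ^ 2 * q) + N * (B ^ 2 * q))
    have h5 : 96 * (N : ℝ) ≤ N * N := mul_le_mul_of_nonneg_right hN1 (by positivity)
    rw [Nat.cast_mul N (B ^ 2 * q), Nat.cast_mul (B ^ 2) q, Nat.cast_pow] at h4
    rw [sq (N : ℝ)]
    linarith
  have ht1R : (q : ℝ) ^ 5 ≤ t := by exact_mod_cast ht1
  have hVR : (N : ℝ) ^ 2 / 4 ≤ V := by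
    have h1 : (B : ℝ) ^ 4 * q ^ 4 ≤ ε * q * q ^ 4 := by gcongr
    have h2 : ε * (q : ℝ) ^ 5 ≤ ε * t := by gcongr
    have h3 : (N : ℝ) ^ 2 = B ^ 4 * q ^ 4 := by rw [hNR]; ring
    have h4 : ε * q * (q : ℝ) ^ 4 = ε * (q : ℝ) ^ 5 := by ring
    linarith [sq_nonneg (N : ℝ)]
  set W := min V (N * (N - 1) / 2 - N * (B ^ 2 * q)) with hWdef
  have hWm : (N : ℝ) ^ 2 / 4 ≤ (W : ℝ) := by
    rw [hWdef, Nat.cast_min]; exact le_min hVR hW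
  have hlogp : (1 : ℝ) / 2 ≤ Real.log p := by
    have : Real.log 2 ≤ Real.log p := Real.log_le_log (by norm_num) (by exact_mod_cast hp)
    linarith [Real.log_two_gt_d9]
  have hH0 : (0 : ℝ) < H := by exact_mod_cast hH
  set X := B * q + q + t * (B * q) with hX
  have hX0 : (0 : ℝ) < X := by
    have : 0 < X := by rw [hX]; omega
    exact_mod_cast this
  have hN00 : (0 : ℝ) < N := by linarith
  have hlog : Real.log ((p : ℝ) ^ W) ≤
      Real.log ((N : ℝ) ^ N * ((X : ℝ) ^ (B ^ 2 * q) * (H : ℝ) ^ (q * (B * q + q + B * q))) ^ N) := by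
    refine Real.log_le_log (pow_pos (by exact_mod_cast (by omega : 0 < p)) _) ?_
    have hle' := (Nat.cast_le (α := ℝ)).2 hle
    simp only [Nat.cast_mul, Nat.cast_pow] at hle'
    exact hle'
  rw [Real.log_pow, Real.log_mul (by positivity) (by positivity), Real.log_pow, Real.log_pow,
    Real.log_mul (by positivity) (by positivity), Real.log_pow, Real.log_pow] at hlog
  push_cast at hlog
  have hXle : (X : ℝ) ≤ q ^ 7 := by
    have h5 : (t : ℝ) ≤ (q + 1) ^ 5 := by exact_mod_cast ht2.le
    have h6 : ((q : ℝ) + 1) ^ 5 ≤ (2 * q) ^ 5 := by gcongr; linarith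
    have h7 : (X : ℝ) = B * q + q + t * (B * q) := by rw [hX]; push_cast; ring
    have h8 : (t : ℝ) * (B * q) ≤ (2 * q) ^ 5 * (B * q) := by gcongr; linarith
    have h9 : (B : ℝ) * q + q ≤ 2 * (B * q ^ 6) := by
      have h11 : (q : ℝ) ≤ q ^ 6 := le_self_pow₀ (by linarith) (by norm_num)
      have h12 : (B : ℝ) * q ≤ B * q ^ 6 := mul_le_mul_of_nonneg_left h11 (by positivity)
      have h13 : 1 * (q : ℝ) ^ 6 ≤ B * q ^ 6 := mul_le_mul_of_nonneg_right hBR (by positivity)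
      linarith
    have h10 : 96 * (B : ℝ) * q ^ 6 ≤ q * q ^ 6 := by gcongr
    have h11 : 0 ≤ (B : ℝ) * q ^ 6 := by positivity
    have h16 : (2 * (q : ℝ)) ^ 5 * (B * q) = 32 * (B * q ^ 6) := by ring
    have h17 : (q : ℝ) * q ^ 6 = q ^ 7 := by ring
    rw [h7]
    linarith
  have hlogX : Real.log X ≤ 7 * (q / 300) := by
    calc Real.log X ≤ Real.log ((q : ℝ) ^ 7) := Real.log_le_log hX0 hXle
      _ = 7 * Real.log q := by rw [Real.log_pow]; norm_num
      _ ≤ _ := by linarith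
  have hlogN : Real.log N ≤ 4 * (q / 300) := by
    have hNle : (N : ℝ) ≤ q ^ 4 := by
      rw [hNR]
      have h11 : (B : ℝ) ^ 2 ≤ q ^ 2 := by gcongr; linarith
      calc (B : ℝ) ^ 2 * q ^ 2 ≤ q ^ 2 * q ^ 2 := mul_le_mul_of_nonneg_right h11 (by positivity)
        _ = q ^ 4 := by ring
    calc Real.log N ≤ Real.log ((q : ℝ) ^ 4) := Real.log_le_log hN00 hNle
      _ = 4 * Real.log q := by rw [Real.log_pow]; norm_num
      _ ≤ _ := by linarith
  have hlogH : 0 ≤ Real.log H := Real.log_nonneg (by exact_mod_cast hH)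
  have hmain : (N : ℝ) / 8 ≤ Real.log N + (B ^ 2 * q * Real.log X +
      q * (B * q + q + B * q) * Real.log H) := by
    have h12 : (N : ℝ) ^ 2 / 4 * (1 / 2) ≤ W * Real.log p := by gcongr
    have h13 : (N : ℝ) * (N / 8) ≤ N * (Real.log N + (B ^ 2 * q * Real.log X +
      q * (B * q + q + B * q) * Real.log H)) := by linarith
    exact le_of_mul_le_mul_left h13 hN00
  have hA : (B : ℝ) ^ 2 * q * Real.log X ≤ B ^ 2 * q * (7 * (q / 300)) := by gcongr
  have hC : (q : ℝ) * (B * q + q + B * q) * Real.log H ≤ B ^ 2 * q ^ 2 / 16 := by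
    have h14 : (q : ℝ) * (B * q + q + B * q) ≤ 3 * B * q ^ 2 := by
      have := mul_le_mul_of_nonneg_right hBR (sq_nonneg (q : ℝ))
      linarith
    calc _ ≤ 3 * B * q ^ 2 * Real.log H := by gcongr
      _ = (B * q ^ 2 / 16) * (48 * Real.log H) := by ring
      _ ≤ (B * q ^ 2 / 16) * B := by gcongr
      _ = _ := by ring
  have hD : (4 : ℝ) * (q / 300) ≤ B ^ 2 * q ^ 2 * (1 / 300) := by
    rw [← hNR]
    linarith
  have hE : (B : ℝ) ^ 2 * q * (7 * (q / 300)) = 7 / 300 * N := by rw [hNR]; ring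
  rw [← hNR] at hC hD
  linarith

/-- A solution of `g v ^ t ≡ h u ^ t` modulo `p ^ V` has `V = o(t)`. -/
theorem eventually_le_of_pow_dvd {p : ℕ} [Fact p.Prime] (u v g h : ℤ)
    (hu0 : u ≠ 0) (hg0 : g ≠ 0) (hpv : ¬ (p : ℤ) ∣ v) (hph : ¬ (p : ℤ) ∣ h)
    (hinj : Function.Injective fun l : ℕ => ((u : ℚ) / v) ^ l)
    (huv : (p : ℤ) ^ 2 ∣ u - v) {ε : ℝ} (hε : 0 < ε) :
    ∀ᶠ t : ℕ in atTop, ∀ V : ℕ, (p : ℤ) ^ V ∣ g * v ^ t - h * u ^ t → (V : ℝ) ≤ ε * t := by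
  have hp : p.Prime := Fact.out
  obtain ⟨H, hH, hu, hv, hg, hh⟩ : ∃ H : ℕ, 1 ≤ H ∧ |u| ≤ H ∧ |v| ≤ H ∧ |g| ≤ H ∧ |h| ≤ H :=
    by
    refine ⟨1 + u.natAbs + v.natAbs + g.natAbs + h.natAbs, by omega, ?_⟩
    simp only [Int.abs_eq_natAbs]
    omega
  obtain ⟨B, hB⟩ := exists_nat_ge (max 1 (48 * Real.log H))
  obtain ⟨hB1, hB2⟩ := max_le_iff.1 hB
  have hB1 : 1 ≤ B := by exact_mod_cast hB1
  have hlog : ∀ᶠ q : ℕ in atTop, Real.log q ≤ q / 300 := by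
    have := (Real.isLittleO_log_id_atTop.comp_tendsto tendsto_natCast_atTop_atTop).def
      (c := 1 / 300) (by norm_num)
    filter_upwards [this] with q hq
    simp only [Function.comp_apply, id, Real.norm_eq_abs, Nat.abs_cast] at hq
    linarith [le_abs_self (Real.log q)]
  have hlin : ∀ᶠ q : ℕ in atTop, (B : ℝ) ^ 4 ≤ ε * q :=
    (tendsto_natCast_atTop_atTop.const_mul_atTop hε).eventually_ge_atTop _
  have hroot : Tendsto (fun t : ℕ => ⌊(t : ℝ) ^ ((1 : ℝ) / 5)⌋₊) atTop atTop :=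
    tendsto_nat_floor_atTop.comp ((tendsto_rpow_atTop (by norm_num)).comp
      tendsto_natCast_atTop_atTop)
  filter_upwards [hroot.eventually hlog, hroot.eventually hlin,
    hroot.eventually (eventually_ge_atTop (96 * B))] with t h1 h2 h3 V hV
  -- The fifth root makes `ε t` outgrow `N² = B⁴ q⁴` while `log t` stays comparable to `log q`.
  set q := ⌊(t : ℝ) ^ ((1 : ℝ) / 5)⌋₊ with hq
  have hpow : ((t : ℝ) ^ ((1 : ℝ) / 5)) ^ 5 = t := by
    rw [← Real.rpow_natCast, ← Real.rpow_mul (Nat.cast_nonneg t)]; norm_num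
  have ht0 : 0 ≤ (t : ℝ) ^ ((1 : ℝ) / 5) := by positivity
  have ht1 : q ^ 5 ≤ t := by
    have : (q : ℝ) ^ 5 ≤ ((t : ℝ) ^ ((1 : ℝ) / 5)) ^ 5 := by
      gcongr; exact Nat.floor_le ht0
    rw [hpow] at this
    exact_mod_cast this
  have ht2 : t < (q + 1) ^ 5 := by
    have : ((t : ℝ) ^ ((1 : ℝ) / 5)) ^ 5 < ((q : ℝ) + 1) ^ 5 := by
      gcongr; exact Nat.lt_floor_add_one _
    rw [hpow] at this
    exact_mod_cast this
  by_contra! hlt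
  have hq96 : 96 ≤ q := le_trans (by omega) h3
  refine (interpolation_parameters_absurd hp.two_le hH hB1 hB2 h3 h2 h1 ht1 ht2 hlt hε).not_ge
    (pow_le_of_pow_dvd u v g h H (B ^ 2 * q) q (B * q) (B * q) t V hH hu hv hg hh hu0 hg0 hpv hph
      hinj huv hV ?_ ?_)
  -- `K L = R S` exactly, so the strict inequality comes from `K - 1` alone.
  · have : 0 < B ^ 2 * q := by positivity
    calc (B ^ 2 * q - 1) * q < B ^ 2 * q * q := by
          refine Nat.mul_lt_mul_of_pos_right (by omega) (by omega)
      _ = B * q * (B * q) := by ring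
  · refine le_trans ?_ ht1
    calc B * q ≤ q * q := Nat.mul_le_mul_right _ (by omega)
      _ = q ^ 2 := by ring
      _ ≤ q ^ 5 := Nat.pow_le_pow_right (by omega) (by norm_num)

end AffineHeight

/-! ### Lower bounds for `x ^ t * a - b` at a `p`-adic unit `x`. -/

namespace AffineHeight

open Finset

section
variable {p : ℕ} [Fact p.Prime]

theorem one_lt_prime_cast (p : ℕ) [Fact p.Prime] : (1 : ℝ) < p := by
  exact_mod_cast (Fact.out : p.Prime).one_lt

theorem tendsto_rpow_neg_mul_nat (p : ℕ) [Fact p.Prime] {ε : ℝ} (hε : 0 < ε) :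
    Tendsto (fun t : ℕ => (p : ℝ) ^ (-(ε * t))) atTop (𝓝 0) := by
  have hp := one_lt_prime_cast p
  have h : (fun t : ℕ => (p : ℝ) ^ (-(ε * t))) = fun t : ℕ => ((p : ℝ) ^ (-ε)) ^ t := by
    funext t
    rw [← Real.rpow_natCast, ← Real.rpow_mul (by linarith), neg_mul]
  rw [h]
  exact tendsto_pow_atTop_nhds_zero_of_lt_one (by positivity)
    (Real.rpow_lt_one_of_one_lt_of_neg hp (by linarith))

theorem injective_pow_of_abs_ne_one {x : ℚ} (h0 : x ≠ 0) (h1 : |x| ≠ 1) :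
    Function.Injective fun l : ℕ => x ^ l := by
  intro i j hij
  have h2 : |x| ^ i = |x| ^ j := by rw [← abs_pow, ← abs_pow]; exact congrArg abs hij
  exact pow_right_injective₀ (abs_pos.2 h0) h1 h2

theorem norm_num_den_of_norm_eq_one {x : ℚ} (hx : ‖(x : ℚ_[p])‖ = 1) :
    ¬ (p : ℤ) ∣ x.num ∧ ¬ (p : ℤ) ∣ (x.den : ℤ) := by
  have hden : (x.den : ℚ_[p]) ≠ 0 := by exact_mod_cast x.den_nz
  have h1 : ‖(x.num : ℚ_[p])‖ = ‖((x.den : ℤ) : ℚ_[p])‖ := by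
    rw [Rat.cast_def, norm_div, div_eq_one_iff_eq (norm_ne_zero_iff.2 hden)] at hx
    rw [hx, Int.cast_natCast]
  have h2 : ¬ ((p : ℤ) ∣ x.num ∧ (p : ℤ) ∣ (x.den : ℤ)) := by
    rintro ⟨ha, hb⟩
    have hc := Nat.dvd_gcd (Int.natCast_dvd.1 ha) (Int.natCast_dvd_natCast.1 hb)
    rw [x.reduced.gcd_eq_one] at hc
    exact (Fact.out : p.Prime).one_lt.ne' (Nat.dvd_one.1 hc)
  rw [← Padic.norm_intCast_lt_one_iff, ← Padic.norm_intCast_lt_one_iff, h1] at h2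
  rw [← Padic.norm_intCast_lt_one_iff, ← Padic.norm_intCast_lt_one_iff, h1]
  tauto

theorem norm_intCast_eq_one_of_not_dvd {n : ℤ} (h : ¬ (p : ℤ) ∣ n) : ‖(n : ℚ_[p])‖ = 1 := by
  rw [← Padic.norm_intCast_lt_one_iff] at h
  exact le_antisymm (Padic.norm_int_le_one n) (not_lt.1 h)

/-- If `|c| ≠ 1` the ultrametric inequality suffices. Otherwise, clearing denominators turns
smallness into divisibility of `g v ^ t - h u ^ t` by `p ^ ⌊ε t⌋`. `eventually_le_of_pow_dvd`, used
with `ε / 2` so that the floor does no harm, forbids this. -/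
theorem eventually_lt_norm_pow_mul_sub_one_of_near_one {x c : ℚ} (hx0 : x ≠ 0)
    (hx : ‖(x : ℚ_[p])‖ = 1) (hx2 : ‖((x - 1 : ℚ) : ℚ_[p])‖ ≤ (p : ℝ) ^ (-2 : ℤ)) (habs : |x| ≠ 1)
    {ε : ℝ} (hε : 0 < ε) :
    ∀ᶠ t : ℕ in atTop, (p : ℝ) ^ (-(ε * t)) < ‖((x ^ t * c - 1 : ℚ) : ℚ_[p])‖ := by
  have hp := one_lt_prime_cast p
  by_cases hc1 : ‖(c : ℚ_[p])‖ = 1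
  · obtain ⟨hu, hv⟩ := norm_num_den_of_norm_eq_one hx
    obtain ⟨hh, hg⟩ := norm_num_den_of_norm_eq_one hc1
    have hxd : (x.den : ℚ) ≠ 0 := by exact_mod_cast x.den_nz
    have hcd : (c.den : ℚ) ≠ 0 := by exact_mod_cast c.den_nz
    have huv : (p : ℤ) ^ 2 ∣ x.num - x.den := by
      have h1 : ((x.num - x.den : ℤ) : ℚ_[p]) = ((x - 1 : ℚ) : ℚ_[p]) * ((x.den : ℤ) : ℚ_[p]) := by
        have : ((x.num - x.den : ℤ) : ℚ) = (x - 1) * ((x.den : ℤ) : ℚ) := by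
          push_cast
          rw [sub_mul, Rat.mul_den_eq_num, one_mul]
        exact_mod_cast congrArg (Rat.cast : ℚ → ℚ_[p]) this
      have := Padic.norm_int_le_pow_iff_dvd (p := p) (x.num - x.den) 2
      rw [h1, norm_mul, norm_intCast_eq_one_of_not_dvd hv, mul_one] at this
      exact_mod_cast this.1 hx2
    have hinj : Function.Injective fun l : ℕ => ((x.num : ℚ) / ((x.den : ℤ) : ℚ)) ^ l := by
      rw [Int.cast_natCast, Rat.num_div_den]
      exact injective_pow_of_abs_ne_one hx0 habs
    have key := eventually_le_of_pow_dvd x.num x.den c.den c.num (Rat.num_ne_zero.2 hx0)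
      (by exact_mod_cast c.den_nz) hv hh hinj huv (half_pos hε)
    have hlarge : ∀ᶠ t : ℕ in atTop, 1 < ε / 2 * t :=
      (tendsto_natCast_atTop_atTop.const_mul_atTop (half_pos hε)).eventually_gt_atTop 1
    filter_upwards [key, hlarge] with t ht ht2
    by_contra! hle
    have hfl : (⌊ε * t⌋₊ : ℝ) ≤ ε * t := Nat.floor_le (by positivity)
    have hdvd : (p : ℤ) ^ ⌊ε * t⌋₊ ∣ (c.den : ℤ) * (x.den : ℤ) ^ t - c.num * x.num ^ t := by
      rw [← dvd_neg]
      have h1 : ((-((c.den : ℤ) * (x.den : ℤ) ^ t - c.num * x.num ^ t) : ℤ) : ℚ_[p]) =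
          ((x ^ t * c - 1 : ℚ) : ℚ_[p]) * (((x.den : ℤ) : ℚ_[p]) ^ t * ((c.den : ℤ) : ℚ_[p])) := by
        have : ((-((c.den : ℤ) * (x.den : ℤ) ^ t - c.num * x.num ^ t) : ℤ) : ℚ) =
            (x ^ t * c - 1) * (((x.den : ℤ) : ℚ) ^ t * ((c.den : ℤ) : ℚ)) := by
          push_cast
          rw [← Rat.mul_den_eq_num x, ← Rat.mul_den_eq_num c]
          ring
        exact_mod_cast congrArg (Rat.cast : ℚ → ℚ_[p]) this
      have := Padic.norm_int_le_pow_iff_dvd (p := p)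
        (-((c.den : ℤ) * (x.den : ℤ) ^ t - c.num * x.num ^ t)) ⌊ε * t⌋₊
      rw [h1, norm_mul, norm_mul, norm_pow, norm_intCast_eq_one_of_not_dvd hv,
        norm_intCast_eq_one_of_not_dvd hg, one_pow, one_mul, mul_one] at this
      refine this.1 (hle.trans ?_)
      rw [← Real.rpow_intCast]
      refine Real.rpow_le_rpow_of_exponent_le hp.le ?_
      push_cast
      linarith
    have h3 := ht _ hdvd
    have h4 := Nat.lt_floor_add_one (ε * t)
    linarith
  · filter_upwards [eventually_gt_atTop 0] with t ht
    have h1 : (p : ℝ) ^ (-(ε * t)) < 1 := by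
      refine Real.rpow_lt_one_of_one_lt_of_neg hp ?_
      have : (0 : ℝ) < t := by exact_mod_cast ht
      nlinarith
    refine h1.trans_le ?_
    have h2 : ‖((x ^ t * c : ℚ) : ℚ_[p])‖ ≠ ‖(1 : ℚ_[p])‖ := by
      push_cast
      rw [norm_mul, norm_pow, hx, one_pow, one_mul, norm_one]
      exact hc1
    push_cast at h2 ⊢
    rw [sub_eq_add_neg, Padic.add_eq_max_of_ne (by rwa [norm_neg]), norm_neg, norm_one]
    exact le_max_right _ _

/-- Euler's theorem modulo `p ^ 2`, applied to numerator and denominator. -/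
theorem exists_pow_norm_sub_one_le {x : ℚ} (hx : ‖(x : ℚ_[p])‖ = 1) :
    ∃ m : ℕ, 0 < m ∧ ‖((x ^ m - 1 : ℚ) : ℚ_[p])‖ ≤ (p : ℝ) ^ (-2 : ℤ) := by
  have hp : p.Prime := Fact.out
  obtain ⟨hu, hv⟩ := norm_num_den_of_norm_eq_one hx
  have hunit : ∀ {w : ℤ}, ¬ (p : ℤ) ∣ w → ((w ^ Nat.totient (p ^ 2) : ℤ) : ZMod (p ^ 2)) = 1 := by
    intro w hw
    have hcop : IsCoprime w ((p ^ 2 : ℕ) : ℤ) := by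
      push_cast
      exact (((Nat.prime_iff_prime_int.1 hp).coprime_iff_not_dvd.2 hw).symm).pow_right
    obtain ⟨w', hw'⟩ := (ZMod.coe_int_isUnit_iff_isCoprime w (p ^ 2)).2 hcop.symm
    rw [Int.cast_pow, ← hw', ← Units.val_pow_eq_pow_val, ZMod.pow_totient, Units.val_one]
  refine ⟨Nat.totient (p ^ 2), Nat.totient_pos.2 (pow_pos hp.pos _), ?_⟩
  have hdvd : ((p ^ 2 : ℕ) : ℤ) ∣ x.num ^ Nat.totient (p ^ 2) - (x.den : ℤ) ^ Nat.totient (p ^ 2) := by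
    rw [← ZMod.intCast_zmod_eq_zero_iff_dvd, Int.cast_sub, hunit hu, hunit hv, sub_self]
  rw [Nat.cast_pow, ← Padic.norm_int_le_pow_iff_dvd] at hdvd
  have h1 : ((x.num ^ Nat.totient (p ^ 2) - (x.den : ℤ) ^ Nat.totient (p ^ 2) : ℤ) : ℚ_[p]) =
      ((x ^ Nat.totient (p ^ 2) - 1 : ℚ) : ℚ_[p]) * ((x.den : ℤ) : ℚ_[p]) ^ Nat.totient (p ^ 2) := by
    have : ((x.num ^ Nat.totient (p ^ 2) - (x.den : ℤ) ^ Nat.totient (p ^ 2) : ℤ) : ℚ) =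
        (x ^ Nat.totient (p ^ 2) - 1) * ((x.den : ℤ) : ℚ) ^ Nat.totient (p ^ 2) := by
      push_cast
      rw [← Rat.mul_den_eq_num x]
      ring
    exact_mod_cast congrArg (Rat.cast : ℚ → ℚ_[p]) this
  rw [h1, norm_mul, norm_pow, norm_intCast_eq_one_of_not_dvd hv, one_pow, mul_one] at hdvd
  exact_mod_cast hdvd

/-- For a rational `p`-adic unit `x ≠ ±1` the numbers `x ^ t * a - b` are not exponentially small
`p`-adically. -/
theorem eventually_lt_norm_pow_mul_sub {x : ℚ} (a : ℚ) {b : ℚ} (hx : ‖(x : ℚ_[p])‖ = 1)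
    (habs : |x| ≠ 1) (hb : b ≠ 0) {ε : ℝ} (hε : 0 < ε) :
    ∀ᶠ t : ℕ in atTop, (p : ℝ) ^ (-(ε * t)) < ‖((x ^ t * a - b : ℚ) : ℚ_[p])‖ := by
  have hp := one_lt_prime_cast p
  have hbn : 0 < ‖(b : ℚ_[p])‖ := norm_pos_iff.2 (by exact_mod_cast hb)
  have hx0 : x ≠ 0 := by
    rintro rfl
    simp at hx
  obtain ⟨m, hm, hxm⟩ := exists_pow_norm_sub_one_le hx
  have habs' : |x ^ m| ≠ 1 := by
    rw [abs_pow]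
    intro h
    exact habs ((pow_eq_one_iff_of_nonneg (abs_nonneg x) hm.ne').1 h)
  -- Write `t = m k + r`. In each residue class the base is `x ^ m`, which is close to 1, and `x ^
  -- r` joins the constant.
  have hstep : ∀ r ∈ range m, ∀ᶠ k : ℕ in atTop,
      (p : ℝ) ^ (-(ε / 2 * m * k)) < ‖(((x ^ m) ^ k * (x ^ r * (a / b)) - 1 : ℚ) : ℚ_[p])‖ :=
    fun r _ => eventually_lt_norm_pow_mul_sub_one_of_near_one (pow_ne_zero _ hx0)
      (by push_cast; rw [norm_pow, hx, one_pow]) hxm habs' (by positivity)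
  have hall := (Filter.eventually_all_finset (range m)).2 hstep
  have hdiv : Tendsto (fun t : ℕ => t / m) atTop atTop := Nat.tendsto_div_const_atTop hm.ne'
  filter_upwards [hdiv.eventually hall,
    (tendsto_rpow_neg_mul_nat p (half_pos hε)).eventually_lt_const hbn] with t ht ht2
  have h1 := ht (t % m) (mem_range.2 (Nat.mod_lt _ hm))
  have h2 : (x ^ m) ^ (t / m) * (x ^ (t % m) * (a / b)) - 1 = (x ^ t * a - b) / b := by
    rw [← pow_mul, ← mul_assoc, ← pow_add, Nat.div_add_mod]
    field_simp
  rw [h2] at h1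
  push_cast at h1 ⊢
  rw [norm_div, lt_div_iff₀ hbn] at h1
  refine lt_of_le_of_lt ?_ h1
  -- Half of the exponential decay absorbs the constant `‖b‖`.
  have h3 : (p : ℝ) ^ (-(ε * t)) = (p : ℝ) ^ (-(ε / 2 * t)) * (p : ℝ) ^ (-(ε / 2 * t)) := by
    rw [← Real.rpow_add (by linarith)]
    congr 1; ring
  rw [h3]
  refine mul_le_mul ?_ ht2.le (by positivity) (by positivity)
  refine Real.rpow_le_rpow_of_exponent_le hp.le ?_
  have h4 : (m : ℝ) * (t / m : ℕ) ≤ t := by exact_mod_cast Nat.mul_div_le t m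
  have h5 : ε / 2 * ((m : ℝ) * (t / m : ℕ)) ≤ ε / 2 * t := by gcongr
  linarith

end

end AffineHeight

/-! ### Counting rational points by height; sets of density zero. -/

namespace AffineHeight

open Finset

theorem height_le_iff {r : ℚ} {N : ℕ} : height r ≤ N ↔ r.num.natAbs ≤ N ∧ r.den ≤ N := max_le_iff

/-- The number of rationals of height at most `N`. -/
noncomputable def heightCount (N : ℕ) : ℕ := {r : ℚ | height r ≤ N}.ncard

theorem sum_inv_sq_le (N : ℕ) (hN : 2 ≤ N) :
    ∑ d ∈ Icc 2 N, (1 : ℝ) / d ^ 2 ≤ 3 / 4 - 1 / N := by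
  induction N, hN using Nat.le_induction with
  | base => norm_num
  | succ n hn ih =>
    rw [sum_Icc_succ_top (by omega)]
    have hn' : (2 : ℝ) ≤ n := by exact_mod_cast hn
    have : (1 : ℝ) / ((n + 1 : ℕ) : ℝ) ^ 2 ≤ 1 / n - 1 / ((n + 1 : ℕ) : ℝ) := by
      push_cast
      rw [div_sub_div _ _ (by positivity) (by positivity), div_le_div_iff₀ (by positivity) (by positivity)]
      nlinarith
    linarith

/-- Sum over a common divisor `d ≥ 2`: at most `(N / d)²` pairs for each, and `∑ 1 / d² ≤ 3 / 4`.
Any constant below 1 would do, since only the order of growth of `heightCount` is needed. -/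
theorem card_not_coprime_le (N : ℕ) :
    (#{x ∈ Icc 1 N ×ˢ Icc 1 N | ¬ Nat.Coprime x.1 x.2} : ℝ) ≤ 3 / 4 * N ^ 2 := by
  have hsub : {x ∈ Icc 1 N ×ˢ Icc 1 N | ¬ Nat.Coprime x.1 x.2} ⊆
      (Icc 2 N).biUnion fun d => {m ∈ Ioc 0 N | d ∣ m} ×ˢ {m ∈ Ioc 0 N | d ∣ m} := by
    rintro ⟨m, n⟩ h
    simp only [mem_filter, mem_product, mem_Icc] at h
    have h0 : 0 < Nat.gcd m n := Nat.gcd_pos_of_pos_left _ (by omega)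
    have h1 : Nat.gcd m n ≤ m := Nat.gcd_le_left _ (by omega)
    simp only [mem_biUnion, mem_product, mem_filter, mem_Ioc, mem_Icc]
    have h2 : Nat.gcd m n ≠ 1 := h.2
    exact ⟨Nat.gcd m n, ⟨by omega, by omega⟩, ⟨by omega, Nat.gcd_dvd_left _ _⟩,
      ⟨by omega, Nat.gcd_dvd_right _ _⟩⟩
  have hle : (#{x ∈ Icc 1 N ×ˢ Icc 1 N | ¬ Nat.Coprime x.1 x.2} : ℝ) ≤
      ∑ d ∈ Icc 2 N, (N : ℝ) ^ 2 * (1 / d ^ 2) := by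
    calc _ ≤ ((∑ d ∈ Icc 2 N, #({m ∈ Ioc 0 N | d ∣ m} ×ˢ {m ∈ Ioc 0 N | d ∣ m}) : ℕ) : ℝ) := by
          exact_mod_cast (card_le_card hsub).trans card_biUnion_le
      _ ≤ _ := by
          push_cast
          refine sum_le_sum fun d hd => ?_
          rw [card_product, Nat.Ioc_filter_dvd_card_eq_div, Nat.cast_mul]
          have : ((N / d : ℕ) : ℝ) ≤ N / d := Nat.cast_div_le
          calc ((N / d : ℕ) : ℝ) * ((N / d : ℕ) : ℝ) ≤ (N / d : ℝ) * (N / d) := by gcongr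
            _ = _ := by ring
  refine hle.trans ?_
  rw [← mul_sum, mul_comm]
  gcongr
  rcases lt_or_ge N 2 with hN | hN
  · rw [Icc_eq_empty (by omega)]; norm_num
  · have := sum_inv_sq_le N hN
    have : (0 : ℝ) ≤ 1 / N := by positivity
    linarith

theorem sq_div_four_le_heightCount (N : ℕ) : (N : ℝ) ^ 2 / 4 ≤ heightCount N := by
  have hsplit := card_filter_add_card_filter_not (s := Icc 1 N ×ˢ Icc 1 N)
    (fun x : ℕ × ℕ => Nat.Coprime x.1 x.2)
  have hinj : #{x ∈ Icc 1 N ×ˢ Icc 1 N | Nat.Coprime x.1 x.2} ≤ heightCount N := by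
    rw [heightCount, ← Set.ncard_coe_finset]
    have hnum : ∀ x ∈ {x ∈ Icc 1 N ×ˢ Icc 1 N | Nat.Coprime x.1 x.2},
        ((x.1 : ℚ) / x.2).num = x.1 ∧ ((x.1 : ℚ) / x.2).den = x.2 := by
      rintro ⟨m, n⟩ hx
      simp only [mem_filter, mem_product, mem_Icc] at hx
      have h1 := Rat.num_div_eq_of_coprime (a := m) (b := n) (by omega) (by simpa using hx.2)
      have h2 := Rat.den_div_eq_of_coprime (a := m) (b := n) (by omega) (by simpa using hx.2)
      push_cast at h1 h2
      exact ⟨h1, by exact_mod_cast h2⟩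
    refine Set.ncard_le_ncard_of_injOn (fun x : ℕ × ℕ => (x.1 : ℚ) / x.2) ?_ ?_ (height_finite N)
    · intro x hx
      obtain ⟨h1, h2⟩ := hnum x hx
      simp only [coe_filter, mem_product, mem_Icc, Set.mem_ofPred_eq] at hx
      change height _ ≤ N
      rw [height_le_iff, h1, h2]
      simp only [Int.natAbs_natCast]
      omega
    · intro x hx y hy hxy
      obtain ⟨h1, h2⟩ := hnum x hx
      obtain ⟨h3, h4⟩ := hnum y hy
      simp only at hxy
      rw [hxy] at h1 h2
      ext
      · exact_mod_cast h1.symm.trans h3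
      · exact h2.symm.trans h4
  rw [card_product, Nat.card_Icc, Nat.add_sub_cancel] at hsplit
  have h1 := card_not_coprime_le N
  have h2 : (#{x ∈ Icc 1 N ×ˢ Icc 1 N | Nat.Coprime x.1 x.2} : ℝ) ≤ heightCount N := by
    exact_mod_cast hinj
  have h3 : (#{x ∈ Icc 1 N ×ˢ Icc 1 N | Nat.Coprime x.1 x.2} : ℝ) +
      #{x ∈ Icc 1 N ×ˢ Icc 1 N | ¬ Nat.Coprime x.1 x.2} = N * N := by exact_mod_cast hsplit
  nlinarith

theorem mem_heightBall_iff {z : Fin 2 → ℚ} {N : ℕ} :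
    z ∈ heightBall N ↔ height (z 0) ≤ N ∧ height (z 1) ≤ N := by
  change max _ _ ≤ N ↔ _
  exact max_le_iff

theorem ncard_prod_le {A B : Set ℚ} (hA : A.Finite) (hB : B.Finite) {Y : Set (Fin 2 → ℚ)}
    (hY : ∀ z ∈ Y, z 0 ∈ A ∧ z 1 ∈ B) : Y.ncard ≤ A.ncard * B.ncard := by
  rw [← Set.ncard_prod]
  refine Set.ncard_le_ncard_of_injOn (fun z => (z 0, z 1)) (fun z hz => hY z hz) ?_ (hA.prod hB)
  intro z _ z' _ h
  simp only [Prod.mk.injEq] at h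
  funext i
  fin_cases i
  · exact h.1
  · exact h.2

theorem ncard_heightBall (N : ℕ) : (heightBall N).ncard = heightCount N ^ 2 := by
  refine le_antisymm ?_ ?_
  · rw [sq]
    exact ncard_prod_le (height_finite N) (height_finite N) fun z hz => mem_heightBall_iff.1 hz
  · rw [sq, heightCount, ← Set.ncard_prod]
    refine Set.ncard_le_ncard_of_injOn (fun x : ℚ × ℚ => ![x.1, x.2]) ?_ ?_ (heightBall_finite N)
    · intro x hx
      exact mem_heightBall_iff.2 hx
    · intro x _ y _ h
      exact Prod.ext (congrFun h 0) (congrFun h 1)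

theorem heightCount_pos {N : ℕ} (hN : 1 ≤ N) : (0 : ℝ) < heightCount N := by
  have h := sq_div_four_le_heightCount N
  have : (1 : ℝ) ≤ N := by exact_mod_cast hN
  nlinarith

theorem tendsto_heightCount : Tendsto (fun N => (heightCount N : ℝ)) atTop atTop := by
  refine tendsto_atTop_mono sq_div_four_le_heightCount ?_
  exact ((tendsto_pow_atTop two_ne_zero).comp tendsto_natCast_atTop_atTop).atTop_div_const
    (by norm_num)

theorem ncard_heightBall_pos {N : ℕ} (hN : 1 ≤ N) : (0 : ℝ) < (heightBall N).ncard := by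
  rw [ncard_heightBall, Nat.cast_pow]
  exact pow_pos (heightCount_pos hN) 2

theorem almostAll_of_hasDensity_zero {P : (Fin 2 → ℚ) → Prop} {X : Set (Fin 2 → ℚ)}
    (hX : HasDensity X 0) (h : ∀ z, z ∉ X → P z) : AlmostAll P := by
  have hlow : Tendsto (fun N : ℕ => 1 - ((X ∩ heightBall N).ncard : ℝ) / ((heightBall N).ncard : ℝ))
      atTop (𝓝 1) := by simpa using hX.const_sub 1
  refine tendsto_of_tendsto_of_tendsto_of_le_of_le' hlow tendsto_const_nhds ?_ ?_
  · filter_upwards [eventually_ge_atTop 1] with N hN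
    have hpos := ncard_heightBall_pos hN
    rw [sub_le_iff_le_add, ← add_div, le_div_iff₀ hpos, one_mul]
    have hcov : heightBall N ⊆ ({z | P z} ∩ heightBall N) ∪ (X ∩ heightBall N) := by
      intro z hz
      by_cases hzX : z ∈ X
      · exact Or.inr ⟨hzX, hz⟩
      · exact Or.inl ⟨h z hzX, hz⟩
    have h1 := (Set.ncard_le_ncard hcov (((heightBall_finite N).inter_of_right _).union
      ((heightBall_finite N).inter_of_right _))).trans (Set.ncard_union_le _ _)
    exact_mod_cast h1
  · filter_upwards with N
    refine div_le_one_of_le₀ ?_ (Nat.cast_nonneg _)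
    exact_mod_cast Set.ncard_le_ncard Set.inter_subset_right (heightBall_finite N)

theorem HasDensity.union_zero {X Y : Set (Fin 2 → ℚ)} (hX : HasDensity X 0) (hY : HasDensity Y 0) :
    HasDensity (X ∪ Y) 0 := by
  have hsum : Tendsto (fun N : ℕ => ((X ∩ heightBall N).ncard : ℝ) / ((heightBall N).ncard : ℝ) +
      ((Y ∩ heightBall N).ncard : ℝ) / ((heightBall N).ncard : ℝ)) atTop (𝓝 0) := by
    simpa using Tendsto.add hX hY
  refine squeeze_zero (fun N => by positivity) (fun N => ?_) hsum
  rw [← add_div, Set.union_inter_distrib_right]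
  gcongr
  exact_mod_cast Set.ncard_union_le _ _

/-- A set of rational points contained in a line has density zero. -/
theorem hasDensity_zero_of_collinear {X : Set (Fin 2 → ℚ)} {e : Fin 2 → ℚ} (he : e ≠ 0)
    (h : ∀ z ∈ X, ∀ z' ∈ X, (z - z') 0 * e 1 = (z - z') 1 * e 0) : HasDensity X 0 := by
  -- A nonzero component of the direction gives a coordinate that is injective on the line. The line
  -- thus has at most `heightCount N` points in a ball of `heightCount N ^ 2`.
  have hinj : ∃ i : Fin 2, Set.InjOn (fun z : Fin 2 → ℚ => z i) X := by
    by_cases h0 : e 0 = 0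
    · have h1 : e 1 ≠ 0 := fun h1 => he (funext fun i => by fin_cases i <;> assumption)
      refine ⟨1, fun z hz z' hz' hzz => ?_⟩
      have := h z hz z' hz'
      rw [h0, mul_zero, mul_eq_zero, or_iff_left h1, Pi.sub_apply, sub_eq_zero] at this
      funext i
      fin_cases i
      · exact this
      · exact hzz
    · refine ⟨0, fun z hz z' hz' hzz => ?_⟩
      have := h z hz z' hz'
      simp only at hzz
      rw [Pi.sub_apply, hzz, sub_self, zero_mul, eq_comm, mul_eq_zero, or_iff_left h0,
        Pi.sub_apply, sub_eq_zero] at this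
      funext i
      fin_cases i
      · exact hzz
      · exact this
  obtain ⟨i, hi⟩ := hinj
  refine squeeze_zero' (g := fun N => ((heightCount N : ℝ))⁻¹) (by filter_upwards with N; positivity) ?_
    tendsto_heightCount.inv_tendsto_atTop
  filter_upwards [eventually_ge_atTop 1] with N hN
  have hle : (X ∩ heightBall N).ncard ≤ heightCount N := by
    refine Set.ncard_le_ncard_of_injOn (fun z => z i) ?_ (hi.mono Set.inter_subset_left)
      (height_finite N)
    intro z hz
    have := mem_heightBall_iff.1 hz.2
    fin_cases i
    · exact this.1
    · exact this.2
  have hpos := heightCount_pos hN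
  rw [ncard_heightBall, Nat.cast_pow, div_le_iff₀ (by positivity), sq, ← mul_assoc,
    inv_mul_cancel₀ hpos.ne', one_mul]
  exact_mod_cast hle

variable {p : ℕ} [Fact p.Prime]

/-- Fractions with the same denominator in one disc of radius `p ^ (-k)` have numerators congruent
modulo `p ^ k`. Such a fraction is determined by its denominator and the quotient of its numerator,
shifted by `N` to be nonnegative, by `p ^ k`. -/
theorem ncard_height_le_near_le (N k : ℕ) (ξ : ℚ) :
    {r : ℚ | height r ≤ N ∧ ‖((r - ξ : ℚ) : ℚ_[p])‖ ≤ (p : ℝ) ^ (-k : ℤ)}.ncard ≤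
      N * (2 * N / p ^ k + 1) := by
  have hcard : ((Icc 1 N ×ˢ Icc (0 : ℤ) ((2 * N / p ^ k : ℕ) : ℤ) : Finset (ℕ × ℤ)) : Set (ℕ × ℤ)).ncard =
      N * (2 * N / p ^ k + 1) := by
    rw [Set.ncard_coe_finset, card_product, Nat.card_Icc, Int.card_Icc]
    congr 1
  rw [← hcard]
  have hpk : 0 < (p : ℤ) ^ k := pow_pos (by exact_mod_cast (Fact.out : p.Prime).pos) k
  refine Set.ncard_le_ncard_of_injOn (fun r : ℚ => (r.den, (r.num + N) / (p : ℤ) ^ k)) ?_ ?_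
    (Finset.finite_toSet _)
  · rintro r ⟨hr, -⟩
    rw [height_le_iff] at hr
    have := r.den_pos
    simp only [coe_product, coe_Icc, Set.mem_prod, Set.mem_Icc]
    refine ⟨⟨by omega, hr.2⟩, Int.ediv_nonneg (by omega) hpk.le, ?_⟩
    push_cast
    exact Int.ediv_le_ediv hpk (by omega)
  · rintro r ⟨-, hr⟩ r' ⟨-, hr'⟩ h
    simp only [Prod.mk.injEq] at h
    obtain ⟨hden, hq⟩ := h
    have hnear : ‖((r - r' : ℚ) : ℚ_[p])‖ ≤ (p : ℝ) ^ (-k : ℤ) := by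
      have : ((r - r' : ℚ) : ℚ_[p]) = ((r - ξ : ℚ) : ℚ_[p]) - ((r' - ξ : ℚ) : ℚ_[p]) := by
        push_cast; ring
      rw [this]
      rw [sub_eq_add_neg]
      exact (Padic.nonarchimedean _ _).trans (by rw [norm_neg]; exact max_le hr hr')
    have hdvd : (p : ℤ) ^ k ∣ r.num - r'.num := by
      rw [← Padic.norm_int_le_pow_iff_dvd]
      have h1 : ((r.num - r'.num : ℤ) : ℚ_[p]) = ((r - r' : ℚ) : ℚ_[p]) * ((r.den : ℤ) : ℚ_[p]) := by
        have : ((r.num - r'.num : ℤ) : ℚ) = (r - r') * ((r.den : ℤ) : ℚ) := by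
          push_cast
          rw [sub_mul, Rat.mul_den_eq_num]
          rw [hden, Rat.mul_den_eq_num]
        exact_mod_cast congrArg (Rat.cast : ℚ → ℚ_[p]) this
      rw [h1, norm_mul]
      exact (mul_le_of_le_one_right (norm_nonneg _) (Padic.norm_int_le_one _)).trans hnear
    have hnum : r.num = r'.num := by
      have hmod : (r.num + N) % (p : ℤ) ^ k = (r'.num + N) % (p : ℤ) ^ k :=
        (Int.emod_emod_of_dvd _ dvd_rfl).symm.trans (by
          rw [Int.emod_emod_of_dvd _ dvd_rfl]
          refine Int.ModEq.add_right _ ?_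
          exact ((Int.modEq_iff_dvd.2 (by rwa [← neg_sub, dvd_neg] at hdvd)))) 
      have e1 := Int.emod_add_mul_ediv (r.num + N) ((p : ℤ) ^ k)
      have e2 := Int.emod_add_mul_ediv (r'.num + N) ((p : ℤ) ^ k)
      rw [hmod, hq] at e1
      linarith
    exact Rat.ext hnum hden

/-- A set of rational points which for every `k` is covered by `O(p ^ k)` polydiscs of radius
`p ^ (-k)` has density zero. -/
theorem hasDensity_zero_of_cover {X : Set (Fin 2 → ℚ)} (C : ℝ)
    (h : ∀ k : ℕ, ∃ Z : Finset (Fin 2 → ℚ), (#Z : ℝ) ≤ C * (p : ℝ) ^ k ∧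
      ∀ z ∈ X, ∃ ζ ∈ Z, ∀ i, ‖((z i - ζ i : ℚ) : ℚ_[p])‖ ≤ (p : ℝ) ^ (-k : ℤ)) :
    HasDensity X 0 := by
  have hp : (1 : ℝ) < p := by exact_mod_cast (Fact.out : p.Prime).one_lt
  have hC : 0 ≤ C := by
    obtain ⟨Z, hZ, -⟩ := h 0
    rw [pow_zero, mul_one] at hZ
    exact (Nat.cast_nonneg _).trans hZ
  rw [HasDensity, Metric.tendsto_atTop]
  intro ε hε
  -- Once `N ≥ p ^ k`, a polydisc holds at most `9 N⁴ / p^(2k)` points, the ball at least `N⁴ / 16`,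
  -- and there are at most `C p ^ k` polydiscs; `144 = 9 * 16`.
  have hlim : Tendsto (fun k : ℕ => 144 * C * ((p : ℝ)⁻¹) ^ k) atTop (𝓝 0) := by
    simpa using (tendsto_pow_atTop_nhds_zero_of_lt_one (by positivity) (inv_lt_one_of_one_lt₀ hp)).const_mul
      (144 * C)
  obtain ⟨k, hk⟩ := (hlim.eventually_lt_const hε).exists
  obtain ⟨Z, hZ, hXZ⟩ := h k
  refine ⟨p ^ k + 1, fun N hN => ?_⟩
  have hN1 : 1 ≤ N := by omega
  have hNk : (p : ℝ) ^ k ≤ N := by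
    have : p ^ k ≤ N := by omega
    exact_mod_cast this
  have hpk : (0 : ℝ) < (p : ℝ) ^ k := by positivity
  have hcount : (X ∩ heightBall N).ncard ≤ #Z * (N * (2 * N / p ^ k + 1)) ^ 2 := by
    have hsub : X ∩ heightBall N ⊆ ⋃ ζ ∈ Z, {z | z ∈ heightBall N ∧
        ∀ i, ‖((z i - ζ i : ℚ) : ℚ_[p])‖ ≤ (p : ℝ) ^ (-k : ℤ)} := by
      rintro z ⟨hz, hzN⟩
      obtain ⟨ζ, hζ, hd⟩ := hXZ z hz
      simp only [Set.mem_iUnion]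
      exact ⟨ζ, hζ, hzN, hd⟩
    refine (Set.ncard_le_ncard hsub (Set.Finite.biUnion (Finset.finite_toSet _) fun ζ _ =>
      (heightBall_finite N).subset fun z hz => hz.1)).trans ?_
    refine (Finset.set_ncard_biUnion_le _ _).trans ?_
    refine (sum_le_card_nsmul _ _ ((N * (2 * N / p ^ k + 1)) ^ 2) fun ζ _ => ?_).trans (by simp)
    rw [sq]
    refine (ncard_prod_le ((height_finite N).subset fun r hr => hr.1)
      ((height_finite N).subset fun r hr => hr.1) ?_).trans (Nat.mul_le_mul
        (ncard_height_le_near_le (p := p) N k (ζ 0)) (ncard_height_le_near_le (p := p) N k (ζ 1)))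
    rintro z ⟨hz, hd⟩
    rw [mem_heightBall_iff] at hz
    exact ⟨⟨hz.1, hd 0⟩, hz.2, hd 1⟩
  have hdiv : ((2 * N / p ^ k + 1 : ℕ) : ℝ) ≤ 3 * N / p ^ k := by
    have h1 : ((2 * N / p ^ k : ℕ) : ℝ) ≤ (2 * N : ℕ) / (p ^ k : ℕ) := Nat.cast_div_le
    push_cast at h1 ⊢
    have h2 : (1 : ℝ) ≤ N / p ^ k := (one_le_div hpk).2 hNk
    calc _ ≤ 2 * (N : ℝ) / p ^ k + N / p ^ k := add_le_add h1 h2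
      _ = _ := by ring
  have hball : (N : ℝ) ^ 4 / 16 ≤ (heightBall N).ncard := by
    rw [ncard_heightBall, Nat.cast_pow]
    calc (N : ℝ) ^ 4 / 16 = ((N : ℝ) ^ 2 / 4) ^ 2 := by ring
      _ ≤ _ := by gcongr; exact sq_div_four_le_heightCount N
  have hpos := ncard_heightBall_pos hN1
  rw [Real.dist_eq, sub_zero, abs_of_nonneg (by positivity), div_lt_iff₀ hpos]
  have hbound : ((X ∩ heightBall N).ncard : ℝ) ≤ 144 * C * ((p : ℝ)⁻¹) ^ k * (heightBall N).ncard := by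
    calc ((X ∩ heightBall N).ncard : ℝ) ≤ (#Z : ℝ) * (N * ((2 * N / p ^ k + 1 : ℕ) : ℝ)) ^ 2 := by
          exact_mod_cast hcount
      _ ≤ (C * p ^ k) * (N * (3 * N / p ^ k)) ^ 2 := by gcongr
      _ = 144 * C * ((p : ℝ)⁻¹) ^ k * ((N : ℝ) ^ 4 / 16) := by
          rw [inv_pow]; field_simp; ring
      _ ≤ _ := by gcongr
  exact hbound.trans_lt (by gcongr)

end AffineHeight

/-! ### The `p`-adic sup norm and linear recurrences. -/

namespace AffineHeight

open Finset

/-- The `p`-adic sup norm of a rational point of the plane. -/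
noncomputable def vnorm (p : ℕ) [Fact p.Prime] (z : Fin 2 → ℚ) : ℝ :=
  max ‖(z 0 : ℚ_[p])‖ ‖(z 1 : ℚ_[p])‖

theorem ord_zero {p : ℕ} : ord p 0 = ⊤ := if_pos rfl

variable {p : ℕ} [Fact p.Prime]

theorem vnorm_nonneg (z : Fin 2 → ℚ) : 0 ≤ vnorm p z := (norm_nonneg _).trans (le_max_left _ _)

theorem norm_apply_le_vnorm (z : Fin 2 → ℚ) (i : Fin 2) : ‖(z i : ℚ_[p])‖ ≤ vnorm p z := by
  fin_cases i
  · exact le_max_left _ _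
  · exact le_max_right _ _

theorem vnorm_le_iff {z : Fin 2 → ℚ} {r : ℝ} : vnorm p z ≤ r ↔ ∀ i, ‖(z i : ℚ_[p])‖ ≤ r := by
  rw [vnorm, max_le_iff, Fin.forall_fin_two]

theorem vnorm_zero : vnorm p 0 = 0 := by simp [vnorm]

theorem vnorm_eq_zero_iff {z : Fin 2 → ℚ} : vnorm p z = 0 ↔ z = 0 := by
  constructor
  · intro h
    funext i
    have h1 := norm_apply_le_vnorm (p := p) z i
    rw [h, norm_le_zero_iff] at h1
    exact_mod_cast h1
  · rintro rfl
    exact vnorm_zero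

theorem vnorm_pos_iff {z : Fin 2 → ℚ} : 0 < vnorm p z ↔ z ≠ 0 := by
  rw [(vnorm_nonneg z).lt_iff_ne', Ne, vnorm_eq_zero_iff]

theorem vnorm_smul (r : ℚ) (z : Fin 2 → ℚ) : vnorm p (r • z) = ‖(r : ℚ_[p])‖ * vnorm p z := by
  simp only [vnorm, Pi.smul_apply, smul_eq_mul, Rat.cast_mul, norm_mul]
  rw [mul_max_of_nonneg _ _ (norm_nonneg _)]

theorem vnorm_neg (z : Fin 2 → ℚ) : vnorm p (-z) = vnorm p z := by
  simp only [vnorm, Pi.neg_apply, Rat.cast_neg, norm_neg]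

theorem vnorm_add_le (z w : Fin 2 → ℚ) : vnorm p (z + w) ≤ max (vnorm p z) (vnorm p w) := by
  rw [vnorm_le_iff]
  intro i
  rw [Pi.add_apply, Rat.cast_add]
  exact (Padic.nonarchimedean _ _).trans
    (max_le_max (norm_apply_le_vnorm z i) (norm_apply_le_vnorm w i))

theorem vnorm_sub_le (z w : Fin 2 → ℚ) : vnorm p (z - w) ≤ max (vnorm p z) (vnorm p w) := by
  rw [sub_eq_add_neg, ← vnorm_neg w]
  exact vnorm_add_le _ _

theorem vnorm_add_eq_of_lt {z w : Fin 2 → ℚ} (h : vnorm p z < vnorm p w) :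
    vnorm p (z + w) = vnorm p w := by
  refine le_antisymm ((vnorm_add_le z w).trans (max_le h.le le_rfl)) ?_
  have h1 := vnorm_sub_le (p := p) (z + w) z
  rw [add_sub_cancel_left] at h1
  exact (le_max_iff.1 h1).resolve_right (not_le.2 h)

theorem vnorm_sub_eq_of_lt {z w : Fin 2 → ℚ} (h : vnorm p z < vnorm p w) :
    vnorm p (w - z) = vnorm p w := by
  rw [sub_eq_add_neg, add_comm, vnorm_add_eq_of_lt (by rwa [vnorm_neg])]

variable (p) in
theorem exists_vnorm_mulVec_le (A : Matrix (Fin 2) (Fin 2) ℚ) :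
    ∃ K : ℝ, 0 < K ∧ ∀ z, vnorm p (A.mulVec z) ≤ K * vnorm p z := by
  obtain ⟨K, hK⟩ : ∃ K : ℝ, 1 ≤ K ∧ ∀ i j, ‖(A i j : ℚ_[p])‖ ≤ K := by
    refine ⟨1 + ∑ i, ∑ j, ‖(A i j : ℚ_[p])‖, ?_, fun i j => ?_⟩
    · have : 0 ≤ ∑ i, ∑ j, ‖(A i j : ℚ_[p])‖ := by positivity
      linarith
    · have h1 : ‖(A i j : ℚ_[p])‖ ≤ ∑ j, ‖(A i j : ℚ_[p])‖ :=
        single_le_sum (f := fun j => ‖(A i j : ℚ_[p])‖) (fun _ _ => norm_nonneg _) (mem_univ j)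
      have h2 : ∑ j, ‖(A i j : ℚ_[p])‖ ≤ ∑ i, ∑ j, ‖(A i j : ℚ_[p])‖ :=
        single_le_sum (f := fun i => ∑ j, ‖(A i j : ℚ_[p])‖) (fun _ _ => by positivity)
          (mem_univ i)
      linarith
  refine ⟨K, by linarith, fun z => ?_⟩
  rw [vnorm_le_iff]
  intro i
  rw [Matrix.mulVec, dotProduct, Fin.sum_univ_two]
  push_cast
  refine (Padic.nonarchimedean _ _).trans (max_le ?_ ?_)
  all_goals
    rw [norm_mul]
    exact mul_le_mul (hK.2 _ _) (norm_apply_le_vnorm _ _) (norm_nonneg _) (by linarith)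

/-! ### Orders and norms -/

theorem ord_eq {r : ℚ} (hr : r ≠ 0) : ord p r = ((-Real.logb p ‖(r : ℚ_[p])‖ : ℝ) : EReal) := by
  have hp := one_lt_prime_cast p
  rw [ord, if_neg hr, Padic.eq_padicNorm, padicNorm.eq_zpow_of_nonzero hr]
  push_cast
  rw [← Real.rpow_intCast, Real.logb_rpow (by linarith) hp.ne']
  push_cast
  rw [neg_neg]

theorem logb_mono {x y : ℝ} (hx : 0 < x) (hxy : x ≤ y) : Real.logb p x ≤ Real.logb p y :=
  Real.logb_le_logb_of_le (one_lt_prime_cast p) hx hxy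

/-- The origin must be excluded: its order is `⊤`, whereas `Real.logb p 0 = 0`. -/
theorem pointOrd_eq {z : Fin 2 → ℚ} (hz : z ≠ 0) :
    pointOrd p z = ((-Real.logb p (vnorm p z) : ℝ) : EReal) := by
  have hpos : ∀ {r : ℚ}, r ≠ 0 → 0 < ‖(r : ℚ_[p])‖ := fun hr => norm_pos_iff.2 (by exact_mod_cast hr)
  rw [pointOrd, vnorm]
  by_cases h0 : z 0 = 0
  · have h1 : z 1 ≠ 0 := fun h1 => hz (funext fun i => by fin_cases i <;> assumption)
    rw [h0, ord_zero, min_eq_right le_top, ord_eq h1, Rat.cast_zero, norm_zero,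
      max_eq_right (norm_nonneg _)]
  · by_cases h1 : z 1 = 0
    · rw [h1, ord_zero, min_eq_left le_top, ord_eq h0, Rat.cast_zero, norm_zero,
        max_eq_left (norm_nonneg _)]
    · rw [ord_eq h0, ord_eq h1, ← EReal.coe_strictMono.monotone.map_min, min_neg_neg]
      rcases le_total ‖(z 0 : ℚ_[p])‖ ‖(z 1 : ℚ_[p])‖ with h | h
      · rw [max_eq_right h, max_eq_right (logb_mono (hpos h0) h)]
      · rw [max_eq_left h, max_eq_left (logb_mono (hpos h1) h)]

/-- Two-sided bounds on `F ^ t z` determine the local height. -/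
theorem hasLocalHeight_of_bounds {F : (Fin 2 → ℚ) → (Fin 2 → ℚ)} {z : Fin 2 → ℚ} {ρ : ℝ}
    (hρ : 0 < ρ) (C : ℝ) (hup : ∀ᶠ t in atTop, vnorm p (F^[t] z) ≤ C * ρ ^ t)
    (hlow : ∀ ε : ℝ, 0 < ε → ∀ᶠ t : ℕ in atTop,
      (p : ℝ) ^ (-(ε * t)) * ρ ^ t ≤ vnorm p (F^[t] z)) :
    HasLocalHeight p F z ((Real.logb p ρ : ℝ) : EReal) := by
  have hp := one_lt_prime_cast p
  have hp0 : (0 : ℝ) < p := by linarith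
  have hpos : ∀ᶠ t in atTop, 0 < vnorm p (F^[t] z) := by
    filter_upwards [hlow 1 one_pos] with t ht
    exact lt_of_lt_of_le (by positivity) ht
  have hreal : Tendsto (fun t : ℕ => Real.logb p (vnorm p (F^[t] z)) / t) atTop
      (𝓝 (Real.logb p ρ)) := by
    rw [tendsto_order]
    constructor
    · intro a ha
      filter_upwards [hlow ((Real.logb p ρ - a) / 2) (by linarith), eventually_gt_atTop 0]
        with t ht ht0
      have ht0' : (0 : ℝ) < t := by exact_mod_cast ht0
      have h1 := logb_mono (p := p) (by positivity) ht
      rw [Real.logb_mul (by positivity) (by positivity), Real.logb_rpow hp0 hp.ne',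
        Real.logb_pow] at h1
      rw [lt_div_iff₀ ht0']
      nlinarith
    · intro b hb
      have hlim : Tendsto (fun t : ℕ => Real.logb p (max C 1) / t) atTop (𝓝 0) :=
        tendsto_const_nhds.div_atTop tendsto_natCast_atTop_atTop
      filter_upwards [hup, hpos, eventually_gt_atTop 0,
        hlim.eventually_lt_const (sub_pos.2 hb)] with t ht hpos ht0 hlt
      have ht0' : (0 : ℝ) < t := by exact_mod_cast ht0
      have hC : 0 < max C 1 := lt_max_of_lt_right one_pos
      have h1 := logb_mono (p := p) hpos (ht.trans
        (mul_le_mul_of_nonneg_right (le_max_left C 1) (by positivity)))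
      rw [Real.logb_mul hC.ne' (by positivity), Real.logb_pow] at h1
      rw [div_lt_iff₀ ht0'] at hlt ⊢
      linarith
  have hcoe := (continuous_coe_real_ereal.tendsto _).comp hreal
  refine hcoe.congr' ?_
  filter_upwards [hpos] with t ht
  rw [Function.comp_apply, pointOrd_eq (vnorm_pos_iff.1 ht), ← EReal.coe_neg, neg_neg,
    ← EReal.coe_natCast, EReal.coe_div]

theorem hasLocalHeight_of_pow_bounds {F : (Fin 2 → ℚ) → (Fin 2 → ℚ)} {z : Fin 2 → ℚ} {c C ρ : ℝ}
    (hρ : 0 < ρ) (hc : 0 < c) (hup : ∀ᶠ t in atTop, vnorm p (F^[t] z) ≤ C * ρ ^ t)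
    (hlow : ∀ᶠ t in atTop, c * ρ ^ t ≤ vnorm p (F^[t] z)) :
    HasLocalHeight p F z ((Real.logb p ρ : ℝ) : EReal) := by
  refine hasLocalHeight_of_bounds hρ C hup fun ε hε => ?_
  filter_upwards [hlow, (tendsto_rpow_neg_mul_nat p hε).eventually_lt_const hc] with t h1 h2
  exact (mul_le_mul_of_nonneg_right h2.le (by positivity)).trans h1

/-! ### Linear dynamics -/

/-- Cayley–Hamilton. It gives access to the growth of orbits through `T` and `D` without extending
the field to contain the eigenvalues. -/
theorem mul_self_eq_trace_smul_sub (A : Matrix (Fin 2) (Fin 2) ℚ) :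
    A * A = A.trace • A - A.det • (1 : Matrix (Fin 2) (Fin 2) ℚ) := by
  ext i j
  fin_cases i <;> fin_cases j <;>
    simp [Matrix.mul_apply, Fin.sum_univ_two, Matrix.trace_fin_two, Matrix.det_fin_two] <;> ring

theorem pow_add_two_mulVec (A : Matrix (Fin 2) (Fin 2) ℚ) (w : Fin 2 → ℚ) (t : ℕ) :
    (A ^ (t + 2)).mulVec w = A.trace • (A ^ (t + 1)).mulVec w - A.det • (A ^ t).mulVec w := by
  rw [pow_add, pow_two, mul_self_eq_trace_smul_sub, Matrix.mul_sub, Matrix.sub_mulVec,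
    Matrix.mul_smul, Matrix.mul_smul, mul_one, Matrix.smul_mulVec, Matrix.smul_mulVec, pow_succ]

variable {A : Matrix (Fin 2) (Fin 2) ℚ}

/-- Two consecutive points of an orbit measured with weight `θ`. -/
noncomputable def pairNorm (p : ℕ) [Fact p.Prime] (A : Matrix (Fin 2) (Fin 2) ℚ) (θ : ℝ)
    (w : Fin 2 → ℚ) (t : ℕ) : ℝ :=
  max (θ * vnorm p ((A ^ t).mulVec w)) (vnorm p ((A ^ (t + 1)).mulVec w))

/-- The weight `θ` balances the two terms of the recurrence, so one step costs exactly a factor `θ`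
and no constant accumulates over `t` steps. -/
theorem pairNorm_succ_le {θ : ℝ} (hθ : 0 < θ) (hT : ‖(A.trace : ℚ_[p])‖ ≤ θ)
    (hD : ‖(A.det : ℚ_[p])‖ ≤ θ ^ 2) (w : Fin 2 → ℚ) (t : ℕ) :
    pairNorm p A θ w (t + 1) ≤ θ * pairNorm p A θ w t := by
  rw [pairNorm, pairNorm, mul_max_of_nonneg _ _ hθ.le, add_assoc, pow_add_two_mulVec]
  refine max_le (le_max_right _ _) ((vnorm_sub_le _ _).trans ?_)
  rw [vnorm_smul, vnorm_smul, max_comm, ← mul_assoc, ← sq]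
  exact max_le_max (mul_le_mul_of_nonneg_right hD (vnorm_nonneg _))
    (mul_le_mul_of_nonneg_right hT (vnorm_nonneg _))

theorem exists_vnorm_pow_le {θ : ℝ} (hθ : 0 < θ) (hT : ‖(A.trace : ℚ_[p])‖ ≤ θ)
    (hD : ‖(A.det : ℚ_[p])‖ ≤ θ ^ 2) :
    ∃ K : ℝ, 0 < K ∧ ∀ t w, vnorm p ((A ^ t).mulVec w) ≤ K * θ ^ t * vnorm p w := by
  obtain ⟨k, hk, hA⟩ := exists_vnorm_mulVec_le p A
  refine ⟨max θ k / θ, by positivity, fun t w => ?_⟩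
  have h0 : pairNorm p A θ w 0 ≤ max θ k * vnorm p w := by
    rw [pairNorm, pow_zero, Matrix.one_mulVec, zero_add, pow_one]
    exact max_le (mul_le_mul_of_nonneg_right (le_max_left _ _) (vnorm_nonneg _))
      ((hA w).trans (mul_le_mul_of_nonneg_right (le_max_right _ _) (vnorm_nonneg _)))
  have h1 : pairNorm p A θ w t ≤ θ ^ t * pairNorm p A θ w 0 := by
    induction t with
    | zero => simp
    | succ t ih =>
      refine (pairNorm_succ_le hθ hT hD w t).trans ?_
      rw [pow_succ', mul_assoc]
      exact mul_le_mul_of_nonneg_left ih hθ.le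
  have h2 : θ * vnorm p ((A ^ t).mulVec w) ≤ θ ^ t * (max θ k * vnorm p w) :=
    (le_max_left _ _).trans (h1.trans (mul_le_mul_of_nonneg_left h0 (by positivity)))
  rw [← mul_le_mul_iff_right₀ hθ]
  refine h2.trans_eq ?_
  field_simp

/-- If `ν(D) ≤ 2 ν(T)` all orbits grow like `‖D‖ ^ (t / 2)`. -/
theorem exists_le_vnorm_pow (hdet : A.det ≠ 0)
    (h : ‖(A.trace : ℚ_[p])‖ ^ 2 ≤ ‖(A.det : ℚ_[p])‖) :
    ∃ K : ℝ, 0 < K ∧ ∀ t w, √‖(A.det : ℚ_[p])‖ ^ t * vnorm p w ≤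
      K * vnorm p ((A ^ t).mulVec w) := by
  have hd : 0 < ‖(A.det : ℚ_[p])‖ := norm_pos_iff.2 (by exact_mod_cast hdet)
  set ρ := √‖(A.det : ℚ_[p])‖ with hρdef
  have hρ : 0 < ρ := Real.sqrt_pos.2 hd
  have hρ2 : ρ ^ 2 = ‖(A.det : ℚ_[p])‖ := Real.sq_sqrt hd.le
  have hT : ‖(A.trace : ℚ_[p])‖ ≤ ρ := Real.le_sqrt_of_sq_le h
  obtain ⟨k, hk, hA⟩ := exists_vnorm_mulVec_le p A
  refine ⟨max ρ k / ρ, by positivity, fun t w => ?_⟩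
  have hstep : ∀ t, ρ * pairNorm p A ρ w t ≤ pairNorm p A ρ w (t + 1) := by
    intro t
    have hrec := pow_add_two_mulVec A w t
    -- The recurrence solved backwards for its oldest term gives the lower bound.
    have h1 : A.det • (A ^ t).mulVec w = A.trace • (A ^ (t + 1)).mulVec w - (A ^ (t + 2)).mulVec w := by
      rw [hrec]; abel
    have h2 : ρ ^ 2 * vnorm p ((A ^ t).mulVec w) ≤ pairNorm p A ρ w (t + 1) := by
      rw [hρ2, ← vnorm_smul, h1]
      refine (vnorm_sub_le _ _).trans (max_le_max ?_ le_rfl)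
      rw [vnorm_smul]
      exact mul_le_mul_of_nonneg_right hT (vnorm_nonneg _)
    conv_lhs => rw [pairNorm]
    rw [mul_max_of_nonneg _ _ hρ.le, ← mul_assoc, ← sq]
    exact max_le h2 (le_max_left _ _)
  have h1 : ρ ^ t * pairNorm p A ρ w 0 ≤ pairNorm p A ρ w t := by
    induction t with
    | zero => simp
    | succ t ih =>
      refine le_trans ?_ (hstep t)
      rw [pow_succ', mul_assoc]
      exact mul_le_mul_of_nonneg_left ih hρ.le
  have h0 : ρ * vnorm p w ≤ pairNorm p A ρ w 0 := by
    rw [pairNorm, pow_zero, Matrix.one_mulVec]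
    exact le_max_left _ _
  have h2 : pairNorm p A ρ w t ≤ max ρ k * vnorm p ((A ^ t).mulVec w) := by
    rw [pairNorm, pow_succ', ← Matrix.mulVec_mulVec]
    exact max_le (mul_le_mul_of_nonneg_right (le_max_left _ _) (vnorm_nonneg _))
      ((hA _).trans (mul_le_mul_of_nonneg_right (le_max_right _ _) (vnorm_nonneg _)))
  rw [← mul_le_mul_iff_right₀ hρ]
  calc ρ * (ρ ^ t * vnorm p w) = ρ ^ t * (ρ * vnorm p w) := by ring
    _ ≤ ρ ^ t * pairNorm p A ρ w 0 := by gcongr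
    _ ≤ _ := h1.trans h2
    _ = _ := by field_simp

/-- The vectors whose orbits are `O((‖D‖ / ‖T‖) ^ t)`. -/
def slowSet (p : ℕ) [Fact p.Prime] (A : Matrix (Fin 2) (Fin 2) ℚ) : Set (Fin 2 → ℚ) :=
  {w | ∃ C : ℝ, ∀ t, vnorm p ((A ^ t).mulVec w) ≤
    C * (‖(A.det : ℚ_[p])‖ / ‖(A.trace : ℚ_[p])‖) ^ t}

theorem sub_mem_slowSet {w w' : Fin 2 → ℚ} (hw : w ∈ slowSet p A) (hw' : w' ∈ slowSet p A) :
    w - w' ∈ slowSet p A := by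
  obtain ⟨C, hC⟩ := hw
  obtain ⟨C', hC'⟩ := hw'
  refine ⟨max C C', fun t => ?_⟩
  rw [Matrix.mulVec_sub]
  refine (vnorm_sub_le _ _).trans (max_le ((hC t).trans ?_) ((hC' t).trans ?_))
  · gcongr; exact le_max_left _ _
  · gcongr; exact le_max_right _ _

/-- Put `τ = ‖T‖` and `σ = ‖D‖ / τ < τ`. As soon as `‖w_{t+1}‖ > σ ‖w_t‖`, the term `T w_{t+1}`
strictly dominates `D w_t`, so the norm is multiplied by exactly `τ` and the inequality persists. If
this never happens, `w` is slow. -/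
theorem exists_vnorm_pow_eq (h : ‖(A.det : ℚ_[p])‖ < ‖(A.trace : ℚ_[p])‖ ^ 2) {w : Fin 2 → ℚ}
    (hw : w ∉ slowSet p A) :
    ∃ c : ℝ, 0 < c ∧ ∀ᶠ t in atTop,
      vnorm p ((A ^ t).mulVec w) = c * ‖(A.trace : ℚ_[p])‖ ^ t := by
  set τ := ‖(A.trace : ℚ_[p])‖ with hτdef
  have hτ : 0 < τ := by
    refine lt_of_le_of_ne (norm_nonneg _) fun h0 => ?_
    rw [← h0] at h
    exact absurd h (not_lt.2 (by
      rw [zero_pow two_ne_zero]; exact norm_nonneg _))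
  set σ := ‖(A.det : ℚ_[p])‖ / τ with hσdef
  have hστ : σ < τ := by rw [hσdef, div_lt_iff₀ hτ, ← sq]; exact h
  have hσ : 0 ≤ σ := by positivity
  have hdσ : ‖(A.det : ℚ_[p])‖ = τ * σ := by rw [hσdef]; field_simp
  obtain ⟨t₀, ht₀⟩ : ∃ t₀, σ * vnorm p ((A ^ t₀).mulVec w) < vnorm p ((A ^ (t₀ + 1)).mulVec w) := by
    by_contra! hall
    refine hw ⟨vnorm p w, fun t => ?_⟩
    induction t with
    | zero => simp
    | succ t ih =>
      refine (hall t).trans ?_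
      rw [pow_succ', mul_left_comm]
      exact mul_le_mul_of_nonneg_left ih hσ
  have hind : ∀ k, σ * vnorm p ((A ^ (t₀ + k)).mulVec w) < vnorm p ((A ^ (t₀ + k + 1)).mulVec w) ∧
      vnorm p ((A ^ (t₀ + k + 1)).mulVec w) = τ ^ k * vnorm p ((A ^ (t₀ + 1)).mulVec w) := by
    intro k
    induction k with
    | zero => exact ⟨ht₀, by simp⟩
    | succ k ih =>
      obtain ⟨ih1, ih2⟩ := ih
      have hpos : 0 < vnorm p ((A ^ (t₀ + k + 1)).mulVec w) :=
        lt_of_le_of_lt (mul_nonneg hσ (vnorm_nonneg _)) ih1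
      have heq : vnorm p ((A ^ (t₀ + k + 2)).mulVec w) =
          τ * vnorm p ((A ^ (t₀ + k + 1)).mulVec w) := by
        rw [pow_add_two_mulVec, vnorm_sub_eq_of_lt, vnorm_smul]
        rw [vnorm_smul, vnorm_smul, hdσ, mul_assoc]
        exact mul_lt_mul_of_pos_left ih1 hτ
      refine ⟨?_, ?_⟩
      · change σ * vnorm p ((A ^ (t₀ + k + 1)).mulVec w) < vnorm p ((A ^ (t₀ + k + 2)).mulVec w)
        rw [heq]
        exact mul_lt_mul_of_pos_right hστ hpos
      · change vnorm p ((A ^ (t₀ + k + 2)).mulVec w) = _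
        rw [heq, ih2, pow_succ' τ, mul_assoc]
  refine ⟨vnorm p ((A ^ (t₀ + 1)).mulVec w) / τ ^ (t₀ + 1), ?_, ?_⟩
  · exact div_pos (lt_of_le_of_lt (mul_nonneg hσ (vnorm_nonneg _)) ht₀) (by positivity)
  · filter_upwards [eventually_ge_atTop (t₀ + 1)] with t ht
    obtain ⟨k, rfl⟩ := Nat.exists_eq_add_of_le ht
    rw [show t₀ + 1 + k = t₀ + k + 1 by ring, (hind k).2, div_mul_eq_mul_div,
      eq_div_iff (by positivity)]
    ring

/-- The determinant of two vectors. -/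
def cross (w w' : Fin 2 → ℚ) : ℚ := w 0 * w' 1 - w 1 * w' 0

theorem cross_mulVec (A : Matrix (Fin 2) (Fin 2) ℚ) (w w' : Fin 2 → ℚ) :
    cross (A.mulVec w) (A.mulVec w') = A.det * cross w w' := by
  simp only [cross, Matrix.mulVec, dotProduct, Fin.sum_univ_two, Matrix.det_fin_two]
  ring

theorem cross_pow_mulVec (A : Matrix (Fin 2) (Fin 2) ℚ) (w w' : Fin 2 → ℚ) (t : ℕ) :
    cross ((A ^ t).mulVec w) ((A ^ t).mulVec w') = A.det ^ t * cross w w' := by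
  rw [cross_mulVec, Matrix.det_pow]

theorem norm_cross_le (w w' : Fin 2 → ℚ) :
    ‖(cross w w' : ℚ_[p])‖ ≤ vnorm p w * vnorm p w' := by
  rw [cross, sub_eq_add_neg]
  push_cast
  refine (Padic.nonarchimedean _ _).trans (max_le ?_ ?_)
  · rw [norm_mul]
    exact mul_le_mul (norm_apply_le_vnorm _ _) (norm_apply_le_vnorm _ _) (norm_nonneg _)
      (vnorm_nonneg _)
  · rw [norm_neg, norm_mul]
    exact mul_le_mul (norm_apply_le_vnorm _ _) (norm_apply_le_vnorm _ _) (norm_nonneg _)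
      (vnorm_nonneg _)

/-- Along two slow orbits the determinant has norm `‖D‖ ^ t * ‖cross w w'‖` and is also `O((‖D‖ /
‖T‖) ^ (2t))`. The ratio `(‖D‖ / ‖T‖²) ^ t` tends to 0. -/
theorem cross_eq_zero_of_mem_slowSet (hdet : A.det ≠ 0)
    (h : ‖(A.det : ℚ_[p])‖ < ‖(A.trace : ℚ_[p])‖ ^ 2) {w w' : Fin 2 → ℚ}
    (hw : w ∈ slowSet p A) (hw' : w' ∈ slowSet p A) : cross w w' = 0 := by
  obtain ⟨C, hC⟩ := hw
  obtain ⟨C', hC'⟩ := hw'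
  have hd : 0 < ‖(A.det : ℚ_[p])‖ := norm_pos_iff.2 (by exact_mod_cast hdet)
  have hτ2 : 0 < ‖(A.trace : ℚ_[p])‖ ^ 2 := hd.trans h
  have hτ : ‖(A.trace : ℚ_[p])‖ ≠ 0 := fun h0 => by rw [h0] at hτ2; norm_num at hτ2
  set τ := ‖(A.trace : ℚ_[p])‖
  set δ := ‖(A.det : ℚ_[p])‖
  have hbound : ∀ t : ℕ, ‖(cross w w' : ℚ_[p])‖ ≤ C * C' * (δ / τ ^ 2) ^ t := by
    intro t
    have h1 := (norm_cross_le (p := p) ((A ^ t).mulVec w) ((A ^ t).mulVec w')).trans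
      (mul_le_mul (hC t) (hC' t) (vnorm_nonneg _) ((vnorm_nonneg _).trans (hC t)))
    rw [cross_pow_mulVec] at h1
    push_cast at h1
    rw [norm_mul, norm_pow] at h1
    have h2 : C * (δ / τ) ^ t * (C' * (δ / τ) ^ t) = δ ^ t * (C * C' * (δ / τ ^ 2) ^ t) := by
      calc _ = C * C' * ((δ / τ) * (δ / τ)) ^ t := by rw [mul_pow]; ring
        _ = C * C' * (δ * (δ / τ ^ 2)) ^ t := by congr 2; field_simp
        _ = _ := by rw [mul_pow]; ring
    rw [h2] at h1
    exact le_of_mul_le_mul_left h1 (pow_pos hd t)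
  have hlim : Tendsto (fun t : ℕ => C * C' * (δ / τ ^ 2) ^ t) atTop (𝓝 0) := by
    simpa using (tendsto_pow_atTop_nhds_zero_of_lt_one (by positivity)
      ((div_lt_one hτ2).2 h)).const_mul (C * C')
  have := ge_of_tendsto' hlim hbound
  rw [norm_le_zero_iff] at this
  exact_mod_cast this

/-- Nonzero slow vectors all share one direction. The slow `p`-adic line may contain no nonzero
rational vector, and then `X` has at most one point. -/
theorem hasDensity_zero_of_sub_mem_slowSet (hdet : A.det ≠ 0)
    (h : ‖(A.det : ℚ_[p])‖ < ‖(A.trace : ℚ_[p])‖ ^ 2) {X : Set (Fin 2 → ℚ)}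
    (hX : ∀ z ∈ X, ∀ z' ∈ X, z - z' ∈ slowSet p A) : HasDensity X 0 := by
  by_cases hE : ∃ e ∈ slowSet p A, e ≠ 0
  · obtain ⟨e, he, he0⟩ := hE
    refine hasDensity_zero_of_collinear he0 fun z hz z' hz' => ?_
    exact sub_eq_zero.1 (cross_eq_zero_of_mem_slowSet hdet h (hX z hz z' hz') he)
  · push Not at hE
    refine hasDensity_zero_of_collinear (e := ![1, 0]) (fun h0 => by simpa using congrFun h0 0) ?_
    intro z hz z' hz'
    rw [hE _ (hX z hz z' hz')]
    simp

end AffineHeight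

namespace AffineHeight

open Finset

/-! ### Affine dynamics -/

theorem iterate_affine_sub (M : GL (Fin 2) ℚ) (s z z' : Fin 2 → ℚ) (t : ℕ) :
    (affine M s)^[t] z - (affine M s)^[t] z' =
      (M.val ^ t).mulVec (z - z') := by
  induction t with
  | zero => simp
  | succ t ih =>
    rw [Function.iterate_succ_apply', Function.iterate_succ_apply', affine, affine,
      add_sub_add_right_eq_sub, ← Matrix.mulVec_sub, ih, Matrix.mulVec_mulVec, pow_succ']

theorem iterate_affine_succ_sub (M : GL (Fin 2) ℚ) (s z : Fin 2 → ℚ) (t : ℕ) :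
    (affine M s)^[t + 1] z - (affine M s)^[t] z =
      (M.val ^ t).mulVec (affine M s z - z) := by
  rw [Function.iterate_succ_apply, iterate_affine_sub]

theorem iterate_affine_of_fixed {M : GL (Fin 2) ℚ} {s z' : Fin 2 → ℚ} (h : affine M s z' = z')
    (z : Fin 2 → ℚ) (t : ℕ) :
    (affine M s)^[t] z = z' + (M.val ^ t).mulVec (z - z') := by
  rw [← iterate_affine_sub M s, Function.iterate_fixed h, add_sub_cancel]

theorem iterate_affine_zero (M : GL (Fin 2) ℚ) (z : Fin 2 → ℚ) (t : ℕ) :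
    (affine M 0)^[t] z = (M.val ^ t).mulVec z := by
  rw [iterate_affine_of_fixed (z' := 0) (by simp [affine]), zero_add, sub_zero]

theorem det_one_sub (A : Matrix (Fin 2) (Fin 2) ℚ) : (1 - A).det = 1 - A.trace + A.det := by
  simp [Matrix.det_fin_two, Matrix.trace_fin_two]
  ring

theorem exists_fixed (M : GL (Fin 2) ℚ) (s : Fin 2 → ℚ)
    (h : 1 - M.val.trace + M.val.det ≠ 0) :
    ∃ z, affine M s z = z := by
  rw [← det_one_sub] at h
  refine ⟨((1 - M.val)⁻¹).mulVec s, ?_⟩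
  have h1 : (1 - M.val).mulVec
      (((1 - M.val)⁻¹).mulVec s) = s := by
    rw [Matrix.mulVec_mulVec, Matrix.mul_nonsing_inv _ (isUnit_iff_ne_zero.2 h), Matrix.one_mulVec]
  rw [Matrix.sub_mulVec, Matrix.one_mulVec] at h1
  exact eq_sub_iff_add_eq'.1 h1.symm

theorem fixed_ne_zero {M : GL (Fin 2) ℚ} {s z : Fin 2 → ℚ} (hs : s ≠ 0) (h : affine M s z = z) :
    z ≠ 0 := by
  rintro rfl
  rw [affine, Matrix.mulVec_zero, zero_add] at h
  exact hs h

theorem det_coe_ne_zero (M : GL (Fin 2) ℚ) : M.val.det ≠ 0 :=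
  (Matrix.isUnits_det_units M).ne_zero

variable {p : ℕ} [Fact p.Prime]

theorem norm_det_pos (M : GL (Fin 2) ℚ) :
    0 < ‖(M.val.det : ℚ_[p])‖ :=
  norm_pos_iff.2 (by exact_mod_cast det_coe_ne_zero M)

theorem norm_trace_pos {A : Matrix (Fin 2) (Fin 2) ℚ}
    (h : ‖(A.det : ℚ_[p])‖ < ‖(A.trace : ℚ_[p])‖ ^ 2) : 0 < ‖(A.trace : ℚ_[p])‖ := by
  refine lt_of_le_of_ne (norm_nonneg _) fun h0 => ?_
  rw [← h0, zero_pow two_ne_zero] at h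
  exact absurd h (not_lt.2 (norm_nonneg _))

theorem one_sub_trace_add_det_ne_zero_of_lt_one {T D : ℚ} (hT : ‖(T : ℚ_[p])‖ < 1)
    (hD : ‖(D : ℚ_[p])‖ < 1) : 1 - T + D ≠ 0 := by
  intro h
  have h1 : (1 : ℚ_[p]) = T + -D := by
    have : (1 : ℚ) = T + -D := by linarith
    exact_mod_cast congrArg (Rat.cast : ℚ → ℚ_[p]) this
  have h2 := Padic.nonarchimedean (T : ℚ_[p]) (-D)
  rw [← h1, norm_one, norm_neg] at h2
  exact (max_lt hT hD).not_ge h2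

theorem one_sub_trace_add_det_ne_zero_of_one_lt {T D : ℚ} (hD : 1 < ‖(D : ℚ_[p])‖)
    (hTD : ‖(T : ℚ_[p])‖ ^ 2 ≤ ‖(D : ℚ_[p])‖) : 1 - T + D ≠ 0 := by
  intro h
  have h1 : (D : ℚ_[p]) = T + -1 := by
    have : D = T + -1 := by linarith
    exact_mod_cast congrArg (Rat.cast : ℚ → ℚ_[p]) this
  have h2 := Padic.nonarchimedean (T : ℚ_[p]) (-1)
  rw [← h1, norm_neg, norm_one] at h2
  have hT : ‖(T : ℚ_[p])‖ < ‖(D : ℚ_[p])‖ := by nlinarith [norm_nonneg (T : ℚ_[p])]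
  exact (max_lt hT hD).not_ge h2

/-- If `u` is not slow, `‖A^t u‖ = c τ^t` with `τ > 1`, so `A^(t+1) u` dominates `A^t u` and the
difference is not slow either. This passes from displacements `F z - z` to the points themselves. -/
theorem mem_slowSet_of_expanding {A : Matrix (Fin 2) (Fin 2) ℚ}
    (hT : 1 < ‖(A.trace : ℚ_[p])‖)
    (h : ‖(A.det : ℚ_[p])‖ < ‖(A.trace : ℚ_[p])‖ ^ 2) {u : Fin 2 → ℚ}
    (hu : A.mulVec u - u ∈ slowSet p A) : u ∈ slowSet p A := by
  by_contra hus
  obtain ⟨c, hc, hev⟩ := exists_vnorm_pow_eq h hus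
  obtain ⟨C, hC⟩ := hu
  have hτ := norm_trace_pos h
  set τ := ‖(A.trace : ℚ_[p])‖
  set σ := ‖(A.det : ℚ_[p])‖ / τ
  have hστ : σ / τ < 1 := by
    rw [div_lt_one hτ, div_lt_iff₀ hτ, ← sq]; exact h
  have hlim : Tendsto (fun t : ℕ => C * (σ / τ) ^ t) atTop (𝓝 0) := by
    simpa using (tendsto_pow_atTop_nhds_zero_of_lt_one (by positivity) hστ).const_mul C
  obtain ⟨t, h1, h2, h3⟩ := (hev.and (((tendsto_add_atTop_nat 1).eventually hev).and
    (hlim.eventually_lt_const (show 0 < c * τ by positivity)))).exists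
  have h4 := hC t
  rw [Matrix.mulVec_sub, Matrix.mulVec_mulVec, ← pow_succ, vnorm_sub_eq_of_lt, h2] at h4
  · have h5 : C * σ ^ t = C * (σ / τ) ^ t * τ ^ t := by
      
      rw [div_pow σ, mul_assoc, div_mul_cancel₀ _ (pow_pos hτ t).ne']
    rw [h5, pow_succ', ← mul_assoc] at h4
    exact h3.not_ge (le_of_mul_le_mul_right h4 (pow_pos hτ t))
  · rw [h1, h2, pow_succ']
    exact mul_lt_mul_of_pos_left (lt_mul_of_one_lt_left (pow_pos hτ t) hT) hc

section
variable (M : GL (Fin 2) ℚ) (s : Fin 2 → ℚ)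

theorem almostAll_linear_of_lt (h : ‖(M.val.det : ℚ_[p])‖ < ‖(M.val.trace : ℚ_[p])‖ ^ 2) :
    AlmostAll fun z => HasLocalHeight p (affine M 0) z
      ((Real.logb p ‖(M.val.trace : ℚ_[p])‖ : ℝ) : EReal) := by
  refine almostAll_of_hasDensity_zero (hasDensity_zero_of_sub_mem_slowSet (det_coe_ne_zero M) h
    (X := slowSet p M.val) fun z hz z' hz' => sub_mem_slowSet hz hz') fun z hz => ?_
  obtain ⟨c, hc, hev⟩ := exists_vnorm_pow_eq h hz
  refine hasLocalHeight_of_pow_bounds (C := c) (norm_trace_pos h) hc ?_ ?_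
  · filter_upwards [hev] with t ht
    rw [iterate_affine_zero, ht]
  · filter_upwards [hev] with t ht
    rw [iterate_affine_zero, ht]

theorem hasDensity_singleton (z : Fin 2 → ℚ) : HasDensity {z} 0 :=
  hasDensity_zero_of_collinear (e := ![1, 0]) (fun h0 => by simpa using congrFun h0 0)
    fun x hx y hy => by
      rw [Set.mem_singleton_iff.1 hx, Set.mem_singleton_iff.1 hy]
      simp

theorem almostAll_linear_of_le (h : ‖(M.val.trace : ℚ_[p])‖ ^ 2 ≤ ‖(M.val.det : ℚ_[p])‖) :
    AlmostAll fun z => HasLocalHeight p (affine M 0) z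
      ((Real.logb p √‖(M.val.det : ℚ_[p])‖ : ℝ) : EReal) := by
  have hρ : 0 < √‖(M.val.det : ℚ_[p])‖ := Real.sqrt_pos.2 (norm_det_pos M)
  obtain ⟨K, hK, hlow⟩ := exists_le_vnorm_pow (det_coe_ne_zero M) h
  obtain ⟨K', hK', hup⟩ := exists_vnorm_pow_le hρ (Real.le_sqrt_of_sq_le h)
    (Real.sq_sqrt (norm_nonneg _)).ge
  refine almostAll_of_hasDensity_zero (hasDensity_singleton 0) fun z hz => ?_
  refine hasLocalHeight_of_pow_bounds (c := vnorm p z / K) (C := K' * vnorm p z) hρ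
    (div_pos (vnorm_pos_iff.2 hz) hK) ?_ ?_
  · filter_upwards with t
    rw [iterate_affine_zero, mul_right_comm]
    exact hup t z
  · filter_upwards with t
    rw [iterate_affine_zero, div_mul_eq_mul_div, div_le_iff₀ hK, mul_comm, mul_comm _ K]
    exact hlow t z

/-- No fixed point is available in general, so displacements are used: outside a line the increments
have norm exactly `c τ ^ t` for large `t`. If the orbit always stayed at or above this size it would
be bounded, which is absurd. Once it is below, the increment dominates, the next norm is `c τ ^ t <
c τ ^ (t + 1)`, and so on forever. -/
theorem almostAll_affine_of_trace_expanding (hT : 1 < ‖(M.val.trace : ℚ_[p])‖)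
    (h : ‖(M.val.det : ℚ_[p])‖ < ‖(M.val.trace : ℚ_[p])‖ ^ 2) :
    AlmostAll fun z => HasLocalHeight p (affine M s) z
      ((Real.logb p ‖(M.val.trace : ℚ_[p])‖ : ℝ) : EReal) := by
  have hτ := norm_trace_pos h
  refine almostAll_of_hasDensity_zero (hasDensity_zero_of_sub_mem_slowSet (det_coe_ne_zero M) h
    (X := {z | affine M s z - z ∈ slowSet p M.val}) fun z hz z' hz' => ?_) fun z hz => ?_
  · refine mem_slowSet_of_expanding hT h ?_
    have h1 : affine M s z - z ∈ slowSet p M.val := hz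
    have h2 : affine M s z' - z' ∈ slowSet p M.val := hz'
    convert sub_mem_slowSet h1 h2 using 1
    rw [affine, affine, Matrix.mulVec_sub]
    abel
  · have hz1 : affine M s z - z ∉ slowSet p M.val := hz
    obtain ⟨c, hc, hev⟩ := exists_vnorm_pow_eq h hz1
    obtain ⟨t₀, ht₀⟩ := eventually_atTop.1 hev
    set τ := ‖(M.val.trace : ℚ_[p])‖
    have hstep : ∀ t, (affine M s)^[t + 1] z =
        (affine M s)^[t] z + (M.val ^ t).mulVec (affine M s z - z) := by
      intro t
      rw [← iterate_affine_succ_sub, add_sub_cancel]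
    obtain ⟨t₁, ht₁, hlt⟩ : ∃ t ≥ t₀, vnorm p ((affine M s)^[t] z) < c * τ ^ t := by
      by_contra! hge
      have hbdd : ∀ k, vnorm p ((affine M s)^[t₀ + k] z) ≤ vnorm p ((affine M s)^[t₀] z) := by
        intro k
        induction k with
        | zero => exact le_rfl
        | succ k ih =>
          rw [← add_assoc, hstep]
          refine (vnorm_add_le _ _).trans (max_le ih ?_)
          rw [ht₀ _ (by omega)]
          exact (hge _ (by omega)).trans ih
      have hlim : Tendsto (fun t : ℕ => c * τ ^ t) atTop atTop :=
        (tendsto_pow_atTop_atTop_of_one_lt hT).const_mul_atTop hc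
      obtain ⟨t, h1, h2⟩ := ((hlim.eventually_gt_atTop (vnorm p ((affine M s)^[t₀] z))).and
        (eventually_ge_atTop t₀)).exists
      obtain ⟨k, rfl⟩ := Nat.exists_eq_add_of_le h2
      exact (h1.trans_le (hge _ h2)).not_ge (hbdd k)
    have hall : ∀ k, vnorm p ((affine M s)^[t₁ + k] z) < c * τ ^ (t₁ + k) ∧
        vnorm p ((affine M s)^[t₁ + k + 1] z) = c * τ ^ (t₁ + k) := by
      intro k
      have hnext : ∀ t ≥ t₀, vnorm p ((affine M s)^[t] z) < c * τ ^ t →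
          vnorm p ((affine M s)^[t + 1] z) = c * τ ^ t := by
        intro t ht hlt
        rw [hstep, vnorm_add_eq_of_lt, ht₀ t ht]
        rwa [ht₀ t ht]
      induction k with
      | zero => exact ⟨hlt, hnext _ ht₁ hlt⟩
      | succ k ih =>
        have h1 : vnorm p ((affine M s)^[t₁ + k + 1] z) < c * τ ^ (t₁ + k + 1) := by
          rw [ih.2, pow_succ]
          have : 0 < c * τ ^ (t₁ + k) := by positivity
          nlinarith
        exact ⟨h1, hnext _ (by omega) h1⟩
    have hev2 : ∀ᶠ t in atTop, vnorm p ((affine M s)^[t] z) = c / τ * τ ^ t := by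
      filter_upwards [eventually_ge_atTop (t₁ + 1)] with t ht
      obtain ⟨k, rfl⟩ := Nat.exists_eq_add_of_le ht
      rw [show t₁ + 1 + k = t₁ + k + 1 by ring, (hall k).2, pow_succ]
      field_simp
    refine hasLocalHeight_of_pow_bounds (C := c / τ) (c := c / τ) hτ (by positivity) ?_ ?_
    · filter_upwards [hev2] with t ht using ht.le
    · filter_upwards [hev2] with t ht using ht.ge

/-- As `‖T‖ < ‖D‖` and `1 < ‖D‖`, the number `1 - T + D` is nonzero and there is a fixed point.
Every other orbit leaves it at the rate `√‖D‖ > 1`, and the fixed point itself becomes negligible.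
-/
theorem almostAll_affine_of_det_expanding (hD : 1 < ‖(M.val.det : ℚ_[p])‖)
    (h : ‖(M.val.trace : ℚ_[p])‖ ^ 2 ≤ ‖(M.val.det : ℚ_[p])‖) :
    AlmostAll fun z => HasLocalHeight p (affine M s) z
      ((Real.logb p √‖(M.val.det : ℚ_[p])‖ : ℝ) : EReal) := by
  have hρ : 0 < √‖(M.val.det : ℚ_[p])‖ := Real.sqrt_pos.2 (norm_det_pos M)
  have hρ1 : 1 < √‖(M.val.det : ℚ_[p])‖ := by rwa [Real.lt_sqrt zero_le_one, one_pow]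
  obtain ⟨z', hz'⟩ := exists_fixed M s (one_sub_trace_add_det_ne_zero_of_one_lt hD h)
  obtain ⟨K, hK, hlow⟩ := exists_le_vnorm_pow (det_coe_ne_zero M) h
  obtain ⟨K', hK', hup⟩ := exists_vnorm_pow_le hρ (Real.le_sqrt_of_sq_le h)
    (Real.sq_sqrt (norm_nonneg _)).ge
  refine almostAll_of_hasDensity_zero (hasDensity_singleton z') fun z hz => ?_
  have hw : 0 < vnorm p (z - z') := vnorm_pos_iff.2 (sub_ne_zero.2 hz)
  set ρ := √‖(M.val.det : ℚ_[p])‖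
  have hlow' : ∀ t, vnorm p (z - z') / K * ρ ^ t ≤ vnorm p ((M.val ^ t).mulVec (z - z')) := by
    intro t
    rw [div_mul_eq_mul_div, div_le_iff₀ hK, mul_comm, mul_comm _ K]
    exact hlow t _
  have hlim : Tendsto (fun t : ℕ => vnorm p (z - z') / K * ρ ^ t) atTop atTop :=
    (tendsto_pow_atTop_atTop_of_one_lt hρ1).const_mul_atTop (div_pos hw hK)
  have heq : ∀ᶠ t in atTop, vnorm p ((affine M s)^[t] z) = vnorm p ((M.val ^ t).mulVec (z - z')) := by
    filter_upwards [hlim.eventually_gt_atTop (vnorm p z')] with t ht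
    rw [iterate_affine_of_fixed hz', vnorm_add_eq_of_lt (ht.trans_le (hlow' t))]
  refine hasLocalHeight_of_pow_bounds (c := vnorm p (z - z') / K) (C := K' * vnorm p (z - z')) hρ
    (div_pos hw hK) ?_ ?_
  · filter_upwards [heq] with t ht
    rw [ht, mul_right_comm]
    exact hup t _
  · filter_upwards [heq] with t ht
    rw [ht]
    exact hlow' t

theorem almostAll_of_forall {P : (Fin 2 → ℚ) → Prop} (h : ∀ z, P z) : AlmostAll P := by
  refine almostAll_of_hasDensity_zero (X := ∅) ?_ fun z _ => h z
  simp [HasDensity]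

/-- Every orbit converges to the fixed point, which is nonzero because `s ≠ 0`; by the ultrametric
inequality the norm is eventually constant. -/
theorem almostAll_affine_of_contracting (hs : s ≠ 0) (hT : ‖(M.val.trace : ℚ_[p])‖ < 1)
    (hD : ‖(M.val.det : ℚ_[p])‖ < 1) :
    AlmostAll fun z => HasLocalHeight p (affine M s) z 0 := by
  refine almostAll_of_forall fun z => ?_
  obtain ⟨z', hz'⟩ := exists_fixed M s (one_sub_trace_add_det_ne_zero_of_lt_one hT hD)
  have hz0 := (vnorm_pos_iff (p := p)).2 (fixed_ne_zero hs hz')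
  set θ := max ‖(M.val.trace : ℚ_[p])‖ √‖(M.val.det : ℚ_[p])‖ with hθdef
  have hθ : 0 < θ := lt_max_of_lt_right (Real.sqrt_pos.2 (norm_det_pos M))
  have hθ1 : θ < 1 := max_lt hT (by rwa [Real.sqrt_lt' one_pos, one_pow])
  obtain ⟨K, hK, hup⟩ := exists_vnorm_pow_le hθ (le_max_left _ _) (by
    rw [← Real.sqrt_le_left hθ.le]; exact le_max_right _ _)
  have hlim : Tendsto (fun t : ℕ => K * θ ^ t * vnorm p (z - z')) atTop (𝓝 0) := by
    simpa using ((tendsto_pow_atTop_nhds_zero_of_lt_one hθ.le hθ1).const_mul K).mul_const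
      (vnorm p (z - z'))
  have heq : ∀ᶠ t in atTop, vnorm p ((affine M s)^[t] z) = vnorm p z' := by
    filter_upwards [hlim.eventually_lt_const hz0] with t ht
    rw [iterate_affine_of_fixed hz', add_comm, vnorm_add_eq_of_lt ((hup t _).trans_lt ht)]
  have := hasLocalHeight_of_pow_bounds (F := affine M s) (z := z) (c := vnorm p z') (C := vnorm p z')
    one_pos hz0 (by filter_upwards [heq] with t ht; rw [ht, one_pow, mul_one])
    (by filter_upwards [heq] with t ht; rw [ht, one_pow, mul_one])
  simpa using this

/-- Increments are uniformly bounded, and ultrametrically their sums are no larger. No fixed point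
is needed. -/
theorem exists_vnorm_iterate_le (hT : ‖(M.val.trace : ℚ_[p])‖ ≤ 1) (hD : ‖(M.val.det : ℚ_[p])‖ ≤ 1)
    (z : Fin 2 → ℚ) : ∃ C : ℝ, ∀ t, vnorm p ((affine M s)^[t] z) ≤ C := by
  obtain ⟨K, hK, hup⟩ := exists_vnorm_pow_le one_pos hT (by rwa [one_pow])
  refine ⟨max (vnorm p z) (K * vnorm p (affine M s z - z)), fun t => ?_⟩
  induction t with
  | zero => exact le_max_left _ _
  | succ t ih =>
    have hstep : (affine M s)^[t + 1] z =
        (affine M s)^[t] z + (M.val ^ t).mulVec (affine M s z - z) := by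
      rw [← iterate_affine_succ_sub, add_sub_cancel]
    rw [hstep]
    refine (vnorm_add_le _ _).trans (max_le ih (le_trans ?_ (le_max_right _ _)))
    simpa using hup t (affine M s z - z)

end

end AffineHeight

namespace AffineHeight

open Finset

/-! ### Powers of an integral matrix of unit determinant -/

section Order
variable {p : ℕ} [Fact p.Prime]

theorem norm_add_le_one {a b : ℚ} (ha : ‖(a : ℚ_[p])‖ ≤ 1) (hb : ‖(b : ℚ_[p])‖ ≤ 1) :
    ‖((a + b : ℚ) : ℚ_[p])‖ ≤ 1 := by
  push_cast
  exact (Padic.nonarchimedean _ _).trans (max_le ha hb)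

theorem norm_neg_le_one {a : ℚ} (ha : ‖(a : ℚ_[p])‖ ≤ 1) : ‖((-a : ℚ) : ℚ_[p])‖ ≤ 1 := by
  push_cast
  rwa [norm_neg]

theorem norm_mul_le_one {a b : ℚ} (ha : ‖(a : ℚ_[p])‖ ≤ 1) (hb : ‖(b : ℚ_[p])‖ ≤ 1) :
    ‖((a * b : ℚ) : ℚ_[p])‖ ≤ 1 := by
  push_cast
  rw [norm_mul]
  exact mul_le_one₀ ha (norm_nonneg _) hb

/-- The ring of the matrices `a A + b` with `p`-integral `a` and `b`. -/
def matrixOrder (p : ℕ) [Fact p.Prime] (A : Matrix (Fin 2) (Fin 2) ℚ)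
    (hT : ‖(A.trace : ℚ_[p])‖ ≤ 1) (hD : ‖(A.det : ℚ_[p])‖ ≤ 1) :
    Subring (Matrix (Fin 2) (Fin 2) ℚ) where
  carrier := {B | ∃ a b : ℚ, ‖(a : ℚ_[p])‖ ≤ 1 ∧ ‖(b : ℚ_[p])‖ ≤ 1 ∧
    B = a • A + b • (1 : Matrix (Fin 2) (Fin 2) ℚ)}
  mul_mem' := by
    rintro _ _ ⟨a, b, ha, hb, rfl⟩ ⟨c, d, hc, hd, rfl⟩
    refine ⟨a * c * A.trace + (a * d + b * c), b * d + -(a * c * A.det),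
      norm_add_le_one (norm_mul_le_one (norm_mul_le_one ha hc) hT)
        (norm_add_le_one (norm_mul_le_one ha hd) (norm_mul_le_one hb hc)),
      norm_add_le_one (norm_mul_le_one hb hd)
        (norm_neg_le_one (norm_mul_le_one (norm_mul_le_one ha hc) hD)), ?_⟩
    simp only [mul_add, add_mul, Matrix.smul_mul, Matrix.mul_smul, mul_one, one_mul,
      mul_self_eq_trace_smul_sub]
    module
  one_mem' := ⟨0, 1, by simp, by simp, by simp⟩
  add_mem' := by
    rintro _ _ ⟨a, b, ha, hb, rfl⟩ ⟨c, d, hc, hd, rfl⟩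
    exact ⟨a + c, b + d, norm_add_le_one ha hc, norm_add_le_one hb hd, by module⟩
  zero_mem' := ⟨0, 0, by simp, by simp, by simp⟩
  neg_mem' := by
    rintro _ ⟨a, b, ha, hb, rfl⟩
    exact ⟨-a, -b, norm_neg_le_one ha, norm_neg_le_one hb, by module⟩

variable {A : Matrix (Fin 2) (Fin 2) ℚ} (hT : ‖(A.trace : ℚ_[p])‖ ≤ 1)
  (hD : ‖(A.det : ℚ_[p])‖ ≤ 1)

theorem self_mem_matrixOrder : A ∈ matrixOrder p A hT hD := ⟨1, 0, by simp, by simp, by simp⟩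

theorem exists_forall_matrixOrder_vnorm_le :
    ∃ κ : ℝ, 0 < κ ∧ ∀ B ∈ matrixOrder p A hT hD, ∀ w, vnorm p (B.mulVec w) ≤ κ * vnorm p w := by
  obtain ⟨k, hk, hA⟩ := exists_vnorm_mulVec_le p A
  refine ⟨max k 1, by positivity, ?_⟩
  rintro _ ⟨a, b, ha, hb, rfl⟩ w
  rw [Matrix.add_mulVec, Matrix.smul_mulVec, Matrix.smul_mulVec, Matrix.one_mulVec]
  refine (vnorm_add_le _ _).trans (max_le ?_ ?_)
  · rw [vnorm_smul]
    exact (mul_le_of_le_one_left (vnorm_nonneg _) ha).trans ((hA w).trans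
      (mul_le_mul_of_nonneg_right (le_max_left _ _) (vnorm_nonneg _)))
  · rw [vnorm_smul]
    exact (mul_le_of_le_one_left (vnorm_nonneg _) hb).trans
      (le_mul_of_one_le_left (vnorm_nonneg _) (le_max_right _ _))

theorem exists_mem_matrixOrder_mul_eq_one (hD1 : ‖(A.det : ℚ_[p])‖ = 1) :
    ∃ B ∈ matrixOrder p A hT hD, B * A = 1 := by
  have hdet : A.det ≠ 0 := by
    intro h0
    rw [h0] at hD1
    simp at hD1
  have hinv : ‖((A.det⁻¹ : ℚ) : ℚ_[p])‖ ≤ 1 := by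
    rw [Rat.cast_inv, norm_inv, hD1, inv_one]
  refine ⟨(-A.det⁻¹) • A + (A.det⁻¹ * A.trace) • (1 : Matrix (Fin 2) (Fin 2) ℚ),
    ⟨_, _, norm_neg_le_one hinv, norm_mul_le_one hinv hT, rfl⟩, ?_⟩
  rw [add_mul, Matrix.smul_mul, Matrix.smul_mul, one_mul, mul_self_eq_trace_smul_sub]
  have h1 : (A.det⁻¹ * A.det) • (1 : Matrix (Fin 2) (Fin 2) ℚ) = 1 := by
    rw [inv_mul_cancel₀ hdet, one_smul]
  refine Eq.trans ?_ h1
  module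

theorem norm_sub_div_le_one {x y : ℚ} {u v : ℤ_[p]} (hx : (u : ℚ_[p]) = x) (hy : (v : ℚ_[p]) = y)
    (h : PadicInt.toZMod u = PadicInt.toZMod v) : ‖(((x - y) / p : ℚ) : ℚ_[p])‖ ≤ 1 := by
  have hker : u - v ∈ RingHom.ker (PadicInt.toZMod (p := p)) := by
    rw [RingHom.mem_ker, map_sub, h, sub_self]
  rw [PadicInt.ker_toZMod, IsLocalRing.mem_maximalIdeal, PadicInt.mem_nonunits,
    PadicInt.norm_lt_one_iff_dvd] at hker
  obtain ⟨c, hc⟩ := hker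
  have hc' : ((x : ℚ_[p]) - y) = p * c := by
    rw [← hx, ← hy, ← PadicInt.coe_sub, hc, PadicInt.coe_mul, PadicInt.coe_natCast]
  have hp0 : (p : ℚ_[p]) ≠ 0 := by exact_mod_cast (Fact.out : p.Prime).ne_zero
  push_cast
  rw [hc', mul_div_cancel_left₀ _ hp0]
  exact c.2

/-- Pigeonhole: powers of `A` have integral coordinates on `A` and `1`, with finitely many residues
modulo `p`. Two congruent powers are compared, and the smaller one is cancelled because `A` is
invertible in the order. -/
theorem exists_pow_eq_one_add (hD1 : ‖(A.det : ℚ_[p])‖ = 1) :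
    ∃ m : ℕ, 0 < m ∧ ∃ Y ∈ matrixOrder p A hT hD, A ^ m = 1 + (p : ℚ) • Y := by
  have hmem : ∀ t : ℕ, A ^ t ∈ matrixOrder p A hT hD := fun t =>
    pow_mem (self_mem_matrixOrder hT hD) t
  choose a b ha hb hab using hmem
  have hlift : ∀ {x : ℚ}, ‖(x : ℚ_[p])‖ ≤ 1 → ∃ u : ℤ_[p], (u : ℚ_[p]) = x := fun hx =>
    ⟨⟨_, hx⟩, rfl⟩
  choose u hu using fun t => hlift (ha t)
  choose v hv using fun t => hlift (hb t)
  obtain ⟨i, j, hne, hij⟩ := Finite.exists_ne_map_eq_of_infinite fun t : ℕ =>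
    (PadicInt.toZMod (u t), PadicInt.toZMod (v t))
  wlog hlt : i < j generalizing i j
  · exact this j i hne.symm hij.symm (by omega)
  simp only [Prod.mk.injEq] at hij
  obtain ⟨B, hB, hBA⟩ := exists_mem_matrixOrder_mul_eq_one hT hD hD1
  have hpQ : (p : ℚ) ≠ 0 := by exact_mod_cast (Fact.out : p.Prime).ne_zero
  set Y := ((a j - a i) / p) • A + ((b j - b i) / p) • (1 : Matrix (Fin 2) (Fin 2) ℚ) with hY
  have hYm : Y ∈ matrixOrder p A hT hD :=
    ⟨_, _, norm_sub_div_le_one (hu j) (hu i) hij.1.symm,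
      norm_sub_div_le_one (hv j) (hv i) hij.2.symm, rfl⟩
  have hdiff : A ^ j = A ^ i + (p : ℚ) • Y := by
    have e1 : (p : ℚ) • Y = (p * ((a j - a i) / p)) • A + (p * ((b j - b i) / p)) • (1 : Matrix (Fin 2) (Fin 2) ℚ) := by
      rw [hY]; module
    rw [e1, mul_div_cancel₀ _ hpQ, mul_div_cancel₀ _ hpQ, hab j, hab i]
    module
  have hBi : B ^ i * A ^ i = 1 := by
    have hcomm : Commute B A := by
      have : A * B = 1 := mul_eq_one_comm.1 hBA
      exact hBA.trans this.symm
    rw [← hcomm.mul_pow, hBA, one_pow]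
  refine ⟨j - i, by omega, B ^ i * Y, mul_mem (pow_mem hB i) hYm, ?_⟩
  have h2 : B ^ i * A ^ j = A ^ (j - i) := by
    rw [← Nat.add_sub_cancel' hlt.le, pow_add, ← mul_assoc, hBi, one_mul]
    congr 1
    omega
  rw [← h2, hdiff, mul_add, hBi, Matrix.mul_smul]

theorem geom_sum_mul_eq {R : Type*} [Ring R] (x : R) (m n : ℕ) :
    ∑ i ∈ range (m * n), x ^ i = (∑ i ∈ range m, x ^ i) * ∑ a ∈ range n, (x ^ m) ^ a := by
  induction n with
  | zero => simp
  | succ n ih =>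
    rw [Nat.mul_succ, sum_range_add, ih, sum_range_succ, mul_add]
    congr 1
    rw [← pow_mul, sum_mul]
    exact sum_congr rfl fun i _ => by rw [← pow_add, add_comm]

/-- All powers of `B` are `1` modulo `p`, so a sum of `p` of them is divisible by `p`. Hence each
multiplication of the length by `p` gains a factor `p`. -/
theorem exists_geom_sum_eq_smul {p : ℕ} (S : Subring (Matrix (Fin 2) (Fin 2) ℚ))
    {B Y : Matrix (Fin 2) (Fin 2) ℚ} (hY : Y ∈ S) (hB : B = 1 + (p : ℚ) • Y) (j : ℕ) :
    ∃ Z ∈ S, ∑ i ∈ range (p ^ j), B ^ i = ((p : ℚ) ^ j) • Z := by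
  have hsmul : ∀ X ∈ S, (p : ℚ) • X ∈ S := fun X hX => by
    have : (p : ℚ) • X = p • X := by rw [Nat.cast_smul_eq_nsmul]
    rw [this]
    exact nsmul_mem hX p
  have hpow : ∀ n : ℕ, ∃ Y' ∈ S, B ^ n = 1 + (p : ℚ) • Y' := by
    intro n
    induction n with
    | zero => exact ⟨0, S.zero_mem, by simp⟩
    | succ n ih =>
      obtain ⟨Y', hY', h⟩ := ih
      refine ⟨Y' + (Y + (p : ℚ) • (Y' * Y)), S.add_mem hY' (S.add_mem hY (hsmul _ (S.mul_mem hY' hY))), ?_⟩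
      rw [pow_succ, h, hB]
      simp only [mul_add, add_mul, Matrix.smul_mul, Matrix.mul_smul, mul_one, one_mul]
      module
  choose Y' hY' hBn using hpow
  induction j with
  | zero => exact ⟨1, S.one_mem, by simp⟩
  | succ j ih =>
    obtain ⟨Z, hZ, h⟩ := ih
    refine ⟨Z * (1 + ∑ a ∈ range p, Y' (p ^ j * a)), S.mul_mem hZ (S.add_mem S.one_mem
      (S.sum_mem fun a _ => hY' _)), ?_⟩
    rw [pow_succ, geom_sum_mul_eq, h]
    simp_rw [← pow_mul, hBn]
    rw [sum_add_distrib, sum_const, card_range, ← smul_sum, ← Nat.cast_smul_eq_nsmul ℚ, ← smul_add,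
      Matrix.smul_mul, Matrix.mul_smul, smul_smul, pow_succ]

end Order

section
variable {p : ℕ} [Fact p.Prime] (M : GL (Fin 2) ℚ) (s : Fin 2 → ℚ)

theorem iterate_affine_apply_zero (t : ℕ) :
    (affine M s)^[t] 0 = (∑ i ∈ range t, M.val ^ i).mulVec s := by
  induction t with
  | zero => simp
  | succ t ih =>
    rw [sum_range_succ, Matrix.add_mulVec, ← ih, ← sub_eq_iff_eq_add', iterate_affine_succ_sub]
    simp [affine]

theorem affine_surjective : Function.Surjective (affine M s) := by
  intro z
  refine ⟨(M⁻¹).val.mulVec (z - s), ?_⟩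
  rw [affine, Matrix.mulVec_mulVec, Units.mul_inv, Matrix.one_mulVec, sub_add_cancel]

/-- Bounded orbits have height 0 unless they come arbitrarily close to the origin. As `M ^ t` is
bi-Lipschitz uniformly in `t`, such a `z` is as close as desired to some `ζ t` with `F^t (ζ t) = 0`.
The geometric sum gives `F^(m p^j) 0 = O(p^(-j))`, so `ζ` is periodic up to `O(p^(-j))` with period
`m p ^ j`, and one period of centres covers the bad set. -/
theorem almostAll_affine_of_det_unit (hT : ‖(M.val.trace : ℚ_[p])‖ ≤ 1)
    (hD : ‖(M.val.det : ℚ_[p])‖ = 1) :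
    AlmostAll fun z => HasLocalHeight p (affine M s) z 0 := by
  have hp := one_lt_prime_cast p
  have hp0 : (0 : ℝ) < p := by linarith
  set X : Set (Fin 2 → ℚ) :=
    {z | ∀ c : ℝ, 0 < c → ∃ t, vnorm p ((affine M s)^[t] z) < c} with hX
  have hlow : ∃ K : ℝ, 0 < K ∧ ∀ t w, vnorm p w ≤ K * vnorm p ((M.val ^ t).mulVec w) := by
    obtain ⟨K, hK, h⟩ := exists_le_vnorm_pow (p := p) (det_coe_ne_zero M) (by
      rw [hD]; exact pow_le_one₀ (norm_nonneg _) hT)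
    refine ⟨K, hK, fun t w => ?_⟩
    simpa [hD] using h t w
  obtain ⟨K, hK, hlow⟩ := hlow
  refine almostAll_of_hasDensity_zero (X := X) ?_ fun z hz => ?_
  · choose ζ hζ using fun t => ((affine_surjective M s).iterate t) 0
    obtain ⟨κ, hκ, hord⟩ := exists_forall_matrixOrder_vnorm_le hT hD.le
    obtain ⟨m, hm, Y, hY, hmY⟩ := exists_pow_eq_one_add hT hD.le hD
    have hper : ∀ j t, vnorm p (ζ (t + m * p ^ j) - ζ t) ≤ K * (κ * vnorm p s) * ((p : ℝ)⁻¹) ^ j := by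
      intro j t
      obtain ⟨Z, hZ, hsum⟩ := exists_geom_sum_eq_smul _ hY hmY j
      have h1 : vnorm p ((affine M s)^[m * p ^ j] 0) ≤ κ * vnorm p s * ((p : ℝ)⁻¹) ^ j := by
        rw [iterate_affine_apply_zero, geom_sum_mul_eq, hsum, Matrix.mul_smul, Matrix.smul_mulVec,
          vnorm_smul, mul_comm]
        push_cast
        rw [norm_pow, Padic.norm_p]
        refine mul_le_mul_of_nonneg_right (hord _ ?_ _) (by positivity)
        exact mul_mem (sum_mem fun i _ => pow_mem (self_mem_matrixOrder hT hD.le) i) hZ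
      have h2 : (affine M s)^[t + m * p ^ j] (ζ t) = (affine M s)^[m * p ^ j] 0 := by
        rw [add_comm, Function.iterate_add_apply, hζ]
      have h3 := hlow (t + m * p ^ j) (ζ (t + m * p ^ j) - ζ t)
      rw [← iterate_affine_sub M s, hζ, h2, zero_sub, vnorm_neg] at h3
      refine h3.trans ?_
      rw [mul_assoc]
      exact mul_le_mul_of_nonneg_left h1 hK.le
    -- Lengthening the period by the fixed factor `p ^ c` absorbs the constants, so that the radius
    -- is `p ^ (-k)` on the nose.
    obtain ⟨c, hc⟩ : ∃ c : ℕ, K * (κ * vnorm p s) * ((p : ℝ)⁻¹) ^ c ≤ 1 := by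
      have hlim : Tendsto (fun c : ℕ => K * (κ * vnorm p s) * ((p : ℝ)⁻¹) ^ c) atTop (𝓝 0) := by
        simpa using (tendsto_pow_atTop_nhds_zero_of_lt_one (by positivity)
          (inv_lt_one_of_one_lt₀ hp)).const_mul (K * (κ * vnorm p s))
      exact (hlim.eventually_le_const one_pos).exists
    refine hasDensity_zero_of_cover (p := p) (m * p ^ c : ℝ) fun k => ?_
    have hrad : ∀ t, vnorm p (ζ (t + m * p ^ (c + k)) - ζ t) ≤ (p : ℝ) ^ (-k : ℤ) := by
      intro t
      refine (hper _ t).trans ?_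
      rw [pow_add, ← mul_assoc, zpow_neg, zpow_natCast, inv_pow (p : ℝ) k]
      exact mul_le_of_le_one_left (by positivity) hc
    have hrad2 : ∀ n t, vnorm p (ζ (t + m * p ^ (c + k) * n) - ζ t) ≤ (p : ℝ) ^ (-k : ℤ) := by
      intro n t
      induction n with
      | zero => simp only [mul_zero, add_zero, sub_self, vnorm_zero]; positivity
      | succ n ih =>
        rw [Nat.mul_succ, ← add_assoc, ← sub_add_sub_cancel _ (ζ (t + m * p ^ (c + k) * n))]
        exact (vnorm_add_le _ _).trans (max_le (hrad _) ih)
    refine ⟨(range (m * p ^ (c + k))).image ζ, ?_, fun z hz => ?_⟩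
    · refine (Nat.cast_le.2 card_image_le).trans ?_
      rw [card_range]
      push_cast
      rw [pow_add, mul_assoc]
    · obtain ⟨t, ht⟩ := hz (K⁻¹ * (p : ℝ) ^ (-k : ℤ)) (by positivity)
      have hpos : 0 < m * p ^ (c + k) := Nat.mul_pos hm (pow_pos (Fact.out : p.Prime).pos _)
      refine ⟨ζ (t % (m * p ^ (c + k))), mem_image_of_mem _ (mem_range.2 (Nat.mod_lt _ hpos)), ?_⟩
      have h1 : vnorm p (z - ζ t) ≤ (p : ℝ) ^ (-k : ℤ) := by
        have h3 := hlow t (z - ζ t)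
        rw [← iterate_affine_sub M s, hζ, sub_zero] at h3
        refine h3.trans ?_
        rw [← le_inv_mul_iff₀ hK]
        exact ht.le
      have h2 := hrad2 (t / (m * p ^ (c + k))) (t % (m * p ^ (c + k)))
      rw [Nat.mod_add_div] at h2
      have h3 := (vnorm_add_le (p := p) (z - ζ t) (ζ t - ζ (t % (m * p ^ (c + k))))).trans (max_le h1 h2)
      rw [sub_add_sub_cancel] at h3
      exact vnorm_le_iff.1 h3
  · have hz' : ∃ c : ℝ, 0 < c ∧ ∀ t, c ≤ vnorm p ((affine M s)^[t] z) := by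
      by_contra! hall
      exact hz hall
    obtain ⟨c, hc, hzc⟩ := hz'
    obtain ⟨C, hC⟩ := exists_vnorm_iterate_le M s hT hD.le z
    have := hasLocalHeight_of_pow_bounds (p := p) (F := affine M s) (z := z) (c := c) (C := C)
      one_pos hc (by filter_upwards with t; rw [one_pow, mul_one]; exact hC t)
      (by filter_upwards with t; rw [one_pow, mul_one]; exact hzc t)
    simpa using this

end

end AffineHeight

/-! ### Unit trace and non-unit determinant: orbits that are not exponentially small. -/

namespace AffineHeight

open Finset

section
variable {p : ℕ} [Fact p.Prime]

/-- The sequence `u` is not exponentially small. -/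
def Subexponential (p : ℕ) (u : ℕ → ℝ) : Prop :=
  ∀ ε : ℝ, 0 < ε → ∀ᶠ t : ℕ in atTop, (p : ℝ) ^ (-(ε * t)) ≤ u t

theorem subexponential_of_le {u v : ℕ → ℝ} {K : ℝ} (hK : 0 < K) (hu : Subexponential p u)
    (h : ∀ᶠ t in atTop, u t ≤ K * v t) : Subexponential p v := by
  have hp0 : (0 : ℝ) < p := zero_lt_one.trans (one_lt_prime_cast p)
  intro ε hε
  filter_upwards [hu _ (half_pos hε), h,
    (tendsto_rpow_neg_mul_nat p (half_pos hε)).eventually_lt_const (inv_pos.2 hK)] with t h1 h2 h3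
  have h4 : (p : ℝ) ^ (-(ε * t)) = (p : ℝ) ^ (-(ε / 2 * t)) * (p : ℝ) ^ (-(ε / 2 * t)) := by
    rw [← Real.rpow_add hp0]
    congr 1; ring
  rw [h4]
  calc _ ≤ K⁻¹ * (K * v t) := mul_le_mul h3.le (h1.trans h2) (by positivity) (by positivity)
    _ = v t := inv_mul_cancel_left₀ hK.ne' _

theorem subexponential_of_const_le {v : ℕ → ℝ} {c : ℝ} (hc : 0 < c) (h : ∀ᶠ t in atTop, c ≤ v t) :
    Subexponential p v := by
  intro ε hε
  filter_upwards [h, (tendsto_rpow_neg_mul_nat p hε).eventually_lt_const hc] with t h1 h2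
  exact h2.le.trans h1

/-- A nonzero integer bounded by a linear function is not exponentially divisible by `p`. -/
theorem subexponential_intCast {n : ℕ → ℤ} (h0 : ∀ᶠ t in atTop, n t ≠ 0) (a : ℝ)
    (hn : ∀ t, |(n t : ℝ)| ≤ a * (t + 1)) : Subexponential p fun t => ‖(n t : ℚ_[p])‖ := by
  have hp := one_lt_prime_cast p
  have hp0 : (0 : ℝ) < p := zero_lt_one.trans hp
  intro ε hε
  set r := (p : ℝ) ^ (-ε) with hr
  have hr1 : r < 1 := Real.rpow_lt_one_of_one_lt_of_neg hp (by linarith)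
  have hr0 : 0 < r := Real.rpow_pos_of_pos hp0 _
  -- Divisibility by `p ^ ⌊ε t⌋` would force `p ^ (ε t) ≤ a p (t + 1)`; the extra `p` pays for the
  -- rounding.
  have hlim : Tendsto (fun t : ℕ => a * p * ((t : ℝ) ^ 1 * r ^ t + r ^ t)) atTop (𝓝 0) := by
    have h1 := tendsto_pow_const_mul_const_pow_of_abs_lt_one 1 (r := r) (by rwa [abs_of_pos hr0])
    have h2 := tendsto_pow_atTop_nhds_zero_of_lt_one hr0.le hr1
    simpa using (h1.add h2).const_mul (a * p)
  filter_upwards [h0, hlim.eventually_lt_const one_pos] with t ht hlt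
  by_contra! hle
  have hrt : r ^ t = (p : ℝ) ^ (-(ε * t)) := by
    rw [hr, ← Real.rpow_natCast, ← Real.rpow_mul hp0.le, neg_mul]
  have hfl := Nat.floor_le (show 0 ≤ ε * t by positivity)
  have hdvd : (p : ℤ) ^ ⌊ε * t⌋₊ ∣ n t := by
    rw [← Padic.norm_int_le_pow_iff_dvd]
    refine hle.le.trans ?_
    rw [← Real.rpow_intCast]
    refine Real.rpow_le_rpow_of_exponent_le hp.le ?_
    push_cast
    linarith
  have h1 : (p : ℝ) ^ ⌊ε * t⌋₊ ≤ |(n t : ℝ)| := by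
    have := Int.le_of_dvd (abs_pos.2 ht) ((dvd_abs _ _).2 hdvd)
    exact_mod_cast this
  have h2 : (p : ℝ) ^ (ε * t) ≤ p * p ^ ⌊ε * t⌋₊ := by
    rw [← pow_succ', ← Real.rpow_natCast]
    refine Real.rpow_le_rpow_of_exponent_le hp.le ?_
    push_cast
    exact (Nat.lt_floor_add_one _).le
  have h3 : (p : ℝ) ^ (ε * t) ≤ a * p * (t + 1) :=
    calc _ ≤ (p : ℝ) * (a * (t + 1)) := h2.trans (mul_le_mul_of_nonneg_left (h1.trans (hn t)) hp0.le)
      _ = _ := by ring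
  have h4 : r ^ t * (p : ℝ) ^ (ε * t) = 1 := by
    rw [hrt, ← Real.rpow_add hp0, neg_add_cancel, Real.rpow_zero]
  have h5 : r ^ t * (p : ℝ) ^ (ε * t) ≤ r ^ t * (a * p * (t + 1)) :=
    mul_le_mul_of_nonneg_left h3 (by positivity)
  rw [h4] at h5
  rw [pow_one] at hlt
  linarith

theorem subexponential_linear (a : ℚ) {b : ℚ} (hb : b ≠ 0) :
    Subexponential p fun t => ‖((a + t * b : ℚ) : ℚ_[p])‖ := by
  set n : ℕ → ℤ := fun t => a.num * b.den + t * (b.num * a.den) with hn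
  have hcast : ∀ t : ℕ, ((n t : ℤ) : ℚ) = (a + t * b) * ((a.den * b.den : ℕ) : ℤ) := by
    intro t
    rw [hn]
    push_cast
    rw [← Rat.mul_den_eq_num a, ← Rat.mul_den_eq_num b]
    ring
  have hle : ∀ t : ℕ, ‖((n t : ℤ) : ℚ_[p])‖ ≤ 1 * ‖((a + t * b : ℚ) : ℚ_[p])‖ := by
    intro t
    have := congrArg (fun x : ℚ => ‖(x : ℚ_[p])‖) (hcast t)
    simp only [Rat.cast_mul _ (((a.den * b.den : ℕ) : ℤ) : ℚ), Rat.cast_intCast, norm_mul] at this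
    rw [this, one_mul]
    exact mul_le_of_le_one_right (norm_nonneg _) (Padic.norm_int_le_one _)
  refine subexponential_of_le one_pos (subexponential_intCast (n := n) ?_
    (|(a.num * b.den : ℝ)| + |(b.num * a.den : ℝ)|) ?_) (Eventually.of_forall hle)
  · have hd : (b.num * a.den : ℤ) ≠ 0 :=
      mul_ne_zero (Rat.num_ne_zero.2 hb) (by exact_mod_cast a.den_nz)
    filter_upwards [eventually_gt_atTop (a.num * b.den : ℤ).natAbs] with t ht h0
    have h1 : (a.num * b.den : ℤ) = -(t * (b.num * a.den)) := by
      rw [hn] at h0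
      linarith
    rw [h1, Int.natAbs_neg, Int.natAbs_mul, Int.natAbs_natCast] at ht
    have h2 : 1 ≤ (b.num * a.den : ℤ).natAbs := Int.natAbs_pos.2 hd
    nlinarith
  · intro t
    rw [hn]
    push_cast
    refine (abs_add_le _ _).trans ?_
    rw [abs_mul (t : ℝ), Nat.abs_cast]
    have h1 := abs_nonneg (a.num * b.den : ℝ)
    have h2 := abs_nonneg (b.num * a.den : ℝ)
    have h3 : (0 : ℝ) ≤ t := Nat.cast_nonneg t
    nlinarith

variable (M : GL (Fin 2) ℚ) (s : Fin 2 → ℚ)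

/-- Without a fixed point `1 - T + D = 0`, so the eigenvalues are `1` and `D`. Then `B = M - D`
satisfies `B M = B`, and `B` applied to the orbit advances by `B s` at each step. If `B s = 0`, then
`s / (1 - D)` would be fixed. -/
theorem subexponential_of_no_fixed_point (hD : ‖(M.val.det : ℚ_[p])‖ < 1)
    (hfix : ¬ ∃ z, affine M s z = z) (z : Fin 2 → ℚ) :
    Subexponential p fun t => vnorm p ((affine M s)^[t] z) := by
  have hTD : 1 - M.val.trace + M.val.det = 0 := by
    by_contra h
    exact hfix (exists_fixed M s h)
  set D := M.val.det with hDdef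
  set B : Matrix (Fin 2) (Fin 2) ℚ := M.val - D • (1 : Matrix (Fin 2) (Fin 2) ℚ) with hB
  have hBM : B * M.val = B := by
    rw [hB, sub_mul, mul_self_eq_trace_smul_sub, Matrix.smul_mul, one_mul,
      show M.val.trace = 1 + D by linarith, ← hDdef]
    module
  have hBs : B.mulVec s ≠ 0 := by
    intro h0
    have hD1 : (1 : ℚ) - D ≠ 0 := by
      intro h1
      rw [show D = 1 by linarith] at hD
      simp at hD
    have hMs : M.val.mulVec s = D • s := by
      rw [hB, Matrix.sub_mulVec, Matrix.smul_mulVec, Matrix.one_mulVec] at h0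
      exact sub_eq_zero.1 h0
    refine hfix ⟨(1 - D)⁻¹ • s, ?_⟩
    rw [affine, Matrix.mulVec_smul, hMs]
    have h1 : ((1 - D)⁻¹ * (1 - D)) • s = s := by rw [inv_mul_cancel₀ hD1, one_smul]
    nth_rewrite 2 [← h1]
    module
  have hiter : ∀ t : ℕ, B.mulVec ((affine M s)^[t] z) = B.mulVec z + (t : ℚ) • B.mulVec s := by
    intro t
    induction t with
    | zero => simp
    | succ t ih =>
      rw [Function.iterate_succ_apply', affine, Matrix.mulVec_add, Matrix.mulVec_mulVec, hBM, ih]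
      push_cast
      module
  obtain ⟨i, hi⟩ := Function.ne_iff.1 hBs
  obtain ⟨K, hK, hle⟩ := exists_vnorm_mulVec_le p B
  refine subexponential_of_le hK (subexponential_linear (B.mulVec z i) hi) ?_
  filter_upwards with t
  refine le_trans ?_ (hle _)
  rw [hiter]
  exact norm_apply_le_vnorm (p := p) (B.mulVec z + (t : ℚ) • B.mulVec s) i

variable {M s}

/-- Let `Q(x) = cross x (M x)` and write the orbit as `x = z' + y` with `y = M^t w`. At each step
`Q(y)` is multiplied by `D`, so it tends to 0, while `Q(z') - Q(y)` is `O(‖x‖)` by bilinearity.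
Since `Q(z') ≠ 0`, the orbit stays away from the origin. -/
theorem exists_le_vnorm_of_cross_ne_zero (hD : ‖(M.val.det : ℚ_[p])‖ < 1)
    (hT : ‖(M.val.trace : ℚ_[p])‖ ≤ 1) {z' : Fin 2 → ℚ} (hz' : affine M s z' = z')
    (hcross : cross z' (M.val.mulVec z') ≠ 0) (z : Fin 2 → ℚ) :
    Subexponential p fun t => vnorm p ((affine M s)^[t] z) := by
  obtain ⟨k, hk, hM⟩ := exists_vnorm_mulVec_le p M.val
  obtain ⟨K, hK, hup⟩ := exists_vnorm_pow_le one_pos hT (by rw [one_pow]; exact hD.le)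
  set w := z - z'
  set C := max (vnorm p (M.val.mulVec z')) (K * vnorm p w * k) with hC
  have hzpos : 0 < ‖((cross z' (M.val.mulVec z') : ℚ) : ℚ_[p])‖ :=
    norm_pos_iff.2 (by exact_mod_cast hcross)
  have hC0 : 0 ≤ C := (vnorm_nonneg _).trans (le_max_left _ _)
  have hlim : Tendsto (fun t : ℕ => ‖(M.val.det : ℚ_[p])‖ ^ t *
      ‖((cross w (M.val.mulVec w) : ℚ) : ℚ_[p])‖) atTop (𝓝 0) := by
    simpa using (tendsto_pow_atTop_nhds_zero_of_lt_one (norm_nonneg _) hD).mul_const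
      ‖((cross w (M.val.mulVec w) : ℚ) : ℚ_[p])‖
  refine subexponential_of_const_le
    (c := ‖((cross z' (M.val.mulVec z') : ℚ) : ℚ_[p])‖ / (C + 1)) (by positivity) ?_
  filter_upwards [hlim.eventually_lt_const hzpos] with t ht
  set x := (affine M s)^[t] z with hx
  set y := (M.val ^ t).mulVec w with hy
  have hxy : x = z' + y := iterate_affine_of_fixed hz' z t
  have hyy : ‖((cross y (M.val.mulVec y) : ℚ) : ℚ_[p])‖ =
      ‖(M.val.det : ℚ_[p])‖ ^ t * ‖((cross w (M.val.mulVec w) : ℚ) : ℚ_[p])‖ := by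
    have h1 : M.val.mulVec y = (M.val ^ t).mulVec (M.val.mulVec w) := by
      rw [hy, Matrix.mulVec_mulVec, Matrix.mulVec_mulVec, ← pow_succ, ← pow_succ']
    rw [h1, hy, cross_pow_mulVec, Rat.cast_mul, Rat.cast_pow, norm_mul, norm_pow]
  have hid : cross z' (M.val.mulVec z') = (cross x (M.val.mulVec z') + -cross y (M.val.mulVec x)) +
      cross y (M.val.mulVec y) := by
    rw [hxy, Matrix.mulVec_add]
    simp only [cross, Pi.add_apply]
    ring
  have h1 : ‖((cross x (M.val.mulVec z') : ℚ) : ℚ_[p])‖ ≤ C * vnorm p x := by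
    refine (norm_cross_le _ _).trans ?_
    rw [mul_comm]
    exact mul_le_mul_of_nonneg_right (le_max_left _ _) (vnorm_nonneg _)
  have h2 : ‖((-cross y (M.val.mulVec x) : ℚ) : ℚ_[p])‖ ≤ C * vnorm p x := by
    rw [Rat.cast_neg, norm_neg]
    refine (norm_cross_le _ _).trans ?_
    have hy1 : vnorm p y ≤ K * vnorm p w := by
      have h6 := hup t w
      rwa [one_pow, mul_one] at h6
    calc vnorm p y * vnorm p (M.val.mulVec x) ≤ (K * vnorm p w) * (k * vnorm p x) :=
          mul_le_mul hy1 (hM x) (vnorm_nonneg _) ((vnorm_nonneg _).trans hy1)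
      _ = (K * vnorm p w * k) * vnorm p x := by ring
      _ ≤ _ := mul_le_mul_of_nonneg_right (le_max_right _ _) (vnorm_nonneg _)
  have h3 : ‖((cross z' (M.val.mulVec z') : ℚ) : ℚ_[p])‖ ≤ C * vnorm p x := by
    have h4 := congrArg (Rat.cast : ℚ → ℚ_[p]) hid
    rw [Rat.cast_add, Rat.cast_add] at h4
    have h5 : ‖((cross z' (M.val.mulVec z') : ℚ) : ℚ_[p])‖ ≤ max (C * vnorm p x)
        ‖((cross y (M.val.mulVec y) : ℚ) : ℚ_[p])‖ := by
      rw [h4]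
      exact (Padic.nonarchimedean _ _).trans (max_le_max ((Padic.nonarchimedean _ _).trans
        (max_le h1 h2)) le_rfl)
    refine (le_max_iff.1 h5).resolve_right (not_le.2 ?_)
    rw [hyy]
    exact ht
  rw [div_le_iff₀ (by positivity)]
  linarith [vnorm_nonneg (p := p) x]

theorem exists_eigenvalue_of_cross_eq_zero {A : Matrix (Fin 2) (Fin 2) ℚ} {v : Fin 2 → ℚ}
    (hv : v ≠ 0) (h : cross v (A.mulVec v) = 0) : ∃ μ : ℚ, A.mulVec v = μ • v := by
  rw [cross, sub_eq_zero] at h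
  by_cases h0 : v 0 = 0
  · have h1 : v 1 ≠ 0 := fun h1 => hv (funext fun i => by fin_cases i <;> assumption)
    refine ⟨A.mulVec v 1 / v 1, funext fun i => ?_⟩
    fin_cases i
    · rw [h0, zero_mul, eq_comm, mul_eq_zero, or_iff_right h1] at h
      simpa [h0] using h
    · simp [h1]
  · refine ⟨A.mulVec v 0 / v 0, funext fun i => ?_⟩
    fin_cases i
    · simp [h0]
    · simp only [Fin.mk_one, Pi.smul_apply, smul_eq_mul]
      field_simp
      linarith

/-- With `ν = T - μ` the other eigenvalue, `B = M - ν` satisfies `B M = μ B`, so a coordinate of `B`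
along the orbit is `μ^t a - b` with `b ≠ 0` constant; `μ ≠ ν` because `‖μ ν‖ < 1 = ‖μ + ν‖`. If `‖μ‖
< 1`, `b` dominates. If `μ = 1`, the fixed point equation gives `s = 0`. If `μ = -1`, the lines `a =
±b` are excluded. Any other `μ` is a unit covered by `eventually_lt_norm_pow_mul_sub`. -/
theorem exists_exceptional_set_of_eigenvector (hD : ‖(M.val.det : ℚ_[p])‖ < 1)
    (hT : ‖(M.val.trace : ℚ_[p])‖ = 1) (hs : s ≠ 0) {z' : Fin 2 → ℚ} (hz' : affine M s z' = z')
    {μ : ℚ} (hμ : M.val.mulVec z' = μ • z') :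
    ∃ X : Set (Fin 2 → ℚ), HasDensity X 0 ∧ ∀ z ∉ X,
      Subexponential p fun t => vnorm p ((affine M s)^[t] z) := by
  have hz0 : z' ≠ 0 := fixed_ne_zero hs hz'
  set T := M.val.trace with hTdef
  set ν := T - μ with hν
  have hdet : μ * ν = M.val.det := by
    have h1 : (M.val * M.val).mulVec z' = (μ * μ) • z' := by
      rw [← Matrix.mulVec_mulVec, hμ, Matrix.mulVec_smul, hμ, smul_smul]
    rw [mul_self_eq_trace_smul_sub, Matrix.sub_mulVec, Matrix.smul_mulVec, Matrix.smul_mulVec,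
      Matrix.one_mulVec, hμ, smul_smul, ← sub_smul] at h1
    obtain ⟨i, hi⟩ := Function.ne_iff.1 hz0
    have h2 := congrFun h1 i
    simp only [Pi.smul_apply, smul_eq_mul] at h2
    have h3 := mul_right_cancel₀ hi h2
    rw [hν, hTdef]
    linarith
  have hμν : ‖(μ : ℚ_[p])‖ * ‖(ν : ℚ_[p])‖ < 1 := by
    rw [← norm_mul, ← Rat.cast_mul, hdet]; exact hD
  have hsum : ‖(μ : ℚ_[p]) + ν‖ = 1 := by
    rw [← Rat.cast_add, hν, add_sub_cancel]; exact hT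
  have hne : μ ≠ ν := by
    intro h
    rw [← h] at hμν hsum
    have h1 := Padic.nonarchimedean (μ : ℚ_[p]) μ
    rw [hsum, max_self] at h1
    nlinarith
  set B : Matrix (Fin 2) (Fin 2) ℚ := M.val - ν • (1 : Matrix (Fin 2) (Fin 2) ℚ) with hB
  have hBM : B * M.val = μ • B := by
    rw [hB, sub_mul, mul_self_eq_trace_smul_sub, Matrix.smul_mul, one_mul, ← hTdef, ← hdet,
      show T = μ + ν by rw [hν]; ring]
    module
  have hBpow : ∀ t w, B.mulVec ((M.val ^ t).mulVec w) = μ ^ t • B.mulVec w := by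
    intro t w
    induction t with
    | zero => simp
    | succ t ih =>
      rw [pow_succ', ← Matrix.mulVec_mulVec, Matrix.mulVec_mulVec _ B, hBM, Matrix.smul_mulVec, ih,
        smul_smul, pow_succ']
  have hBz : B.mulVec z' = (μ - ν) • z' := by
    rw [hB, Matrix.sub_mulVec, hμ, Matrix.smul_mulVec, Matrix.one_mulVec, ← sub_smul]
  have hBiter : ∀ t z, B.mulVec ((affine M s)^[t] z) = (μ - ν) • z' + μ ^ t • B.mulVec (z - z') := by
    intro t z
    rw [iterate_affine_of_fixed hz', Matrix.mulVec_add, hBz, hBpow]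
  obtain ⟨K, hK, hKle⟩ := exists_vnorm_mulVec_le p B
  obtain ⟨i, hi⟩ := Function.ne_iff.1 hz0
  rw [Pi.zero_apply] at hi
  have hb : (ν - μ) * z' i ≠ 0 := mul_ne_zero (sub_ne_zero.2 hne.symm) hi
  have hcoord : ∀ t z, ‖((μ ^ t * B.mulVec (z - z') i - (ν - μ) * z' i : ℚ) : ℚ_[p])‖ ≤
      K * vnorm p ((affine M s)^[t] z) := by
    intro t z
    refine le_trans (le_of_eq ?_) ((norm_apply_le_vnorm _ i).trans (hKle _))
    rw [hBiter, Pi.add_apply, Pi.smul_apply, Pi.smul_apply, smul_eq_mul, smul_eq_mul]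
    congr 2
    ring
  have hbn : 0 < ‖(((ν - μ) * z' i : ℚ) : ℚ_[p])‖ := norm_pos_iff.2 (by exact_mod_cast hb)
  rcases lt_or_ge ‖(μ : ℚ_[p])‖ 1 with hμ1 | hμ1
  · refine ⟨∅, by simp [HasDensity], fun z _ => ?_⟩
    have hlim : Tendsto (fun t : ℕ => ‖(μ : ℚ_[p])‖ ^ t * ‖((B.mulVec (z - z') i : ℚ) : ℚ_[p])‖)
        atTop (𝓝 0) := by
      simpa using (tendsto_pow_atTop_nhds_zero_of_lt_one (norm_nonneg _) hμ1).mul_const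
        ‖((B.mulVec (z - z') i : ℚ) : ℚ_[p])‖
    refine subexponential_of_le hK (subexponential_of_const_le (v := fun t =>
      ‖((μ ^ t * B.mulVec (z - z') i - (ν - μ) * z' i : ℚ) : ℚ_[p])‖) hbn ?_)
      (Eventually.of_forall fun t => hcoord t z)
    filter_upwards [hlim.eventually_lt_const hbn] with t ht
    rw [← norm_pow, ← norm_mul, ← Rat.cast_pow, ← Rat.cast_mul] at ht
    generalize μ ^ t * B.mulVec (z - z') i = a at ht ⊢
    generalize (ν - μ) * z' i = b at ht ⊢
    rw [Rat.cast_sub, sub_eq_add_neg, Padic.add_eq_max_of_ne (by rw [norm_neg]; exact ht.ne),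
      norm_neg]
    exact le_max_right _ _
  · have hμ1' : ‖(μ : ℚ_[p])‖ = 1 := by
      have h1 : ‖(ν : ℚ_[p])‖ < 1 := by
        by_contra! h2
        nlinarith
      have h2 := Padic.nonarchimedean ((μ : ℚ_[p]) + (ν : ℚ_[p])) (-(ν : ℚ_[p]))
      rw [hsum, norm_neg, add_neg_cancel_right, max_eq_left h1.le] at h2
      exact le_antisymm h2 hμ1
    by_cases habs : |μ| = 1
    · rcases (abs_eq zero_le_one).1 habs with h1 | h1
      · exfalso
        rw [affine, hμ, h1, one_smul, add_eq_left] at hz'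
        exact hs hz'
      -- Row `i` of `B` is nonzero, since otherwise `(μ - ν) * z' i = 0`; hence the level sets of
      -- this coordinate are lines.
      · have hline : ∀ c : ℚ, HasDensity {z | B.mulVec (z - z') i = c} 0 := by
          intro c
          have hrow : (![-B i 1, B i 0] : Fin 2 → ℚ) ≠ 0 := by
            intro h0
            have e0 : B i 0 = 0 := congrFun h0 1
            have e1 : B i 1 = 0 := neg_eq_zero.1 (congrFun h0 0)
            have e2 := congrFun hBz i
            rw [Matrix.mulVec, dotProduct, Fin.sum_univ_two, e0, e1, Pi.smul_apply, smul_eq_mul] at e2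
            exact hb (by linarith)
          refine hasDensity_zero_of_collinear hrow fun x hx y hy => ?_
          have hx' : B.mulVec (x - z') i = c := hx
          have hy' : B.mulVec (y - z') i = c := hy
          simp only [Matrix.mulVec, dotProduct, Fin.sum_univ_two, Pi.sub_apply] at hx' hy'
          simp only [Matrix.cons_val_zero, Matrix.cons_val_one, Pi.sub_apply]
          linarith
        refine ⟨_, (hline ((ν - μ) * z' i)).union_zero (hline (-((ν - μ) * z' i))), fun z hz => ?_⟩
        have hz1 : B.mulVec (z - z') i ≠ (ν - μ) * z' i := fun h => hz (Or.inl h)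
        have hz2 : B.mulVec (z - z') i ≠ -((ν - μ) * z' i) := fun h => hz (Or.inr h)
        set a := B.mulVec (z - z') i
        set b := (ν - μ) * z' i
        have hp1 : 0 < ‖((a - b : ℚ) : ℚ_[p])‖ :=
          norm_pos_iff.2 (by exact_mod_cast sub_ne_zero.2 hz1)
        have hp2 : 0 < ‖((-a - b : ℚ) : ℚ_[p])‖ :=
          norm_pos_iff.2 (by exact_mod_cast fun h => hz2 (by linarith))
        refine subexponential_of_le hK (subexponential_of_const_le (v := fun t =>
          ‖((μ ^ t * a - b : ℚ) : ℚ_[p])‖) (lt_min hp1 hp2) ?_)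
          (Eventually.of_forall fun t => hcoord t z)
        filter_upwards with t
        rcases neg_one_pow_eq_or ℚ t with ht | ht
        · rw [h1, ht, one_mul]
          exact min_le_left _ _
        · rw [h1, ht, neg_one_mul]
          exact min_le_right _ _
    · refine ⟨∅, by simp [HasDensity], fun z _ => ?_⟩
      refine subexponential_of_le (u := fun t =>
        ‖((μ ^ t * B.mulVec (z - z') i - (ν - μ) * z' i : ℚ) : ℚ_[p])‖) hK (fun ε hε => ?_)
        (Eventually.of_forall fun t => hcoord t z)
      filter_upwards [eventually_lt_norm_pow_mul_sub (B.mulVec (z - z') i) hμ1' habs hb hε] with t ht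
      exact ht.le

variable (M)

theorem almostAll_affine_of_trace_unit (hD : ‖(M.val.det : ℚ_[p])‖ < 1)
    (hT : ‖(M.val.trace : ℚ_[p])‖ = 1) (hs : s ≠ 0) :
    AlmostAll fun z => HasLocalHeight p (affine M s) z 0 := by
  have hexc : ∃ X : Set (Fin 2 → ℚ), HasDensity X 0 ∧ ∀ z ∉ X,
      Subexponential p fun t => vnorm p ((affine M s)^[t] z) := by
    by_cases hfix : ∃ z, affine M s z = z
    · obtain ⟨z', hz'⟩ := hfix
      by_cases hcross : cross z' (M.val.mulVec z') = 0
      · obtain ⟨μ, hμ⟩ := exists_eigenvalue_of_cross_eq_zero (fixed_ne_zero hs hz') hcross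
        exact exists_exceptional_set_of_eigenvector hD hT hs hz' hμ
      · exact ⟨∅, by simp [HasDensity], fun z _ =>
          exists_le_vnorm_of_cross_ne_zero hD hT.le hz' hcross z⟩
    · exact ⟨∅, by simp [HasDensity], fun z _ => subexponential_of_no_fixed_point M s hD hfix z⟩
  obtain ⟨X, hX, h⟩ := hexc
  refine almostAll_of_hasDensity_zero hX fun z hz => ?_
  obtain ⟨C, hC⟩ := exists_vnorm_iterate_le M s hT.le hD.le z
  have := hasLocalHeight_of_bounds (p := p) (F := affine M s) (z := z) one_pos C
    (by filter_upwards with t; rw [one_pow, mul_one]; exact hC t)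
    (fun ε hε => by
      filter_upwards [h z hz ε hε] with t ht
      rwa [one_pow, mul_one])
  simpa using this

end

/-! ### Translation into orders -/

section
variable {p : ℕ} [Fact p.Prime]

theorem two_mul_ord_lt_iff {T D : ℚ} (hD : D ≠ 0) :
    2 * ord p T < ord p D ↔ ‖(D : ℚ_[p])‖ < ‖(T : ℚ_[p])‖ ^ 2 := by
  have hd : 0 < ‖(D : ℚ_[p])‖ := norm_pos_iff.2 (by exact_mod_cast hD)
  by_cases hT : T = 0
  · rw [hT, ord_zero, ord_eq hD, EReal.mul_top_of_pos (by norm_num)]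
    simp only [not_top_lt, false_iff, not_lt]
    rw [Rat.cast_zero, norm_zero, zero_pow two_ne_zero]
    exact hd.le
  · have ht : 0 < ‖(T : ℚ_[p])‖ := norm_pos_iff.2 (by exact_mod_cast hT)
    rw [ord_eq hT, ord_eq hD, ← Real.logb_lt_logb_iff (one_lt_prime_cast p) hd (by positivity),
      Real.logb_pow, show (2 : EReal) = ((2 : ℝ) : EReal) from rfl, ← EReal.coe_mul,
      EReal.coe_lt_coe_iff]
    push_cast
    constructor <;> intro h <;> linarith

theorem neg_ord_eq {r : ℚ} (hr : r ≠ 0) : -ord p r = ((Real.logb p ‖(r : ℚ_[p])‖ : ℝ) : EReal) := by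
  rw [ord_eq hr, ← EReal.coe_neg, neg_neg]

theorem neg_ord_div_two_eq {r : ℚ} (hr : r ≠ 0) :
    -ord p r / 2 = ((Real.logb p √‖(r : ℚ_[p])‖ : ℝ) : EReal) := by
  rw [neg_ord_eq hr, show (2 : EReal) = ((2 : ℝ) : EReal) from rfl, ← EReal.coe_div,
    Real.sqrt_eq_rpow, Real.logb_rpow_eq_mul_logb_of_pos (norm_pos_iff.2 (by exact_mod_cast hr))]
  congr 1
  ring

theorem max_logb_zero_of_one_lt {x : ℝ} (hx : 1 < x) :
    max ((Real.logb p x : ℝ) : EReal) 0 = ((Real.logb p x : ℝ) : EReal) :=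
  max_eq_left (by exact_mod_cast (Real.logb_pos (one_lt_prime_cast p) hx).le)

theorem max_logb_zero_of_le_one {x : ℝ} (hx0 : 0 ≤ x) (hx : x ≤ 1) :
    max ((Real.logb p x : ℝ) : EReal) 0 = 0 :=
  max_eq_right (by exact_mod_cast Real.logb_nonpos (one_lt_prime_cast p) hx0 hx)

end

end AffineHeight

/-! ### Assembly of the cases. -/

theorem mainTheorem1 (p : ℕ) (hp : p.Prime) (M : GL (Fin 2) ℚ) (s : Fin 2 → ℚ) (T D : ℚ)
    (hT : T = Matrix.trace (M : Matrix (Fin 2) (Fin 2) ℚ))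
    (hD : D = Matrix.det (M : Matrix (Fin 2) (Fin 2) ℚ)) :
    (s = 0 →
      (2 * AffineHeight.ord p T < AffineHeight.ord p D →
        AffineHeight.AlmostAll fun z =>
          AffineHeight.HasLocalHeight p (AffineHeight.affine M s) z (-AffineHeight.ord p T)) ∧
      (AffineHeight.ord p D ≤ 2 * AffineHeight.ord p T →
        AffineHeight.AlmostAll fun z =>
          AffineHeight.HasLocalHeight p (AffineHeight.affine M s) z
            (-AffineHeight.ord p D / 2))) ∧
    (s ≠ 0 →
      (2 * AffineHeight.ord p T < AffineHeight.ord p D →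
        AffineHeight.AlmostAll fun z =>
          AffineHeight.HasLocalHeight p (AffineHeight.affine M s) z
            (max (-AffineHeight.ord p T) 0)) ∧
      (AffineHeight.ord p D ≤ 2 * AffineHeight.ord p T →
        AffineHeight.AlmostAll fun z =>
          AffineHeight.HasLocalHeight p (AffineHeight.affine M s) z
            (max (-AffineHeight.ord p D / 2) 0))) := by
  have : Fact p.Prime := ⟨hp⟩
  have hD0 : D ≠ 0 := hD ▸ AffineHeight.det_coe_ne_zero M
  have hT0 : ‖(D : ℚ_[p])‖ < ‖(T : ℚ_[p])‖ ^ 2 → T ≠ 0 := by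
    rintro h rfl
    rw [Rat.cast_zero, norm_zero, zero_pow two_ne_zero] at h
    exact h.not_ge (norm_nonneg _)
  -- The two alternatives on orders are complementary, so one translation into norms serves both.
  rw [← not_lt, AffineHeight.two_mul_ord_lt_iff hD0, not_lt, AffineHeight.neg_ord_div_two_eq hD0]
  refine ⟨?_, fun hs => ⟨fun h => ?_, fun h => ?_⟩⟩
  · rintro rfl
    refine ⟨fun h => ?_, fun h => ?_⟩
    · rw [AffineHeight.neg_ord_eq (hT0 h)]
      subst hT hD
      exact AffineHeight.almostAll_linear_of_lt M h
    · subst hT hD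
      exact AffineHeight.almostAll_linear_of_le M h
  · rw [AffineHeight.neg_ord_eq (hT0 h)]
    subst hT hD
    rcases lt_trichotomy ‖(M.val.trace : ℚ_[p])‖ 1 with h1 | h1 | h1
    · rw [AffineHeight.max_logb_zero_of_le_one (norm_nonneg _) h1.le]
      exact AffineHeight.almostAll_affine_of_contracting M s hs h1
        (h.trans_le (pow_le_one₀ (norm_nonneg _) h1.le))
    · rw [AffineHeight.max_logb_zero_of_le_one (norm_nonneg _) h1.le]
      exact AffineHeight.almostAll_affine_of_trace_unit M
        (h.trans_le (pow_le_one₀ (norm_nonneg _) h1.le)) h1 hs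
    · rw [AffineHeight.max_logb_zero_of_one_lt h1]
      exact AffineHeight.almostAll_affine_of_trace_expanding M s h1 h
  · subst hT hD
    rcases lt_trichotomy ‖(M.val.det : ℚ_[p])‖ 1 with h1 | h1 | h1
    · rw [AffineHeight.max_logb_zero_of_le_one (Real.sqrt_nonneg _) (Real.sqrt_le_one.2 h1.le)]
      exact AffineHeight.almostAll_affine_of_contracting M s hs
        ((pow_lt_one_iff_of_nonneg (norm_nonneg _) two_ne_zero).1 (h.trans_lt h1)) h1
    · rw [AffineHeight.max_logb_zero_of_le_one (Real.sqrt_nonneg _) (Real.sqrt_le_one.2 h1.le)]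
      exact AffineHeight.almostAll_affine_of_det_unit M s
        ((pow_le_one_iff_of_nonneg (norm_nonneg _) two_ne_zero).1 (h.trans_eq h1)) h1
    · rw [AffineHeight.max_logb_zero_of_one_lt (by rwa [Real.lt_sqrt zero_le_one, one_pow])]
      exact AffineHeight.almostAll_affine_of_det_expanding M s h1 h
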